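/- For a meromorphic function $f$ on $\mathbb{C}$ let $T(r,f)$ be its Nevanlinna characteristic and let $\rho(f)=\limsup_{r\to\infty}\frac{\log^+T(r,f)}{\log r}\in[0,\infty]$ be its order. An L-function (an element of the extended Selberg class) is a Dirichlet series $L(s)=\sum_{n\ge1}a(n)n^{-s}$ with $a(1)=1$, identified with its meromorphic continuation to $\mathbb{C}$, such that (i) $a(n)\ll n^{\varepsilon}$ for every $\varepsilon>0$; (ii) for some integer $k\ge0$ the function $(s-1)^kL(s)$ is entire of finite order; (iii) there are $K\ge0$, $Q>0$, $\lambda_j>0$, $\mu_j$ with $\operatorname{Re}\mu_j\ge0$ $(1\le j\le K)$ and $\omega$ with $|\omega|=1$ such that $\Lambda_L(s)=L(s)Q^s\prod_{j=1}^K\Gamma(\lambda_js+\mu_j)$ satisfies $\Lambda_L(s)=\omega\overline{\Lambda_L(1-\overline{s})}$. Theorem. Let $h$ be a non-constant entire function with $\rho(h)\ne1$ (infinite order is allowed), and let $L_1,L_2$ be L-functions such that $L_1-h$ and $L_2-h$ have the same zeros counting multiplicities. Then $L_1\equiv L_2$. The condition $\rho(h)\neq1$ cannot be dropped: the functions $L_1(s)=1+\frac{2}{4^s}$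 and $L_2(s)=1+\frac{3}{9^s}$ are distinct L-functions, $h=L_1+L_2-1$ is a non-constant entire function with $\rho(h)=1$, and $L_1-h$ and $L_2-h$ have no zeros, hence the same zeros counting multiplicities. -/

import Mathlib

open Filter Topology

noncomputable section

/-- The order `ρ(f) = limsup_{r → ∞} log⁺ T(r, f) / log r` of a meromorphic function on `ℂ`, where
`T(r, f) = m(r, f) + N(r, f)` is the Nevanlinna characteristic. The values are extended reals, so
that infinite order is `⊤`. -/
def nevanlinnaOrder (f : ℂ → ℂ) : EReal :=
  limsup (fun r : ℝ =>
    ((Real.posLog (ValueDistribution.characteristic f ⊤ r) / Real.log r : ℝ) : EReal)) atTop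

/-- The completed function `Λ_L(s) = L(s) Q^s ∏_{j=1}^K Γ(λ_j s + μ_j)`. -/
def completedLFun (L : ℂ → ℂ) (Q : ℝ) {K : ℕ} (lam : Fin K → ℝ) (mu : Fin K → ℂ) (s : ℂ) : ℂ :=
  L s * (Q : ℂ) ^ s * ∏ j, Complex.Gamma ((lam j : ℂ) * s + mu j)

/-- `L` belongs to the extended Selberg class. The Dirichlet series is identified with its
meromorphic continuation to `ℂ`, taken in normal form: it is analytic wherever it is regular, and
its value at a pole is `0` by convention. So equality of functions is equality of meromorphic
functions. -/
structure IsLFunction (L : ℂ → ℂ) : Prop where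
  /-- `L` is meromorphic on `ℂ`, without spurious values at removable singularities. -/
  meromorphicNF : MeromorphicNFOn L Set.univ
  /-- `L` is given on `Re s > 1` by a Dirichlet series with `a(1) = 1` and `a(n) ≪ n^ε` for every
  `ε > 0` (so that the series converges absolutely there). -/
  dirichletSeries : ∃ a : ℕ → ℂ, a 1 = 1 ∧
    (∀ ε : ℝ, 0 < ε → ∃ C : ℝ, ∀ n : ℕ, 1 ≤ n → ‖a n‖ ≤ C * (n : ℝ) ^ ε) ∧
    ∀ s : ℂ, 1 < s.re → L s = LSeries a s
  /-- For some `k ≥ 0`, `(s - 1)^k L(s)` is an entire function of finite order. -/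
  continuation : ∃ (k : ℕ) (F : ℂ → ℂ), Differentiable ℂ F ∧ nevanlinnaOrder F < ⊤ ∧
    ∀ s : ℂ, s ≠ 1 → F s = (s - 1) ^ k * L s
  /-- The functional equation, an identity of meromorphic functions (that is, off a closed discrete
  set, which contains the poles of both sides). -/
  functionalEquation : ∃ (K : ℕ) (Q : ℝ) (lam : Fin K → ℝ) (mu : Fin K → ℂ) (ω : ℂ),
    0 < Q ∧ (∀ j, 0 < lam j) ∧ (∀ j, 0 ≤ (mu j).re) ∧ ‖ω‖ = 1 ∧
    completedLFun L Q lam mu =ᶠ[codiscrete ℂ]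
      fun s => ω * starRingEnd ℂ (completedLFun L Q lam mu (1 - starRingEnd ℂ s))

/-- The multiplicity of `s` as a zero of the meromorphic function `f`; it is `0` if `s` is not a
zero (in particular if it is a pole), and `⊤` if `f` vanishes identically near `s`. -/
def zeroMultiplicity (f : ℂ → ℂ) (s : ℂ) : WithTop ℤ :=
  max (meromorphicOrderAt f s) 0

/-- The meromorphic functions `f` and `g` have the same zeros counting multiplicities. -/
def SameZerosCM (f g : ℂ → ℂ) : Prop :=
  ∀ s : ℂ, zeroMultiplicity f s = zeroMultiplicity g s

end

/-!
Suppose that `L₁ ≠ L₂`, and put `E i = (s - 1) ^ k (L i - h)` with `k` large enough for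
`F i = (s - 1) ^ k L i` to be entire. Since `E 1` and `E 2` have the same zeros off `s = 1`, one of
them, say `E 1`, is `f E 2` with `f = (s - 1) ^ m exp g` (`exists_eq_sub_pow_mul_exp_mul`). The
entire function `(f - 1) E 2 = F 1 - F 2` does not involve `h`, and it has order at most `1`: by the
functional equation, Stirling-type bounds for `Γ` and the finiteness of the order, each `F i` is
`exp (O(|s| ^ τ))` for every `τ > 1` (`IsLFunction.exists_differentiable`). So `f - 1` has few
zeros, and Borel's unicity argument (`exists_proximity_exp_le_log`) bounds the growth of `exp g`;
this makes `g` affine (`exists_eq_affine_of_sub_pow_mul_exp`).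

Now `h` has order exactly `1`. The upper bound is the first main theorem applied to `f - 1` in
`(f - 1) E 2 = F 1 - F 2` (`nevanlinnaOrder_le_one_of_eq_mul`). For the lower bound, write
`(h - 1) (1 - f) = (L₁ - 1) - f (L₂ - 1)`. In some sector inside `Re s > 0` the function `f` tends to
`0`, to `∞`, or to a constant different from `1`, so that `h - 1` inherits the exponential decay of
`L₁ - 1` and `L₂ - 1`; by the first main theorem, applied to `h - 1`, a nonconstant entire function
that approximates `1` so well in a sector grows exponentially (`one_le_nevanlinnaOrder_of_arc`).
This contradicts `ρ(h) ≠ 1`.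

Only characteristics of entire functions occur, which are equal to the proximity function
`proximity F ⊤`. The analytic tool for them is a Poisson-Jensen inequality
(`posLog_norm_le_mul_proximity`), which turns bounds on `proximity F ⊤` into pointwise ones.

For the example, `L₁ - h` and `L₂ - h` have the zero-free quotient `(3 / 2) (4 / 9) ^ s`, and the
lower bound `1 ≤ ρ(h)` is the same sector argument.
-/


section

open Metric Set ValueDistribution Asymptotics
open scoped Real

/-! ### Proximity functions of entire functions -/

theorem Differentiable.meromorphic' {F : ℂ → ℂ} (hF : Differentiable ℂ F) : Meromorphic F :=
  fun z => (hF.analyticAt z).meromorphicAt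

theorem logCounting_top_of_differentiable {F : ℂ → ℂ} (hF : Differentiable ℂ F) :
    logCounting F ⊤ = 0 := by
  have h := logCounting_add_analyticOn (f := fun _ : ℂ => (0 : ℂ)) (g := F)
    (fun z => analyticAt_const.meromorphicAt) (fun z _ => (hF.analyticAt z).analyticWithinAt)
  have h0 : (fun _ : ℂ => (0 : ℂ)) + F = F := by ext; simp
  rw [h0] at h
  rw [h]
  simp

theorem characteristic_top_of_differentiable {F : ℂ → ℂ} (hF : Differentiable ℂ F) :
    characteristic F ⊤ = proximity F ⊤ := by
  simp [characteristic, logCounting_top_of_differentiable hF]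

theorem proximity_top_mono {F : ℂ → ℂ} (hF : Differentiable ℂ F) {r R : ℝ} (hr : 0 < r)
    (hrR : r ≤ R) : proximity F ⊤ r ≤ proximity F ⊤ R := by
  rw [← characteristic_top_of_differentiable hF]
  exact characteristic_monotoneOn hF.meromorphic' hr (hr.trans_le hrR) hrR

/-- A form of the first main theorem: the proximity function of `1 / F` is controlled by that
of the entire function `F`. -/
theorem proximity_inv_le_sub_log {F : ℂ → ℂ} (hF : Differentiable ℂ F) {r : ℝ} (hr : 1 ≤ r) :
    proximity F⁻¹ ⊤ r ≤ proximity F ⊤ r - Real.log ‖meromorphicTrailingCoeffAt F 0‖ := by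
  have h := characteristic_sub_characteristic_inv_of_ne_zero hF.meromorphic'
    (R := r) (by positivity)
  rw [characteristic_top_of_differentiable hF] at h
  have h2 : proximity F⁻¹ ⊤ r ≤ characteristic F⁻¹ ⊤ r :=
    le_add_of_nonneg_right (logCounting_nonneg hr)
  linarith

theorem proximity_inv_le {F : ℂ → ℂ} (hF : Differentiable ℂ F) (h0 : F 0 ≠ 0) {r : ℝ}
    (hr : 1 ≤ r) : proximity F⁻¹ ⊤ r ≤ proximity F ⊤ r - Real.log ‖F 0‖ := by
  have h := proximity_inv_le_sub_log hF hr
  rwa [(hF.analyticAt 0).meromorphicTrailingCoeffAt_of_ne_zero h0] at h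

theorem Meromorphic.circleIntegrable_posLog {F : ℂ → ℂ} (hF : Meromorphic F) (r : ℝ) :
    CircleIntegrable (fun z => Real.posLog ‖F z‖) 0 r :=
  MeromorphicOn.circleIntegrable_posLog_norm fun z _ => hF z

theorem proximity_top_le_of_forall {F : ℂ → ℂ} (hF : Meromorphic F) {r B : ℝ} (hr : 0 ≤ r)
    (h : ∀ z, ‖z‖ = r → Real.posLog ‖F z‖ ≤ B) : proximity F ⊤ r ≤ B := by
  rw [proximity_top]
  refine Real.circleAverage_mono_on_of_le_circle (hF.circleIntegrable_posLog r) fun z hz => ?_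
  rw [abs_of_nonneg hr] at hz
  exact h z (by simpa using hz)

theorem proximity_add_le {F G : ℂ → ℂ} (hF : Meromorphic F) (hG : Meromorphic G) (r : ℝ) :
    proximity (fun z => F z + G z) ⊤ r
      ≤ proximity F ⊤ r + proximity G ⊤ r + Real.log 2 :=
  proximity_add_top_le hF hG r

theorem proximity_neg_top {F : ℂ → ℂ} (r : ℝ) :
    proximity (fun z => -F z) ⊤ r = proximity F ⊤ r := by
  simp [proximity_top]

theorem proximity_sub_le {F G : ℂ → ℂ} (hF : Meromorphic F) (hG : Meromorphic G) (r : ℝ) :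
    proximity (fun z => F z - G z) ⊤ r
      ≤ proximity F ⊤ r + proximity G ⊤ r + Real.log 2 := by
  have h := proximity_add_le (G := fun z => -G z) hF (hG.neg) r
  simpa only [proximity_neg_top, ← sub_eq_add_neg] using h

theorem proximity_mul_le {F G : ℂ → ℂ} (hF : Meromorphic F) (hG : Meromorphic G) (r : ℝ) :
    proximity (fun z => F z * G z) ⊤ r ≤ proximity F ⊤ r + proximity G ⊤ r :=
  proximity_mul_top_le hF hG r

theorem proximity_top_congr {F G : ℂ → ℂ} {r : ℝ} (hr : 0 ≤ r)
    (h : ∀ z, ‖z‖ = r → F z = G z) : proximity F ⊤ r = proximity G ⊤ r := by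
  rw [proximity_top, proximity_top]
  refine Real.circleAverage_congr_sphere fun z hz => ?_
  rw [abs_of_nonneg hr] at hz
  simp only [h z (by simpa using hz)]

/-- A zero-free entire function (on a closed disc) has the same proximity to `0` and `∞`, up to the
value at the centre. -/
theorem proximity_eq_of_ne_zero {V : ℂ → ℂ} (hV : Differentiable ℂ V) {r : ℝ} (hr : 0 ≤ r)
    (h : ∀ z, ‖z‖ ≤ r → V z ≠ 0) :
    proximity V ⊤ r = proximity V⁻¹ ⊤ r + Real.log ‖V 0‖ := by
  have h1 := congrFun (proximity_sub_proximity_inv_eq_circleAverage hV.meromorphic') r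
  have h2 := AnalyticOnNhd.circleAverage_log_norm_of_ne_zero (R := r) (c := 0) (g := V)
    (fun z _ => hV.analyticAt z) (fun z hz => h z (by simpa [abs_of_nonneg hr] using hz))
  simp only [Pi.sub_apply] at h1
  linarith

/-! ### Splitting off zeros and the Poisson-Jensen inequality -/

/-- The polynomial `∏ (1 - z / a)` with value `1` at the origin and zeros listed in `l`. -/
noncomputable def normalizedZeroProd (l : List ℂ) (z : ℂ) : ℂ := (l.map fun a => 1 - z / a).prod

@[simp] theorem normalizedZeroProd_nil (z : ℂ) : normalizedZeroProd [] z = 1 := by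
  simp [normalizedZeroProd]

@[simp] theorem normalizedZeroProd_cons (a : ℂ) (l : List ℂ) (z : ℂ) :
    normalizedZeroProd (a :: l) z = (1 - z / a) * normalizedZeroProd l z := by
  simp [normalizedZeroProd]

theorem normalizedZeroProd_zero (l : List ℂ) : normalizedZeroProd l 0 = 1 := by
  induction l with
  | nil => simp
  | cons a l ih => simp [ih]

theorem differentiable_normalizedZeroProd (l : List ℂ) :
    Differentiable ℂ (normalizedZeroProd l) := by
  induction l with
  | nil => simp [funext fun z => normalizedZeroProd_nil z]
  | cons a l ih =>
    rw [funext fun z => normalizedZeroProd_cons a l z]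
    exact ((differentiable_const _).sub (differentiable_id.div_const a)).mul ih

theorem norm_normalizedZeroProd_le {l : List ℂ} {δ : ℝ} (hδ : 0 < δ) (hl : ∀ a ∈ l, δ ≤ ‖a‖)
    {z : ℂ} {r : ℝ} (hz : ‖z‖ ≤ r) : ‖normalizedZeroProd l z‖ ≤ (1 + r / δ) ^ l.length := by
  have hr : 0 ≤ r := (norm_nonneg z).trans hz
  induction l with
  | nil => simp
  | cons a l ih =>
    have ha : δ ≤ ‖a‖ := hl a (by simp)
    have h1 : ‖1 - z / a‖ ≤ 1 + r / δ := by
      refine (norm_sub_le _ _).trans ?_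
      rw [norm_one, norm_div]
      gcongr
    rw [normalizedZeroProd_cons, norm_mul, List.length_cons, pow_succ']
    exact mul_le_mul h1 (ih fun b hb => hl b (by simp [hb])) (norm_nonneg _) (by positivity)

theorem two_pow_le_norm_normalizedZeroProd {l : List ℂ} {R : ℝ}
    (hl : ∀ a ∈ l, a ≠ 0 ∧ ‖a‖ ≤ R) {z : ℂ} (hz : 3 * R ≤ ‖z‖) :
    2 ^ l.length ≤ ‖normalizedZeroProd l z‖ := by
  induction l with
  | nil => simp
  | cons a l ih =>
    obtain ⟨ha0, haR⟩ := hl a (by simp)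
    have hpos : 0 < ‖a‖ := norm_pos_iff.2 ha0
    have h3 : 3 ≤ ‖z / a‖ := by
      rw [norm_div, le_div_iff₀ hpos]
      linarith
    have h1 : 2 ≤ ‖1 - z / a‖ := by
      have := norm_sub_norm_le (z / a) 1
      rw [norm_sub_rev, norm_one] at this
      linarith
    rw [normalizedZeroProd_cons, norm_mul, List.length_cons, pow_succ']
    exact mul_le_mul h1 (ih fun b hb => hl b (by simp [hb])) (by positivity) (norm_nonneg _)

/-- A multiple `P * W` of `P = ∏ (1 - z / a)`, with all `‖a‖ ≤ R`, which is bounded by `M` on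
`‖z‖ = 3 R`, satisfies `2 ^ deg P ≤ M / ‖W 0‖`: Jensen's bound for the number of zeros. -/
theorem two_pow_mul_norm_le {l : List ℂ} {R M : ℝ} (hR : 0 < R)
    (hl : ∀ a ∈ l, a ≠ 0 ∧ ‖a‖ ≤ R) {W : ℂ → ℂ} (hW : Differentiable ℂ W)
    (hM : ∀ z, ‖z‖ = 3 * R → ‖normalizedZeroProd l z * W z‖ ≤ M) :
    2 ^ l.length * ‖W 0‖ ≤ M := by
  have h2 : (0 : ℝ) < 2 ^ l.length := by positivity
  have h : ‖W 0‖ ≤ M / 2 ^ l.length := by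
    refine Complex.norm_le_of_forall_mem_frontier_norm_le (U := ball 0 (3 * R)) isBounded_ball
      hW.diffContOnCl (fun z hz => ?_) (subset_closure (by simpa using hR))
    rw [frontier_ball _ (by positivity)] at hz
    have hz' : ‖z‖ = 3 * R := by simpa using hz
    rw [le_div_iff₀ h2]
    have := hM z hz'
    rw [norm_mul] at this
    have h3 := two_pow_le_norm_normalizedZeroProd hl hz'.ge
    nlinarith [norm_nonneg (W z)]
  rw [le_div_iff₀ h2] at h
  linarith

theorem exists_eq_one_sub_div_mul {F : ℂ → ℂ} (hF : Differentiable ℂ F) {a : ℂ} (ha : a ≠ 0)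
    (h0 : F a = 0) : ∃ V : ℂ → ℂ, Differentiable ℂ V ∧ ∀ z, F z = (1 - z / a) * V z := by
  refine ⟨fun z => -a * dslope F a z, ?_, fun z => ?_⟩
  · refine (differentiable_const _).mul ?_
    rw [← differentiableOn_univ]
    exact (Complex.differentiableOn_dslope (by simp)).2 hF.differentiableOn
  · have h := sub_smul_dslope F a z
    rw [h0, sub_zero, smul_eq_mul] at h
    rw [← h]
    field_simp
    ring

/-- The zeros of an entire function in a bounded set can be split off as a polynomial. -/
theorem exists_eq_normalizedZeroProd_mul {F : ℂ → ℂ} (hF : Differentiable ℂ F) (h0 : F 0 ≠ 0)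
    {S : Set ℂ} {R : ℝ} (hR : 0 < R) (hS : ∀ a ∈ S, ‖a‖ ≤ R) :
    ∃ (l : List ℂ) (V : ℂ → ℂ), (∀ a ∈ l, a ∈ S ∧ F a = 0) ∧ Differentiable ℂ V ∧
      (∀ z, F z = normalizedZeroProd l z * V z) ∧ ∀ z ∈ S, V z ≠ 0 := by
  by_contra hcon
  push Not at hcon
  have key : ∀ n : ℕ, ∃ (l : List ℂ) (V : ℂ → ℂ), l.length = n ∧ (∀ a ∈ l, a ∈ S ∧ F a = 0) ∧
      Differentiable ℂ V ∧ ∀ z, F z = normalizedZeroProd l z * V z := by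
    intro n
    induction n with
    | zero => exact ⟨[], F, rfl, by simp, hF, by simp⟩
    | succ n ih =>
      obtain ⟨l, V, hn, hl, hV, hFV⟩ := ih
      obtain ⟨a, haS, ha⟩ := hcon l V hl hV hFV
      have hFa : F a = 0 := by rw [hFV, ha, mul_zero]
      have ha0 : a ≠ 0 := by rintro rfl; exact h0 hFa
      obtain ⟨W, hW, hVW⟩ := exists_eq_one_sub_div_mul hV ha0 ha
      refine ⟨a :: l, W, by simp [hn], ?_, hW, fun z => ?_⟩
      · intro b hb
        rcases List.mem_cons.1 hb with rfl | hb
        · exact ⟨haS, hFa⟩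
        · exact hl b hb
      · rw [hFV, hVW, normalizedZeroProd_cons]
        ring
  obtain ⟨M, hM⟩ := (isCompact_sphere (0 : ℂ) (3 * R)).exists_bound_of_continuousOn
    hF.continuous.continuousOn
  obtain ⟨n, hn⟩ := pow_unbounded_of_one_lt (M / ‖F 0‖) (one_lt_two)
  obtain ⟨l, V, hln, hl, hV, hFV⟩ := key n
  have h := two_pow_mul_norm_le (M := M) hR
    (fun a ha => ⟨fun h => h0 (h ▸ (hl a ha).2), hS a (hl a ha).1⟩) hV
    (fun z hz => by rw [← hFV]; exact hM z (by simpa using hz))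
  have hV0 : V 0 = F 0 := by rw [hFV, normalizedZeroProd_zero, one_mul]
  rw [hV0, hln] at h
  rw [div_lt_iff₀ (norm_pos_iff.2 h0)] at hn
  linarith

/-- The Poisson integral bounds `log ‖G‖` inside a disc in terms of its positive part on the
boundary circle, for zero-free `G`. -/
theorem log_norm_le_mul_proximity_of_ne_zero {G : ℂ → ℂ} {t : ℝ} (hG : Differentiable ℂ G)
    (hG0 : ∀ z, ‖z‖ ≤ t → G z ≠ 0) {w : ℂ} (hw : ‖w‖ < t) :
    Real.log ‖G w‖ ≤ (t + ‖w‖) / (t - ‖w‖) * proximity G ⊤ t := by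
  have ht : 0 < t := (norm_nonneg w).trans_lt hw
  have hw' : w ∈ ball (0 : ℂ) t := by simpa using hw
  have hP := InnerProductSpace.HarmonicOnNhd.circleAverage_re_herglotzRieszKernel_smul
    (f := fun z => Real.log ‖G z‖) (c := 0) (R := t) (w := w)
    (fun z hz => (hG.analyticAt z).harmonicAt_log_norm (hG0 z (by simpa using hz))) hw'
  rw [← hP, proximity_top, ← smul_eq_mul, ← Real.circleAverage_fun_smul]
  have hcont : ContinuousOn (fun z => Real.log ‖G z‖) (sphere 0 t) := by
    refine ContinuousOn.log hG.continuous.norm.continuousOn fun z hz => ?_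
    exact norm_ne_zero_iff.2 (hG0 z (by simpa using (mem_sphere.1 hz).le))
  have hK : ContinuousOn (Complex.re ∘ herglotzRieszKernel 0 w) (sphere 0 t) := by
    refine Complex.continuous_re.comp_continuousOn ?_
    rw [herglotzRieszKernel_fun_def]
    refine ContinuousOn.div (by fun_prop) (by fun_prop) fun z hz h => ?_
    have : z = w := by simpa [sub_eq_zero] using h
    rw [← this] at hw
    simp only [mem_sphere, dist_zero_right] at hz
    linarith
  refine Real.circleAverage_mono ?_ ?_ fun z hz => ?_
  · exact (ContinuousOn.smul hK hcont).circleIntegrable ht.le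
  · exact (hG.meromorphic'.circleIntegrable_posLog t).const_fun_smul
  · rw [abs_of_pos ht] at hz
    have h1 := re_herglotzRieszKernel_le hz hw'
    have h2 := le_re_herglotzRieszKernel hz hw'
    simp only [sub_zero] at h1 h2
    simp only [Pi.smul_apply', Function.comp_apply, smul_eq_mul, herglotzRieszKernel_def, sub_zero]
    have h3 : 0 ≤ ((z + w) / (z - w)).re :=
      le_trans (div_nonneg (by linarith) (by positivity)) h2
    calc ((z + w) / (z - w)).re * Real.log ‖G z‖
        ≤ ((z + w) / (z - w)).re * Real.posLog ‖G z‖ := by gcongr; exact le_max_right _ _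
      _ ≤ _ := by gcongr; exact Real.posLog_nonneg

/-- The identity behind the reflection of a zero `a` in the circle of radius `t`: it shows that
`t (a - z)` and `t ^ 2 - conj a * z` have the same modulus on the circle. -/
theorem normSq_reflect_sub (t : ℝ) (a z : ℂ) :
    ‖(t : ℂ) ^ 2 - starRingEnd ℂ a * z‖ ^ 2 - t ^ 2 * ‖a - z‖ ^ 2
      = (t ^ 2 - ‖a‖ ^ 2) * (t ^ 2 - ‖z‖ ^ 2) := by
  rw [pow_two (t : ℂ)]
  simp only [Complex.sq_norm, Complex.normSq_apply, Complex.sub_re, Complex.sub_im,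
    Complex.mul_re, Complex.mul_im, Complex.conj_re, Complex.conj_im, Complex.ofReal_re,
    Complex.ofReal_im]
  ring

theorem mul_norm_sub_le_norm_reflect {t : ℝ} (ht : 0 ≤ t) {a z : ℂ} (ha : ‖a‖ ≤ t) (hz : ‖z‖ ≤ t) :
    t * ‖a - z‖ ≤ ‖(t : ℂ) ^ 2 - starRingEnd ℂ a * z‖ := by
  have h := normSq_reflect_sub t a z
  have h1 : 0 ≤ (t ^ 2 - ‖a‖ ^ 2) * (t ^ 2 - ‖z‖ ^ 2) :=
    mul_nonneg (by nlinarith [norm_nonneg a]) (by nlinarith [norm_nonneg z])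
  refine le_of_sq_le_sq ?_ (norm_nonneg _)
  nlinarith

theorem mul_norm_sub_eq_norm_reflect {t : ℝ} (ht : 0 ≤ t) {a z : ℂ} (hz : ‖z‖ = t) :
    t * ‖a - z‖ = ‖(t : ℂ) ^ 2 - starRingEnd ℂ a * z‖ := by
  have h := normSq_reflect_sub t a z
  rw [hz, sub_self, mul_zero, sub_eq_zero, ← mul_pow] at h
  exact ((sq_eq_sq₀ (norm_nonneg _) (by positivity)).1 h).symm

/-- The factors of `∏ (1 - (z - w) / a)`, whose zeros are the points `a + w`, with each zero
replaced by its reflection in the circle of radius `t`. -/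
noncomputable def reflectedProd (t : ℝ) (w : ℂ) (l : List ℂ) (z : ℂ) : ℂ :=
  (l.map fun a => ((t : ℂ) ^ 2 - starRingEnd ℂ (a + w) * z) / (t * a)).prod

@[simp] theorem reflectedProd_nil (t : ℝ) (w z : ℂ) : reflectedProd t w [] z = 1 := by
  simp [reflectedProd]

@[simp] theorem reflectedProd_cons (t : ℝ) (w a : ℂ) (l : List ℂ) (z : ℂ) :
    reflectedProd t w (a :: l) z =
      ((t : ℂ) ^ 2 - starRingEnd ℂ (a + w) * z) / (t * a) * reflectedProd t w l z := by
  simp [reflectedProd]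

theorem differentiable_reflectedProd (t : ℝ) (w : ℂ) (l : List ℂ) :
    Differentiable ℂ (reflectedProd t w l) := by
  induction l with
  | nil => simp [funext fun z => reflectedProd_nil t w z]
  | cons a l ih =>
    rw [funext fun z => reflectedProd_cons t w a l z]
    exact (((differentiable_const _).sub ((differentiable_const _).mul
      differentiable_id)).div_const _).mul ih

theorem reflectedProd_ne_zero {t : ℝ} (ht : 0 < t) {w : ℂ} {l : List ℂ}
    (hl : ∀ a ∈ l, a ≠ 0 ∧ ‖a + w‖ < t) {z : ℂ} (hz : ‖z‖ ≤ t) : reflectedProd t w l z ≠ 0 := by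
  induction l with
  | nil => simp
  | cons a l ih =>
    obtain ⟨ha0, hat⟩ := hl a (by simp)
    rw [reflectedProd_cons]
    refine mul_ne_zero (div_ne_zero (fun h => ?_) (mul_ne_zero (by exact_mod_cast ht.ne') ha0))
      (ih fun b hb => hl b (by simp [hb]))
    have h1 := congrArg norm (sub_eq_zero.1 h)
    rw [norm_mul, RCLike.norm_conj, norm_pow, Complex.norm_real, Real.norm_of_nonneg ht.le] at h1
    nlinarith [norm_nonneg z, norm_nonneg (a + w)]

theorem norm_reflectedProd_eq {t : ℝ} (ht : 0 < t) {w : ℂ} {l : List ℂ}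
    (hl : ∀ a ∈ l, a ≠ 0) {z : ℂ} (hz : ‖z‖ = t) :
    ‖reflectedProd t w l z‖ = ‖normalizedZeroProd l (z - w)‖ := by
  induction l with
  | nil => simp
  | cons a l ih =>
    have ha0 := hl a (by simp)
    have e : 1 - (z - w) / a = (a + w - z) / a := by field_simp; ring
    rw [reflectedProd_cons, normalizedZeroProd_cons, norm_mul, norm_mul,
      ih fun b hb => hl b (by simp [hb]), e, norm_div, norm_div, norm_mul, Complex.norm_real,
      Real.norm_of_nonneg ht.le, ← mul_norm_sub_eq_norm_reflect ht.le hz,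
      mul_div_mul_left _ _ ht.ne']

theorem one_le_norm_reflectedProd {t : ℝ} (ht : 0 < t) {w : ℂ} (hw : ‖w‖ ≤ t) {l : List ℂ}
    (hl : ∀ a ∈ l, a ≠ 0 ∧ ‖a + w‖ < t) : 1 ≤ ‖reflectedProd t w l w‖ := by
  induction l with
  | nil => simp
  | cons a l ih =>
    obtain ⟨ha0, hat⟩ := hl a (by simp)
    have h1 := mul_norm_sub_le_norm_reflect ht.le hat.le hw
    rw [add_sub_cancel_right] at h1
    rw [reflectedProd_cons, norm_mul]
    refine one_le_mul_of_one_le_of_one_le ?_ (ih fun b hb => hl b (by simp [hb]))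
    rw [norm_div, norm_mul, Complex.norm_real, Real.norm_of_nonneg ht.le,
      one_le_div (mul_pos ht (norm_pos_iff.2 ha0))]
    exact h1

/-- The Poisson-Jensen bound for the growth of an entire function in terms of its proximity
function: reflecting the zeros in a slightly larger circle increases the modulus inside, and
reduces the claim to zero-free functions. -/
theorem posLog_norm_le_mul_proximity {F : ℂ → ℂ} (hF : Differentiable ℂ F) {w : ℂ} {R : ℝ}
    (hw : ‖w‖ < R) :
    Real.posLog ‖F w‖ ≤ (R + ‖w‖) / (R - ‖w‖) * proximity F ⊤ R := by
  have hR : 0 < R := (norm_nonneg w).trans_lt hw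
  have hK : 0 ≤ (R + ‖w‖) / (R - ‖w‖) * proximity F ⊤ R :=
    mul_nonneg (div_nonneg (by positivity) (by linarith)) (proximity_nonneg R)
  rw [Real.posLog_def]
  refine max_le hK ?_
  by_cases hFw : F w = 0
  · simpa [hFw] using hK
  obtain ⟨l, V, hl, hV, hFV, hVS⟩ := exists_eq_normalizedZeroProd_mul (F := fun z => F (z + w))
    (hF.comp (differentiable_id.add_const w)) (by simpa using hFw) (S := {z | ‖z + w‖ ≤ R})
    (R := 2 * R) (by positivity) (fun a (ha : ‖a + w‖ ≤ R) => by
      have := norm_sub_le (a + w) w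
      rw [add_sub_cancel_right] at this
      linarith)
  have hl0 : ∀ a ∈ l, a ≠ 0 := by
    rintro a ha rfl
    exact hFw (by simpa using (hl _ ha).2)
  have hFV' : ∀ z, F z = normalizedZeroProd l (z - w) * V (z - w) := fun z => by
    simpa using hFV (z - w)
  have hVw : Continuous fun z => V (z - w) := hV.continuous.comp (continuous_id.sub continuous_const)
  obtain ⟨δ, hδ, hδV⟩ := (isCompact_closedBall (0 : ℂ) R).exists_thickening_subset_open
    (t := {z | V (z - w) ≠ 0}) (hVw.isOpen_preimage _ isOpen_ne)
    (fun z hz => hVS (z - w) (by simpa using hz))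
  rw [thickening_closedBall hδ hR.le] at hδV
  have hlim : Tendsto (fun t => (t + ‖w‖) / (t - ‖w‖) * proximity F ⊤ t) (𝓝[>] R)
      (𝓝 ((R + ‖w‖) / (R - ‖w‖) * proximity F ⊤ R)) := by
    refine ContinuousAt.tendsto ?_ |>.mono_left nhdsWithin_le_nhds
    refine ContinuousAt.mul (ContinuousAt.div (by fun_prop) (by fun_prop) (by linarith)) ?_
    exact (continuous_proximity_top hF.continuous).continuousAt
  refine ge_of_tendsto hlim ?_
  filter_upwards [Ioo_mem_nhdsGT (show R < δ + R by linarith)] with t ht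
  have ht0 : 0 < t := hR.trans ht.1
  have hl' : ∀ a ∈ l, a ≠ 0 ∧ ‖a + w‖ < t := fun a ha =>
    ⟨hl0 a ha, lt_of_le_of_lt (hl a ha).1 ht.1⟩
  have hG : Differentiable ℂ fun z => reflectedProd t w l z * V (z - w) :=
    (differentiable_reflectedProd t w l).mul (hV.comp (differentiable_id.sub_const w))
  have hP := log_norm_le_mul_proximity_of_ne_zero hG (t := t) (w := w)
    (fun z hz => mul_ne_zero (reflectedProd_ne_zero ht0 hl' hz)
      (hδV (by simpa using lt_of_le_of_lt hz ht.2))) (hw.trans ht.1)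
  have hprox : proximity (fun z => reflectedProd t w l z * V (z - w)) ⊤ t = proximity F ⊤ t := by
    rw [proximity_top, proximity_top]
    refine Real.circleAverage_congr_sphere fun z hz => ?_
    rw [abs_of_pos ht0] at hz
    simp only [norm_mul, hFV' z, norm_reflectedProd_eq ht0 hl0 (show ‖z‖ = t by simpa using hz)]
  rw [hprox] at hP
  refine le_trans (Real.log_le_log (norm_pos_iff.2 hFw) ?_) hP
  have h1 := one_le_norm_reflectedProd ht0 (hw.trans ht.1).le hl'
  rw [hFV' w, sub_self, normalizedZeroProd_zero, one_mul, norm_mul]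
  nlinarith [norm_nonneg (V 0)]

/-- A zero-free holomorphic function on a disc whose modulus is bounded by `exp A` has a
logarithmic derivative bounded linearly in `A` (Borel-Carathéodory and Cauchy). -/
theorem norm_deriv_div_le {V : ℂ → ℂ} (hV : Differentiable ℂ V) {r R A : ℝ} (hrR : r < R)
    (hV0 : ∀ z, ‖z‖ < R → V z ≠ 0) (hA : 0 ≤ A) (hVA : ∀ z, ‖z‖ < R → Real.log ‖V z‖ ≤ A)
    {z : ℂ} (hz : ‖z‖ ≤ r) :
    ‖deriv V z / V z‖ ≤ 8 * R / (R - r) ^ 2 * (A + |Real.log ‖V 0‖| + 1) := by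
  have hR : 0 < R := (norm_nonneg z).trans_lt (hz.trans_lt hrR)
  have hd : DifferentiableOn ℂ (fun z => deriv V z / V z) (ball 0 R) :=
    (hV.contDiff (n := 2) |>.differentiable_deriv_two).differentiableOn.div hV.differentiableOn
      fun z hz => hV0 z (by simpa using hz)
  obtain ⟨q, hq0, hq⟩ := hd.isExactOn_ball.with_val_at 0 0
  -- `V = V 0 * exp q` on the disc
  have hexp : ∀ z ∈ ball (0 : ℂ) R, V z = V 0 * Complex.exp (q z) := by
    intro z hz
    have hconst : ∀ z ∈ ball (0 : ℂ) R, HasDerivWithinAt (fun z => V z * Complex.exp (-q z)) 0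
        (ball (0 : ℂ) R) z := by
      intro z hz
      have h1 := ((hV z).hasDerivAt.mul ((hq z hz).neg.cexp))
      refine (h1.congr_deriv ?_).hasDerivWithinAt
      have := hV0 z (by simpa using hz)
      field_simp
      ring
    have h2 := (convex_ball (0 : ℂ) R).is_const_of_fderivWithin_eq_zero (𝕜 := ℂ)
      (fun z hz => (hconst z hz).differentiableWithinAt) (fun z hz => by
        have := (hconst z hz).hasFDerivWithinAt.fderivWithin
          (isOpen_ball.uniqueDiffWithinAt hz)
        rw [this]; ext; simp) hz (mem_ball_self hR)
    simp only [hq0, neg_zero, Complex.exp_zero, mul_one] at h2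
    rw [← h2, mul_assoc, ← Complex.exp_add]
    simp
  set M : ℝ := A + |Real.log ‖V 0‖| + 1 with hM
  have hMpos : 0 < M := by positivity
  have hqd : DifferentiableOn ℂ q (ball 0 R) := fun z hz =>
    (hq z hz).differentiableAt.differentiableWithinAt
  have hre : MapsTo q (ball 0 R) {z | z.re ≤ M} := by
    intro z hz
    have h1 := congrArg (fun x => Real.log ‖x‖) (hexp z hz)
    simp only [norm_mul, Complex.norm_exp] at h1
    rw [Real.log_mul (norm_ne_zero_iff.2 (hV0 0 (by simpa using hR))) (Real.exp_pos _).ne',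
      Real.log_exp] at h1
    have h2 := hVA z (by simpa using hz)
    have h3 := neg_abs_le (Real.log ‖V 0‖)
    simp only [mem_ofPred_eq]
    linarith
  have hBC : ∀ u : ℂ, ‖u‖ ≤ (r + R) / 2 → ‖q u‖ ≤ 4 * M * R / (R - r) := by
    intro u hu
    have huR : ‖u‖ < R := by linarith
    refine (Complex.borelCaratheodory_zero hMpos hqd hre hR (by simpa using huR) hq0).trans ?_
    rw [div_le_div_iff₀ (by linarith) (by linarith)]
    have h1 : 2 * M * ‖u‖ * (R - r) ≤ 2 * M * R * (R - r) := by
      have : 0 ≤ R - r := by linarith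
      gcongr
    have h2 : 4 * M * R * ((R - r) / 2) ≤ 4 * M * R * (R - ‖u‖) := by gcongr; linarith
    linarith
  have hρ : 0 < (R - r) / 2 := by linarith
  have hzR : z ∈ ball (0 : ℂ) R := by simpa using hz.trans_lt hrR
  have hsub : closedBall z ((R - r) / 2) ⊆ ball 0 R := by
    intro u hu
    have := norm_sub_norm_le u z
    simp only [mem_closedBall, dist_eq_norm] at hu
    simp only [mem_ball, dist_zero_right]
    linarith
  have hC := Complex.norm_deriv_le_of_forall_mem_sphere_norm_le (f := q) hρ
    (DifferentiableOn.diffContOnCl (hqd.mono ((closure_ball_subset_closedBall).trans hsub)))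
    (C := 4 * M * R / (R - r)) (fun u hu => hBC u (by
      have := norm_sub_norm_le u z
      simp only [mem_sphere, dist_eq_norm] at hu
      linarith))
  rw [(hq z hzR).deriv] at hC
  refine hC.trans (le_of_eq ?_)
  have : R - r ≠ 0 := by linarith
  field_simp
  ring

/-! ### Logarithmic derivatives and Borel's growth lemma -/

theorem dense_of_eventually_codiscrete {q : ℂ → Prop} (h : ∀ᶠ z in codiscrete ℂ, q z) :
    Dense {z | q z} := by
  intro x
  have h1 := mem_codiscrete.1 h x
  rw [disjoint_principal_right, compl_compl] at h1
  exact mem_closure_iff_frequently.2 ((Eventually.frequently h1).filter_mono nhdsWithin_le_nhds)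

theorem Differentiable.eventually_codiscrete_ne_zero {F : ℂ → ℂ} (hF : Differentiable ℂ F)
    {c : ℂ} (hc : F c ≠ 0) : ∀ᶠ z in codiscrete ℂ, F z ≠ 0 := by
  have h := AnalyticOnNhd.preimage_zero_mem_codiscrete (𝕜 := ℂ) (f := F) (x := c)
    (fun z _ => hF.analyticAt z) hc
  filter_upwards [h] with z hz
  simpa using hz

/-- For an entire function `V` without zeros in a disc, the proximity function of `V' / V` is
logarithmically small compared to that of `V`. -/
theorem proximity_deriv_div_le {V : ℂ → ℂ} (hV : Differentiable ℂ V) {r δ : ℝ} (hr : 1 ≤ r)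
    (hδ : 0 < δ) (hδ1 : δ ≤ 1 / 2) (hV0 : ∀ z, ‖z‖ ≤ r + 2 * δ → V z ≠ 0) :
    proximity (fun z => deriv V z / V z) ⊤ r ≤ Real.log (16 * (|Real.log ‖V 0‖| + 1))
      + 2 * Real.log (1 + r) + 3 * Real.log (1 / δ)
      + Real.log (1 + proximity V ⊤ (r + 2 * δ)) := by
  set m := proximity V ⊤ (r + 2 * δ) with hm
  set c := |Real.log ‖V 0‖| with hc
  have hm0 : 0 ≤ m := proximity_nonneg _
  have hc0 : 0 ≤ c := abs_nonneg _
  refine proximity_top_le_of_forall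
    (hV.deriv.meromorphic'.div hV.meromorphic') (by linarith) fun z hz => ?_
  have hA : ∀ u : ℂ, ‖u‖ < r + δ → Real.log ‖V u‖ ≤ 2 * (1 + r) / δ * m := by
    intro u hu
    have h1 := posLog_norm_le_mul_proximity hV (w := u) (R := r + 2 * δ) (by linarith)
    refine (le_max_right 0 _).trans (h1.trans ?_)
    gcongr
    · linarith
    · linarith
  have h2 := norm_deriv_div_le hV (r := r) (R := r + δ) (by linarith)
    (fun u hu => hV0 u (by linarith)) (by positivity) hA hz.le
  have h3 : 8 * (r + δ) / (r + δ - r) ^ 2 * (2 * (1 + r) / δ * m + c + 1)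
      ≤ 16 * (c + 1) * (1 + r) ^ 2 * (1 / δ) ^ 3 * (1 + m) := by
    have e : r + δ - r = δ := by ring
    rw [e]
    have h4 : 2 * (1 + r) / δ * m + c + 1 ≤ 2 * (1 + r) / δ * ((c + 1) * (1 + m)) := by
      have : 1 ≤ 2 * (1 + r) / δ := by rw [le_div_iff₀ hδ]; linarith
      have h5 : c + 1 ≤ 2 * (1 + r) / δ * (c + 1) := le_mul_of_one_le_left (by positivity) this
      have h6 : 0 ≤ 2 * (1 + r) / δ * (m * c) := by positivity
      nlinarith
    calc 8 * (r + δ) / δ ^ 2 * (2 * (1 + r) / δ * m + c + 1)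
        ≤ 8 * (1 + r) / δ ^ 2 * (2 * (1 + r) / δ * ((c + 1) * (1 + m))) := by
          refine mul_le_mul ?_ h4 (by positivity) (by positivity)
          exact div_le_div_of_nonneg_right (by linarith) (by positivity)
      _ = _ := by field_simp; ring
  have h7 := h2.trans h3
  have h8 : 1 ≤ 16 * (c + 1) * (1 + r) ^ 2 * (1 / δ) ^ 3 * (1 + m) := by
    have a1 : 1 ≤ 16 * (c + 1) := by linarith
    have a2 : 1 ≤ (1 + r) ^ 2 := one_le_pow₀ (by linarith)
    have a3 : 1 ≤ (1 / δ) ^ 3 := one_le_pow₀ (by rw [le_div_iff₀ hδ]; linarith)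
    have a4 : 1 ≤ 1 + m := by linarith
    exact one_le_mul_of_one_le_of_one_le (one_le_mul_of_one_le_of_one_le
      (one_le_mul_of_one_le_of_one_le a1 a2) a3) a4
  refine (Real.posLog_le_posLog (norm_nonneg _) h7).trans ?_
  rw [Real.posLog_eq_log (by rwa [abs_of_nonneg (by positivity)])]
  rw [Real.log_mul (by positivity) (by positivity), Real.log_mul (by positivity) (by positivity),
    Real.log_mul (by positivity) (by positivity), Real.log_pow, Real.log_pow]
  push_cast
  exact le_rfl

/-- A nondecreasing function does not double on the interval `[r, r + 1 / W r]` for some `r`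
close to a given point (Borel's growth lemma). -/
theorem exists_le_two_mul_of_monotoneOn {W : ℝ → ℝ} {a : ℝ} (hW : ∀ r s, a ≤ r → r ≤ s → W r ≤ W s)
    (hW1 : ∀ r, a ≤ r → 1 ≤ W r) {r₀ : ℝ} (hr₀ : a ≤ r₀) :
    ∃ r, r₀ ≤ r ∧ r ≤ r₀ + 2 ∧ W (r + 1 / W r) ≤ 2 * W r := by
  by_contra hcon
  push Not at hcon
  let s : ℕ → ℝ := fun n => Nat.rec r₀ (fun _ r => r + 1 / W r) n
  have hs : ∀ n, s (n + 1) = s n + 1 / W (s n) := fun n => rfl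
  have key : ∀ n, r₀ ≤ s n ∧ s n ≤ r₀ + 2 - 2 / 2 ^ n ∧ (2 : ℝ) ^ n ≤ W (s n) := by
    intro n
    induction n with
    | zero => exact ⟨le_rfl, by simp [s], by simpa [s] using hW1 r₀ hr₀⟩
    | succ n ih =>
      obtain ⟨h1, h2, h3⟩ := ih
      have hpos : 0 < W (s n) := by linarith [hW1 (s n) (hr₀.trans h1)]
      have hp2 : (0 : ℝ) < 2 ^ n := by positivity
      have h4 : 1 / W (s n) ≤ 1 / 2 ^ n := one_div_le_one_div_of_le hp2 h3
      have h5 : 0 ≤ 1 / W (s n) := by positivity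
      have h6 : (2 : ℝ) / 2 ^ n = 2 * (1 / 2 ^ n) := by ring
      have h7 : (2 : ℝ) / 2 ^ (n + 1) = 1 / 2 ^ n := by rw [pow_succ]; field_simp
      have h8 : 0 ≤ (1 : ℝ) / 2 ^ n := by positivity
      refine ⟨by rw [hs]; linarith, by rw [hs, h7]; linarith, ?_⟩
      have := hcon (s n) h1 (by linarith)
      rw [hs, pow_succ]
      linarith
  obtain ⟨n, hn⟩ := pow_unbounded_of_one_lt (W (r₀ + 2)) (one_lt_two)
  obtain ⟨h1, h2, h3⟩ := key n
  have h4 : 0 ≤ (2 : ℝ) / 2 ^ n := by positivity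
  have := hW (s n) (r₀ + 2) (hr₀.trans h1) (by linarith)
  linarith

/-- An inequality `U r ≤ C (r ^ (7 / 4) + log (1 / δ) + log (1 + U (r + 2 δ)))`, uniform in `δ`,
implies `U r = O(r ^ (7 / 4))`: the choice of `δ` rests on Borel's growth lemma. -/
theorem exists_le_rpow_of_forall_le_log {U : ℝ → ℝ} (hU0 : ∀ r, 0 ≤ U r)
    (hU : ∀ r s, 1 ≤ r → r ≤ s → U r ≤ U s) {C : ℝ}
    (h : ∀ r δ, 1 ≤ r → 0 < δ → δ ≤ 1 / 2 → U r ≤ C * ((1 + r) ^ (7 / 4 : ℝ) + Real.log (1 / δ)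
      + Real.log (1 + U (r + 2 * δ)))) :
    ∃ C', ∀ r, 1 ≤ r → U r ≤ C' * (1 + r) ^ (7 / 4 : ℝ) := by
  wlog hC : 1 ≤ C generalizing C
  · refine this (C := 1) (fun r δ hr hδ hδ1 => (h r δ hr hδ hδ1).trans ?_) le_rfl
    have h1 : 0 ≤ Real.log (1 / δ) :=
      Real.log_nonneg (by rw [le_div_iff₀ hδ]; linarith)
    have h2 : 0 ≤ Real.log (1 + U (r + 2 * δ)) :=
      Real.log_nonneg (by linarith [hU0 (r + 2 * δ)])
    have h3 : 0 ≤ (1 + r) ^ (7 / 4 : ℝ) := by positivity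
    exact mul_le_mul_of_nonneg_right (not_le.1 hC).le (by positivity)
  refine ⟨2 * C * 3 ^ (7 / 4 : ℝ) + (1 + 4 * C * Real.log (8 * C)), fun r₀ hr₀ => ?_⟩
  obtain ⟨r, hr0r, hrr0, hr⟩ := exists_le_two_mul_of_monotoneOn (W := fun r => 1 + U r) (a := 1)
    (fun r s hr hrs => by linarith [hU r s hr hrs]) (fun r _ => by linarith [hU0 r]) hr₀
  have hr1 : 1 ≤ r := hr₀.trans hr0r
  have hW1 : 1 ≤ 1 + U r := by linarith [hU0 r]
  have hW : 0 < 1 + U r := by linarith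
  have h1 := h r (1 / (2 * (1 + U r))) hr1 (by positivity)
    (by rw [div_le_div_iff₀ (by positivity) (by positivity)]; linarith)
  have e1 : 2 * (1 / (2 * (1 + U r))) = 1 / (1 + U r) := by field_simp
  rw [e1, one_div_one_div] at h1
  have h2 : Real.log (1 + U (r + 1 / (1 + U r))) ≤ Real.log (2 * (1 + U r)) :=
    Real.log_le_log (by linarith [hU0 (r + 1 / (1 + U r))]) hr
  have h3 : Real.log (2 * (1 + U r)) ≤ (1 + U r) / (4 * C) + Real.log (8 * C) := by
    have := Real.log_le_sub_one_of_pos (x := 2 * (1 + U r) / (8 * C)) (by positivity)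
    rw [Real.log_div (by positivity) (by positivity)] at this
    have e2 : 2 * (1 + U r) / (8 * C) = (1 + U r) / (4 * C) := by field_simp; ring
    rw [e2] at this
    linarith
  have h4 : U r ≤ C * ((1 + r) ^ (7 / 4 : ℝ)
      + 2 * ((1 + U r) / (4 * C) + Real.log (8 * C))) :=
    h1.trans (mul_le_mul_of_nonneg_left (by linarith) (by linarith))
  have e3 : C * ((1 + r) ^ (7 / 4 : ℝ) + 2 * ((1 + U r) / (4 * C) + Real.log (8 * C)))
      = C * (1 + r) ^ (7 / 4 : ℝ) + (1 + U r) / 2 + 2 * C * Real.log (8 * C) := by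
    field_simp
    ring
  rw [e3] at h4
  have h5 : (1 + r) ^ (7 / 4 : ℝ) ≤ 3 ^ (7 / 4 : ℝ) * (1 + r₀) ^ (7 / 4 : ℝ) := by
    rw [← Real.mul_rpow (by norm_num) (by linarith)]
    gcongr
    linarith
  have h6 : 1 ≤ (1 + r₀) ^ (7 / 4 : ℝ) := Real.one_le_rpow (by linarith) (by norm_num)
  have h7 : 0 ≤ Real.log (8 * C) := Real.log_nonneg (by linarith)
  calc U r₀ ≤ U r := hU r₀ r hr₀ hr0r
    _ ≤ 2 * C * (1 + r) ^ (7 / 4 : ℝ) + (1 + 4 * C * Real.log (8 * C)) := by linarith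
    _ ≤ 2 * C * (3 ^ (7 / 4 : ℝ) * (1 + r₀) ^ (7 / 4 : ℝ))
        + (1 + 4 * C * Real.log (8 * C)) * (1 + r₀) ^ (7 / 4 : ℝ) := by
      refine add_le_add (by gcongr) (le_mul_of_one_le_right (by positivity) h6)
    _ = _ := by ring

/-! ### Borel's unicity argument -/

theorem log_one_add_div_le {a r : ℝ} (ha : 0 < a) (hr : 1 ≤ r) :
    Real.log (1 + (r + 2) / a) ≤ 4 * (1 + 2 / a) ^ (1 / 4 : ℝ) * (1 + r) ^ (1 / 4 : ℝ) := by
  have h1 : 1 + (r + 2) / a ≤ (1 + 2 / a) * (1 + r) := by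
    have : (1 + 2 / a) * (1 + r) = 1 + r + (2 + 2 * r) / a := by field_simp
    rw [this]
    have : (r + 2) / a ≤ (2 + 2 * r) / a :=
      div_le_div_of_nonneg_right (by linarith) ha.le
    linarith
  refine (Real.log_le_log (by positivity) h1).trans ?_
  refine (Real.log_le_rpow_div (ε := 1 / 4) (by positivity) (by norm_num)).trans ?_
  rw [Real.mul_rpow (by positivity) (by positivity)]
  apply le_of_eq
  ring

theorem one_add_rpow_quarter_mul {r : ℝ} (hr : 0 ≤ r) :
    (1 + r) ^ (3 / 2 : ℝ) * (1 + r) ^ (1 / 4 : ℝ) = (1 + r) ^ (7 / 4 : ℝ) := by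
  rw [← Real.rpow_add (by linarith)]
  norm_num

/-- The number of zeros of an entire factor of `D` in a disc is controlled by the growth of `D`. -/
theorem exists_length_le_of_posLog_norm_le {D : ℂ → ℂ} (hD0 : D 0 ≠ 0) {B : ℝ}
    (hDB : ∀ z, Real.posLog ‖D z‖ ≤ B * (1 + ‖z‖) ^ (3 / 2 : ℝ)) :
    ∃ C, 0 ≤ C ∧ ∀ (r : ℝ) (l : List ℂ) (W : ℂ → ℂ), 1 ≤ r → (∀ a ∈ l, a ≠ 0 ∧ ‖a‖ ≤ r + 1) →
      Differentiable ℂ W → (∀ z, D z = normalizedZeroProd l z * W z) →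
      (l.length : ℝ) ≤ C * (1 + r) ^ (3 / 2 : ℝ) := by
  have hB : 0 ≤ B := by
    have := (Real.posLog_nonneg).trans (hDB 0)
    simpa using this
  refine ⟨2 * (B * 4 ^ (3 / 2 : ℝ) + |Real.log ‖D 0‖|), by positivity,
    fun r l W hr hl hW hDW => ?_⟩
  have hx : 1 ≤ (1 + r) ^ (3 / 2 : ℝ) := Real.one_le_rpow (by linarith) (by norm_num)
  have h := two_pow_mul_norm_le (M := Real.exp (B * (4 ^ (3 / 2 : ℝ) * (1 + r) ^ (3 / 2 : ℝ))))
    (by linarith) hl hW (fun z hz => by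
      rw [← hDW]
      have h1 : Real.log ‖D z‖ ≤ B * (4 ^ (3 / 2 : ℝ) * (1 + r) ^ (3 / 2 : ℝ)) := by
        refine (le_max_right 0 _).trans ((hDB z).trans ?_)
        rw [hz, ← Real.mul_rpow (by norm_num) (by linarith)]
        gcongr
        linarith
      by_cases hz0 : D z = 0
      · rw [hz0, norm_zero]; positivity
      · exact (Real.log_le_iff_le_exp (norm_pos_iff.2 hz0)).1 h1)
  have hW0 : W 0 = D 0 := by rw [hDW, normalizedZeroProd_zero, one_mul]
  rw [hW0] at h
  have h2 := Real.log_le_log (by positivity) h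
  rw [Real.log_exp, Real.log_mul (by positivity) (norm_ne_zero_iff.2 hD0), Real.log_pow] at h2
  have h3 : (1 : ℝ) / 2 < Real.log 2 := by linarith [Real.log_two_gt_d9]
  have h4 := neg_abs_le (Real.log ‖D 0‖)
  have h5 : (l.length : ℝ) * (1 / 2) ≤ l.length * Real.log 2 := by gcongr
  have h6 : |Real.log ‖D 0‖| ≤ |Real.log ‖D 0‖| * (1 + r) ^ (3 / 2 : ℝ) :=
    le_mul_of_one_le_right (abs_nonneg _) hx
  linarith

theorem Differentiable.exists_forall_le_norm_of_eq_zero {F : ℂ → ℂ} (hF : Differentiable ℂ F)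
    (h0 : F 0 ≠ 0) : ∃ a : ℝ, 0 < a ∧ ∀ z, F z = 0 → a ≤ ‖z‖ := by
  obtain ⟨a, ha, h⟩ := Metric.isOpen_iff.1 (hF.continuous.isOpen_preimage _ isOpen_ne) 0 h0
  refine ⟨a, ha, fun z hz => ?_⟩
  by_contra hlt
  exact h (show z ∈ ball 0 a by simpa using hlt) hz

set_option maxHeartbeats 1000000 in
/-- Borel's argument, in quantitative form: if the entire function `p exp g - 1` has few zeros,
then `exp g` has small growth. Split off its zeros in a disc, `p exp g - 1 = P V` with `V` zero-free;
differentiating and eliminating `exp g` expresses `1 / V` through `p`, `P`, their derivatives, and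
the logarithmic derivatives `g'` and `V' / V`, which are negligible. The exponent `7 / 4` leaves room
for the bound `O(r ^ (3 / 2) log r)` on the growth of `P`. -/
theorem exists_proximity_exp_le_log {p g G : ℂ → ℂ} (hp : Differentiable ℂ p)
    (hg : Differentiable ℂ g) (hG : Differentiable ℂ G) {B : ℝ}
    (hDB : ∀ z, Real.posLog ‖(p z * Complex.exp (g z) - 1) * G z‖ ≤ B * (1 + ‖z‖) ^ (3 / 2 : ℝ))
    (hD0 : (p 0 * Complex.exp (g 0) - 1) * G 0 ≠ 0) (hp0 : p 0 ≠ 0)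
    (hp10 : deriv p 0 + p 0 * deriv g 0 ≠ 0) {Cp : ℝ}
    (hCp : ∀ r, 1 ≤ r → proximity p ⊤ r ≤ Cp * (1 + r) ^ (7 / 4 : ℝ))
    (hCp' : ∀ r, 1 ≤ r → proximity (deriv p) ⊤ r ≤ Cp * (1 + r) ^ (7 / 4 : ℝ)) :
    ∃ C, ∀ r δ, 1 ≤ r → 0 < δ → δ ≤ 1 / 2 →
      proximity (fun z => Complex.exp (g z)) ⊤ r ≤ C * ((1 + r) ^ (7 / 4 : ℝ) + Real.log (1 / δ)
      + Real.log (1 + proximity (fun z => Complex.exp (g z)) ⊤ (r + 2 * δ))) := by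
  set e : ℂ → ℂ := fun z => Complex.exp (g z) with he
  set F : ℂ → ℂ := fun z => p z * e z - 1 with hFdef
  set p1 : ℂ → ℂ := fun z => deriv p z + p z * deriv g z with hp1def
  have hed : Differentiable ℂ e := hg.cexp
  have hFd : Differentiable ℂ F := (hp.mul hed).sub_const 1
  have hp1d : Differentiable ℂ p1 := hp.deriv.add (hp.mul hg.deriv)
  have hF0 : F 0 ≠ 0 := left_ne_zero_of_mul hD0
  have hderivF : ∀ z, deriv F z = p1 z * e z := by
    intro z
    have h : HasDerivAt F (deriv p z * e z + p z * (e z * deriv g z)) z :=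
      ((hp z).hasDerivAt.mul (hg z).hasDerivAt.cexp).sub_const 1
    rw [h.deriv]
    ring
  obtain ⟨a, ha, haF⟩ := hFd.exists_forall_le_norm_of_eq_zero hF0
  obtain ⟨Cn, hCn0, hCn⟩ := exists_length_le_of_posLog_norm_le (D := fun z => F z * G z) hD0 hDB
  set K := Cn * (4 * (1 + 2 / a) ^ (1 / 4 : ℝ)) with hK
  have hK0 : 0 ≤ K := by positivity
  have hCp0 : 0 ≤ Cp := by
    have h1 := (proximity_nonneg (f := p) (a := ⊤) 1).trans (hCp 1 le_rfl)
    have h2 : (0 : ℝ) < (1 + 1) ^ (7 / 4 : ℝ) := by positivity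
    exact nonneg_of_mul_nonneg_left h1 h2
  set cF := |Real.log ‖F 0‖| with hcF
  set ce := |Real.log ‖e 0‖| with hce
  set cp := |Real.log ‖p 0‖| with hcp
  set cp1 := |Real.log ‖p1 0‖| with hcp1
  set LF := Real.log (16 * (cF + 1)) with hLF
  set Le := Real.log (16 * (ce + 1)) with hLe
  set LK := Real.log (1 + (Cp * 2 ^ (7 / 4 : ℝ) + 1 + K)) with hLK
  have hlog2 : 0 ≤ Real.log 2 := Real.log_nonneg (by norm_num)
  have hlog21 : Real.log 2 ≤ 1 := by linarith [Real.log_two_lt_d9]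
  have hLF0 : 0 ≤ LF := Real.log_nonneg (by linarith [abs_nonneg (Real.log ‖F 0‖)])
  have hLe0 : 0 ≤ Le := Real.log_nonneg (by linarith [abs_nonneg (Real.log ‖e 0‖)])
  have h2pos : (0 : ℝ) < 2 ^ (7 / 4 : ℝ) := by positivity
  have hLK0 : 0 ≤ LK := Real.log_nonneg (by
    have : 0 ≤ Cp * 2 ^ (7 / 4 : ℝ) := by positivity
    linarith)
  refine ⟨cF + cp + cp1 + LF + 2 * Le + LK + 30 + 6 * Cp + 6 * K, fun r δ hr hδ hδ1 => ?_⟩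
  set X := (1 + r) ^ (7 / 4 : ℝ) with hX
  have hX1 : 1 ≤ X := Real.one_le_rpow (by linarith) (by norm_num)
  have hlogr : Real.log (1 + r) ≤ X := by
    have h1 : Real.log (1 + r) ≤ (1 + r) - 1 := Real.log_le_sub_one_of_pos (by linarith)
    have h2 : (1 + r) ^ (1 : ℝ) ≤ X := Real.rpow_le_rpow_of_exponent_le (by linarith) (by norm_num)
    rw [Real.rpow_one] at h2
    linarith
  have hlogr0 : 0 ≤ Real.log (1 + r) := Real.log_nonneg (by linarith)
  set dl := Real.log (1 / δ) with hdl
  have hdl0 : 0 ≤ dl := Real.log_nonneg (by rw [le_div_iff₀ hδ]; linarith)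
  set u := proximity e ⊤ (r + 2 * δ) with hu
  have hu0 : 0 ≤ u := proximity_nonneg _
  set lu := Real.log (1 + u) with hlu
  have hlu0 : 0 ≤ lu := Real.log_nonneg (by linarith)
  have hlogX : Real.log X ≤ X := by
    have := Real.log_le_sub_one_of_pos (x := X) (by linarith)
    linarith
  -- splitting off the zeros in the disc of radius `r + 1`
  obtain ⟨l, V, hl, hV, hFV, hVS⟩ := exists_eq_normalizedZeroProd_mul hFd hF0
    (S := closedBall 0 (r + 1)) (R := r + 1) (by linarith) (fun a ha => by simpa using ha)
  set P := normalizedZeroProd l with hP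
  have hPd : Differentiable ℂ P := differentiable_normalizedZeroProd l
  have hP0 : P 0 = 1 := normalizedZeroProd_zero l
  have hV0 : V 0 = F 0 := by rw [hFV, hP0, one_mul]
  have hn : (l.length : ℝ) * Real.log (1 + (r + 2) / a) ≤ K * X := by
    have h1 := hCn r l (fun z => V z * G z) hr (fun b hb => ⟨?_, by simpa using (hl b hb).1⟩)
      (hV.mul hG) (fun z => by simp only [hFV z, mul_assoc, hP])
    · have h2 := log_one_add_div_le ha hr
      rw [hK, hX, ← one_add_rpow_quarter_mul (by linarith : (0 : ℝ) ≤ r)]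
      calc _ ≤ (Cn * (1 + r) ^ (3 / 2 : ℝ))
            * (4 * (1 + 2 / a) ^ (1 / 4 : ℝ) * (1 + r) ^ (1 / 4 : ℝ)) := by
            have : 0 ≤ Real.log (1 + (r + 2) / a) :=
              Real.log_nonneg (by have : 0 ≤ (r + 2) / a := by positivity
                                  linarith)
            gcongr
        _ = _ := by ring
    · rintro rfl
      exact hF0 (hl _ hb).2
  have hPle : ∀ z, ‖z‖ ≤ r + 2 → ‖P z‖ ≤ (1 + (r + 2) / a) ^ l.length := fun z hz =>
    norm_normalizedZeroProd_le ha (fun b hb => haF b (hl b hb).2) hz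
  have hbase : 1 ≤ (1 + (r + 2) / a) ^ l.length :=
    one_le_pow₀ (by have : 0 ≤ (r + 2) / a := by positivity
                    linarith)
  have hlogle : ∀ x : ℂ, ‖x‖ ≤ (1 + (r + 2) / a) ^ l.length → Real.posLog ‖x‖ ≤ K * X := by
    intro x hx
    refine (Real.posLog_le_posLog (norm_nonneg _) hx).trans ?_
    rw [Real.posLog_eq_log (by rwa [abs_of_nonneg (by positivity)]), Real.log_pow]
    exact hn
  have mP : proximity P ⊤ r ≤ K * X := proximity_top_le_of_forall hPd.meromorphic' (by linarith)
    fun z hz => hlogle _ (hPle z (by linarith))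
  have mP2 : proximity P ⊤ (r + 2 * δ) ≤ K * X :=
    proximity_top_le_of_forall hPd.meromorphic' (by linarith)
      fun z hz => hlogle _ (hPle z (by linarith))
  have mP' : proximity (deriv P) ⊤ r ≤ K * X :=
    proximity_top_le_of_forall hPd.deriv.meromorphic' (by linarith) fun z hz => by
      refine hlogle _ ?_
      have := Complex.norm_deriv_le_of_forall_mem_sphere_norm_le (f := P) (c := z) (R := 1)
        (C := (1 + (r + 2) / a) ^ l.length) one_pos hPd.diffContOnCl (fun w hw => hPle w (by
          have := norm_sub_norm_le w z
          simp only [mem_sphere, dist_eq_norm] at hw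
          linarith))
      simpa using this
  -- `F` and `V` on the outer circle
  have one_mer : Meromorphic (fun _ : ℂ => (1 : ℂ)) := (differentiable_const _).meromorphic'
  have mF2 : proximity F ⊤ (r + 2 * δ) ≤ Cp * (2 ^ (7 / 4 : ℝ) * X) + u + 1 := by
    have h1 := proximity_sub_le (hp.mul hed).meromorphic' one_mer (r + 2 * δ)
    have h2 := proximity_mul_le hp.meromorphic' hed.meromorphic' (r + 2 * δ)
    have h3 := hCp (r + 2 * δ) (by linarith)
    have h4 : (1 + (r + 2 * δ)) ^ (7 / 4 : ℝ) ≤ 2 ^ (7 / 4 : ℝ) * X := by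
      rw [hX, ← Real.mul_rpow (by norm_num) (by linarith)]
      gcongr
      linarith
    have h5 : Cp * (1 + (r + 2 * δ)) ^ (7 / 4 : ℝ) ≤ Cp * (2 ^ (7 / 4 : ℝ) * X) := by gcongr
    have h6 : proximity (fun _ : ℂ => (1 : ℂ)) ⊤ (r + 2 * δ) = 0 := by simp
    have h7 : proximity F ⊤ (r + 2 * δ) ≤ proximity (fun z => p z * e z) ⊤ (r + 2 * δ)
      + proximity (fun _ : ℂ => (1 : ℂ)) ⊤ (r + 2 * δ) + Real.log 2 := h1
    linarith
  have mV2 : proximity V ⊤ (r + 2 * δ) ≤ (Cp * 2 ^ (7 / 4 : ℝ) + 1 + K) * X + u := by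
    have h1 : proximity V ⊤ (r + 2 * δ) = proximity (fun z => F z * P⁻¹ z) ⊤ (r + 2 * δ) := by
      refine proximity_congr_codiscrete ?_ (by linarith)
      filter_upwards [hPd.eventually_codiscrete_ne_zero (c := 0) (by simp [hP0])] with z hz
      rw [hFV z, Pi.inv_apply]
      field_simp
    have h2 := proximity_mul_le hFd.meromorphic' hPd.meromorphic'.inv (r + 2 * δ)
    have h3 := proximity_inv_le hPd (by simp [hP0]) (r := r + 2 * δ) (by linarith)
    rw [hP0, norm_one, Real.log_one, sub_zero] at h3
    rw [h1]
    linarith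
  have hVne : ∀ z, ‖z‖ ≤ r + 2 * δ → V z ≠ 0 := fun z hz => hVS z (by
    simp only [mem_closedBall, dist_zero_right]; linarith)
  -- the logarithmic derivatives are `O(log)` of the growth of `V` and `exp g`
  have mV'V : proximity (fun z => deriv V z / V z) ⊤ r ≤ LF + 2 * X + 3 * dl + (LK + X + lu) := by
    have h1 := proximity_deriv_div_le hV hr hδ hδ1 hVne
    rw [hV0] at h1
    have h2 : Real.log (1 + proximity V ⊤ (r + 2 * δ)) ≤ LK + Real.log X + lu := by
      have h0 : 0 ≤ Cp * 2 ^ (7 / 4 : ℝ) := by positivity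
      rw [hLK, hlu, ← Real.log_mul (by positivity) (by positivity),
        ← Real.log_mul (by positivity) (by positivity)]
      have hm : 0 ≤ proximity V ⊤ (r + 2 * δ) := proximity_nonneg _
      refine Real.log_le_log (by linarith) ?_
      have h3 : u ≤ X * u := le_mul_of_one_le_left hu0 hX1
      have h4 : 0 ≤ (Cp * 2 ^ (7 / 4 : ℝ) + 1 + K) * X * u := by positivity
      nlinarith
    linarith
  have mg' : proximity (deriv g) ⊤ r ≤ Le + 2 * X + 3 * dl + lu := by
    have h1 := proximity_deriv_div_le hed hr hδ hδ1 (fun z _ => Complex.exp_ne_zero _)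
    have h2 : (fun z => deriv e z / e z) = deriv g := by
      ext z
      rw [he, ((hg z).hasDerivAt.cexp).deriv, mul_div_cancel_left₀ _ (Complex.exp_ne_zero _)]
    rw [h2] at h1
    linarith
  have mp := hCp r hr
  have mp' := hCp' r hr
  have mp1 : proximity p1 ⊤ r ≤ 2 * (Cp * X) + (Le + 2 * X + 3 * dl + lu) + 1 := by
    have h1 := proximity_add_le hp.deriv.meromorphic' (hp.mul hg.deriv).meromorphic' r
    have h2 := proximity_mul_le hp.meromorphic' hg.deriv.meromorphic' r
    have h3 : proximity p1 ⊤ r ≤ proximity (deriv p) ⊤ r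
      + proximity (fun z => p z * deriv g z) ⊤ r + Real.log 2 := h1
    linarith
  have mp1i : proximity p1⁻¹ ⊤ r ≤ proximity p1 ⊤ r + cp1 := by
    have h1 := proximity_inv_le hp1d hp10 hr
    have h2 := neg_abs_le (Real.log ‖p1 0‖)
    linarith
  -- the elimination of `exp g`
  have hid : V⁻¹ =ᶠ[codiscrete ℂ] fun z =>
      p1⁻¹ z * (p z * (deriv P z + P z * (deriv V z / V z)) - p1 z * P z) := by
    filter_upwards [hp1d.eventually_codiscrete_ne_zero hp10,
      hV.eventually_codiscrete_ne_zero (c := 0) (by rwa [hV0])] with z h1 h2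
    have h3 : p1 z * e z = deriv P z * V z + P z * deriv V z := by
      rw [← hderivF, show F = fun z => P z * V z from funext hFV]
      exact ((hPd z).hasDerivAt.mul (hV z).hasDerivAt).deriv
    have h4 : p z * e z - 1 = P z * V z := hFV z
    simp only [Pi.inv_apply]
    field_simp
    linear_combination (p z) * h3 - p1 z * h4
  have hQm : Meromorphic fun z => deriv V z / V z := hV.deriv.meromorphic'.div hV.meromorphic'
  have hPQm : Meromorphic fun z => P z * (deriv V z / V z) := hPd.meromorphic'.mul hQm
  have hSm : Meromorphic fun z => deriv P z + P z * (deriv V z / V z) :=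
    hPd.deriv.meromorphic'.add hPQm
  have mVi : proximity V⁻¹ ⊤ r ≤ proximity p1⁻¹ ⊤ r + (Cp * X + (K * X + (K * X
      + (LF + 2 * X + 3 * dl + (LK + X + lu))) + 1) + (proximity p1 ⊤ r + K * X) + 1) := by
    rw [proximity_congr_codiscrete hid (by linarith)]
    have h1 := proximity_mul_le hp1d.meromorphic'.inv
      ((hp.meromorphic'.mul hSm).sub (hp1d.meromorphic'.mul hPd.meromorphic')) r
    have h2 := proximity_sub_le (hp.meromorphic'.mul hSm)
      (hp1d.meromorphic'.mul hPd.meromorphic') r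
    have h3 := proximity_mul_le hp.meromorphic' hSm r
    have h4 := proximity_add_le hPd.deriv.meromorphic' hPQm r
    have h5 := proximity_mul_le hPd.meromorphic' hQm r
    have h6 := proximity_mul_le hp1d.meromorphic' hPd.meromorphic' r
    simp only [Pi.mul_apply, Pi.sub_apply, Pi.mul_def, Pi.sub_def] at h1 h2 h3 h4 h5 h6 ⊢
    linarith
  have mV : proximity V ⊤ r ≤ proximity V⁻¹ ⊤ r + cF := by
    rw [proximity_eq_of_ne_zero hV (by linarith) (fun z hz => hVne z (by linarith)), hV0]
    linarith [le_abs_self (Real.log ‖F 0‖)]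
  have mF : proximity F ⊤ r ≤ K * X + proximity V ⊤ r := by
    rw [show F = fun z => P z * V z from funext hFV]
    have := proximity_mul_le hPd.meromorphic' hV.meromorphic' r
    linarith
  have me : proximity e ⊤ r ≤ proximity F ⊤ r + 1 + (Cp * X + cp) := by
    have h1 : proximity e ⊤ r = proximity (fun z => (F z + 1) * p⁻¹ z) ⊤ r := by
      refine proximity_congr_codiscrete ?_ (by linarith)
      filter_upwards [hp.eventually_codiscrete_ne_zero hp0] with z hz
      simp only [Pi.inv_apply, hFdef]
      field_simp
      ring
    have h2 := proximity_mul_le (hFd.add_const 1).meromorphic' hp.meromorphic'.inv r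
    have h3 := proximity_add_le hFd.meromorphic' one_mer r
    have h4 := proximity_inv_le hp hp0 hr
    have h5 : proximity (fun _ : ℂ => (1 : ℂ)) ⊤ r = 0 := by simp
    have h6 := neg_abs_le (Real.log ‖p 0‖)
    rw [h1]
    linarith
  have hfin : proximity e ⊤ r ≤ (cF + cp + cp1 + LF + 2 * Le + LK) + 30 * (X + dl + lu)
      + (6 * Cp + 6 * K) * X := by
    have : 0 ≤ K * X := by positivity
    linarith
  have c0 : 0 ≤ cF + cp + cp1 + LF + 2 * Le + LK := by positivity
  have h1 : cF + cp + cp1 + LF + 2 * Le + LK ≤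
      (cF + cp + cp1 + LF + 2 * Le + LK) * (X + dl + lu) :=
    le_mul_of_one_le_right c0 (by linarith)
  have h2 : (6 * Cp + 6 * K) * X ≤ (6 * Cp + 6 * K) * (X + dl + lu) := by
    gcongr
    linarith
  linarith

/-! ### Affine exponents -/

theorem Real.posLog_le_self {x : ℝ} (hx : 0 ≤ x) : Real.posLog x ≤ x := by
  rw [Real.posLog_def]
  exact max_le hx (Real.log_le_self hx)

/-- An entire function `g` for which the proximity function of `exp g` is `O(r ^ (7 / 4))` is
affine: `g' = O(r ^ (3 / 4))` by Borel-Carathéodory. -/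
theorem exists_eq_affine_of_proximity_exp_le {g : ℂ → ℂ} (hg : Differentiable ℂ g) {C : ℝ}
    (hC : ∀ r, 1 ≤ r → proximity (fun z => Complex.exp (g z)) ⊤ r ≤ C * (1 + r) ^ (7 / 4 : ℝ)) :
    ∃ a b : ℂ, ∀ z, g z = a * z + b := by
  set e : ℂ → ℂ := fun z => Complex.exp (g z) with he
  have hed : Differentiable ℂ e := hg.cexp
  set c := |Real.log ‖e 0‖| with hc
  have hC0 : 0 ≤ C := by
    have h1 : (0 : ℝ) ≤ C * (1 + 1) ^ (7 / 4 : ℝ) :=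
      (show (0 : ℝ) ≤ proximity e ⊤ 1 from proximity_nonneg _).trans (hC 1 le_rfl)
    exact nonneg_of_mul_nonneg_left h1 (by positivity)
  -- `g'` is the logarithmic derivative of `exp g`
  have hg' : ∀ r, 1 ≤ r → ∀ z, ‖z‖ ≤ 2 * r →
      ‖deriv g z‖ ≤ 8 * (3 * C * 9 ^ (7 / 4 : ℝ) + c + 1) * r ^ (3 / 4 : ℝ) := by
    intro r hr z hz
    have hr0 : 0 < r := by linarith
    have hA : ∀ u : ℂ, ‖u‖ < 4 * r → Real.log ‖e u‖ ≤ 3 * C * 9 ^ (7 / 4 : ℝ) * r ^ (7 / 4 : ℝ) := by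
      intro u hu
      have h1 := posLog_norm_le_mul_proximity hed (w := u) (R := 8 * r) (by linarith)
      have h2 : (8 * r + ‖u‖) / (8 * r - ‖u‖) ≤ 3 := by
        rw [div_le_iff₀ (by linarith)]; linarith
      have h3 := hC (8 * r) (by linarith)
      have h4 : (1 + 8 * r) ^ (7 / 4 : ℝ) ≤ 9 ^ (7 / 4 : ℝ) * r ^ (7 / 4 : ℝ) := by
        rw [← Real.mul_rpow (by norm_num) hr0.le]
        gcongr
        linarith
      calc Real.log ‖e u‖ ≤ (8 * r + ‖u‖) / (8 * r - ‖u‖) * proximity e ⊤ (8 * r) :=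
            (le_max_right 0 _).trans h1
        _ ≤ 3 * (C * (9 ^ (7 / 4 : ℝ) * r ^ (7 / 4 : ℝ))) := by
            refine mul_le_mul h2 (h3.trans (by gcongr)) (proximity_nonneg _) (by norm_num)
        _ = _ := by ring
    have h1 := norm_deriv_div_le hed (r := 2 * r) (R := 4 * r) (by linarith)
      (fun z _ => Complex.exp_ne_zero _) (by positivity) hA hz
    have h2 : deriv e z / e z = deriv g z := by
      rw [he, ((hg z).hasDerivAt.cexp).deriv, mul_div_cancel_left₀ _ (Complex.exp_ne_zero _)]
    rw [h2] at h1
    refine h1.trans ?_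
    have h3 : 1 ≤ r ^ (7 / 4 : ℝ) := Real.one_le_rpow hr (by norm_num)
    have h4 : r ^ (7 / 4 : ℝ) = r * r ^ (3 / 4 : ℝ) := by
      nth_rw 2 [← Real.rpow_one r]
      rw [← Real.rpow_add hr0]
      norm_num
    calc 8 * (4 * r) / (4 * r - 2 * r) ^ 2
          * (3 * C * 9 ^ (7 / 4 : ℝ) * r ^ (7 / 4 : ℝ) + |Real.log ‖e 0‖| + 1)
        ≤ 8 * (4 * r) / (4 * r - 2 * r) ^ 2
          * ((3 * C * 9 ^ (7 / 4 : ℝ) + c + 1) * r ^ (7 / 4 : ℝ)) := by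
          refine mul_le_mul_of_nonneg_left ?_ (by positivity)
          have : c + 1 ≤ (c + 1) * r ^ (7 / 4 : ℝ) :=
            le_mul_of_one_le_right (by positivity) h3
          linarith
      _ = 8 * (3 * C * 9 ^ (7 / 4 : ℝ) + c + 1) * r ^ (3 / 4 : ℝ) := by
          rw [h4]
          have : 4 * r - 2 * r = 2 * r := by ring
          rw [this]
          field_simp
          ring
  -- Cauchy's estimate, since `3 / 4 < 1`
  have hg'' : ∀ z, deriv (deriv g) z = 0 := by
    intro z
    set K := 8 * (3 * C * 9 ^ (7 / 4 : ℝ) + c + 1) with hK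
    have hlim : Tendsto (fun r : ℝ => K * r ^ (-(1 / 4) : ℝ)) atTop (𝓝 0) := by
      simpa using (tendsto_rpow_neg_atTop (y := 1 / 4) (by norm_num)).const_mul K
    have hle : ‖deriv (deriv g) z‖ ≤ 0 := by
      refine ge_of_tendsto hlim ?_
      filter_upwards [eventually_ge_atTop (max 1 ‖z‖)] with r hr
      have hr1 : 1 ≤ r := (le_max_left _ _).trans hr
      have hzr : ‖z‖ ≤ r := (le_max_right _ _).trans hr
      have h1 := Complex.norm_deriv_le_of_forall_mem_sphere_norm_le (f := deriv g) (c := z)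
        (R := r) (C := K * r ^ (3 / 4 : ℝ)) (by linarith) hg.deriv.diffContOnCl
        (fun u hu => hg' r hr1 u (by
          have := norm_sub_norm_le u z
          simp only [mem_sphere, dist_eq_norm] at hu
          linarith))
      refine h1.trans (le_of_eq ?_)
      have h2 : r ^ (3 / 4 : ℝ) = r * r ^ (-(1 / 4) : ℝ) := by
        nth_rw 2 [← Real.rpow_one r]
        rw [← Real.rpow_add (by linarith)]
        norm_num
      rw [h2]
      field_simp
    exact norm_le_zero_iff.1 hle
  have hconst : ∀ z, deriv g z = deriv g 0 := fun z =>
    is_const_of_deriv_eq_zero hg.deriv hg'' z 0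
  refine ⟨deriv g 0, g 0, fun z => ?_⟩
  have h := is_const_of_deriv_eq_zero (f := fun z => g z - deriv g 0 * z)
    (hg.sub ((differentiable_const _).mul differentiable_id)) (fun z => by
      have : HasDerivAt (fun z => g z - deriv g 0 * z) (deriv g z - deriv g 0 * 1) z :=
        (hg z).hasDerivAt.sub ((hasDerivAt_id z).const_mul _)
      rw [this.deriv, hconst z]
      ring) z 0
  simp only [mul_zero, sub_zero] at h
  rw [← h]
  ring

theorem posLog_norm_sub_pow_le (b : ℂ) (m : ℕ) {r : ℝ} {z : ℂ} (hz : ‖z‖ = r) :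
    Real.posLog ‖(z - b) ^ m‖ ≤ m * (1 + ‖b‖) * (1 + r) := by
  have hr : 0 ≤ r := hz ▸ norm_nonneg z
  rw [norm_pow, Real.posLog_pow, mul_assoc]
  refine mul_le_mul_of_nonneg_left ?_ (Nat.cast_nonneg m)
  refine (Real.posLog_le_self (norm_nonneg _)).trans ((norm_sub_le _ _).trans ?_)
  rw [hz]
  nlinarith [norm_nonneg b, mul_nonneg (norm_nonneg b) hr]

/-- If `(z - b) ^ m exp g - 1` is a factor of an entire function `D ≢ 0` of order less than `2`,
then `g` is affine. -/
theorem exists_eq_affine_of_sub_pow_mul_exp {g G : ℂ → ℂ} (hg : Differentiable ℂ g)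
    (hG : Differentiable ℂ G) (b : ℂ) (m : ℕ) {B : ℝ}
    (hDB : ∀ z, Real.posLog ‖((z - b) ^ m * Complex.exp (g z) - 1) * G z‖
      ≤ B * (1 + ‖z‖) ^ (3 / 2 : ℝ))
    (hD0 : ∃ z, ((z - b) ^ m * Complex.exp (g z) - 1) * G z ≠ 0) :
    ∃ a c : ℂ, ∀ z, g z = a * z + c := by
  have hB : 0 ≤ B := by simpa using (Real.posLog_nonneg).trans (hDB 0)
  set p : ℂ → ℂ := fun z => (z - b) ^ m with hpdef
  have hp : Differentiable ℂ p := (differentiable_id.sub_const b).pow m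
  have hD : Differentiable ℂ fun z => ((z - b) ^ m * Complex.exp (g z) - 1) * G z :=
    ((hp.mul hg.cexp).sub_const 1).mul hG
  set p1 : ℂ → ℂ := fun z => deriv p z + p z * deriv g z with hp1def
  have hp1 : Differentiable ℂ p1 := hp.deriv.add (hp.mul hg.deriv)
  by_cases hp1z : ∀ z, p1 z = 0
  · -- `p * exp g` is constant, so that `m = 0`
    have hpconst := is_const_of_deriv_eq_zero (hp.mul hg.cexp) (fun z => by
      have h : HasDerivAt (p * fun z => Complex.exp (g z)) (deriv p z * Complex.exp (g z)
        + p z * (Complex.exp (g z) * deriv g z)) z :=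
        (hp z).hasDerivAt.mul (hg z).hasDerivAt.cexp
      rw [h.deriv]
      linear_combination Complex.exp (g z) * hp1z z)
    have hm : m = 0 := by
      by_contra hm
      have h := hpconst (b + 1) b
      simp [hpdef, hm] at h
    have hg0 : ∀ z, deriv g z = 0 := fun z => by
      have := hp1z z
      simpa [hp1def, hpdef, hm] using this
    exact ⟨0, g 0, fun z => by
      rw [is_const_of_deriv_eq_zero hg hg0 z 0]; ring⟩
  push Not at hp1z
  obtain ⟨z1, hz1⟩ := hp1z
  obtain ⟨z2, hz2⟩ := hD0
  obtain ⟨c, ⟨hc1, hc2⟩, hc3⟩ := (dense_of_eventually_codiscrete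
    (((hp1.eventually_codiscrete_ne_zero hz1).and (hD.eventually_codiscrete_ne_zero hz2)).and
    (hp.eventually_codiscrete_ne_zero (c := b + 1) (by simp [hpdef])))).nonempty
  -- Borel's argument needs nonvanishing at the origin, so recentre at a generic point `c`
  have hshift : Differentiable ℂ fun z : ℂ => z + c := differentiable_id.add_const c
  have hpc : Differentiable ℂ fun z => (z - (b - c)) ^ m := (differentiable_id.sub_const _).pow m
  have hpcd : ∀ z, deriv (fun z : ℂ => (z - (b - c)) ^ m) z = m * (z - (b - c)) ^ (m - 1) := by
    intro z
    simp
  have hpshift : ∀ z, (z - (b - c)) ^ m = p (z + c) := fun z => by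
    simp only [hpdef]; congr 1; ring
  have hpcd0 : deriv (fun z : ℂ => (z - (b - c)) ^ m) 0 = deriv p c := by
    have := deriv_comp_add_const p c 0
    rw [zero_add] at this
    rw [← this]
    congr 1
    exact funext hpshift
  have hgcd0 : deriv (fun z => g (z + c)) 0 = deriv g c := by
    have := deriv_comp_add_const g c 0
    rwa [zero_add] at this
  have hX : ∀ r : ℝ, 1 ≤ r → 1 + r ≤ (1 + r) ^ (7 / 4 : ℝ) := fun r hr => by
    have := Real.rpow_le_rpow_of_exponent_le (x := 1 + r) (by linarith)
      (show (1 : ℝ) ≤ 7 / 4 by norm_num)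
    rwa [Real.rpow_one] at this
  obtain ⟨C, hC⟩ := exists_proximity_exp_le_log (p := fun z => (z - (b - c)) ^ m)
    (g := fun z => g (z + c)) (G := fun z => G (z + c)) (B := B * (1 + ‖c‖) ^ (3 / 2 : ℝ))
    (Cp := m + m * (1 + ‖b - c‖)) hpc (hg.comp hshift) (hG.comp hshift)
    (fun z => by
      rw [hpshift]
      refine (hDB (z + c)).trans ?_
      rw [mul_assoc, ← Real.mul_rpow (by positivity) (by positivity)]
      gcongr
      have := norm_add_le z c
      nlinarith [mul_nonneg (norm_nonneg z) (norm_nonneg c)])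
    (by rw [hpshift, zero_add]; exact hc2) (by rw [hpshift, zero_add]; exact hc3)
    (by rw [hpcd0, hgcd0, hpshift, zero_add]; exact hc1)
    (fun r hr => proximity_top_le_of_forall hpc.meromorphic' (by linarith) fun z hz => by
      refine (posLog_norm_sub_pow_le _ _ hz).trans ?_
      have h1 : (0 : ℝ) ≤ m := Nat.cast_nonneg m
      have h2 := hX r hr
      have h3 : (m : ℝ) * (1 + ‖b - c‖) ≤ m + m * (1 + ‖b - c‖) := by linarith
      gcongr)
    (fun r hr => proximity_top_le_of_forall hpc.deriv.meromorphic' (by linarith) fun z hz => by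
      rw [hpcd z, norm_mul]
      refine Real.posLog_mul.trans ?_
      have h0 := posLog_norm_sub_pow_le (b - c) (m - 1) hz
      have h1 : (0 : ℝ) ≤ m := Nat.cast_nonneg m
      have h2 := hX r hr
      have h3 : Real.posLog ‖(m : ℂ)‖ ≤ m := by
        simpa using Real.posLog_le_self (norm_nonneg (m : ℂ))
      have h4 : ((m - 1 : ℕ) : ℝ) ≤ m := by exact_mod_cast Nat.sub_le m 1
      have h5 : (m : ℝ) ≤ m * (1 + r) := le_mul_of_one_le_right h1 (by linarith)
      calc _ ≤ (m : ℝ) * (1 + r) + m * (1 + ‖b - c‖) * (1 + r) := by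
            refine add_le_add (h3.trans h5) (h0.trans ?_)
            gcongr
        _ = (m + m * (1 + ‖b - c‖)) * (1 + r) := by ring
        _ ≤ _ := by gcongr)
  have hed : Differentiable ℂ fun z => Complex.exp (g (z + c)) := (hg.comp hshift).cexp
  obtain ⟨C', hC'⟩ := exists_le_rpow_of_forall_le_log (fun r => proximity_nonneg r)
    (fun r s hr hrs => proximity_top_mono hed (by linarith) hrs) hC
  obtain ⟨a, d, had⟩ := exists_eq_affine_of_proximity_exp_le (hg.comp hshift) hC'
  refine ⟨a, d - a * c, fun z => ?_⟩
  have := had (z - c)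
  simp only [Function.comp_apply, sub_add_cancel] at this
  rw [this]
  ring

/-! ### Dirichlet series in a right half-plane -/

/-- A Dirichlet series with first coefficient `1` and coefficients `O(√n)` tends to `1`
exponentially fast as `Re s → ∞`. -/
theorem exists_norm_LSeries_sub_one_le {a : ℕ → ℂ} (ha1 : a 1 = 1) {C : ℝ}
    (hC : ∀ n : ℕ, 1 ≤ n → ‖a n‖ ≤ C * (n : ℝ) ^ (1 / 2 : ℝ)) :
    ∃ K, 0 ≤ K ∧ ∀ s : ℂ, 2 ≤ s.re → ‖LSeries a s - 1‖ ≤ K * (2 : ℝ) ^ (-s.re) := by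
  have hC0 : 0 ≤ C := by simpa using (norm_nonneg _).trans (hC 1 le_rfl)
  have hsum : Summable fun n : ℕ => C * ((n + 2 : ℕ) : ℝ) ^ (-(3 / 2) : ℝ) :=
    ((summable_nat_add_iff 2).2 (Real.summable_nat_rpow.2 (by norm_num))).mul_left C
  set S := ∑' n : ℕ, C * ((n + 2 : ℕ) : ℝ) ^ (-(3 / 2) : ℝ) with hS
  have hS0 : 0 ≤ S := tsum_nonneg fun n => by positivity
  refine ⟨S * 4, by positivity, fun s hs => ?_⟩
  have hsummable : LSeriesSummable a s :=
    LSeriesSummable_of_le_const_mul_rpow (x := 3 / 2) (by linarith)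
      ⟨C, fun n hn => by
        have := hC n (Nat.one_le_iff_ne_zero.2 hn)
        norm_num at this ⊢
        exact this⟩
  have h1 := hsummable.sum_add_tsum_nat_add 2
  have h2 : ∑ i ∈ Finset.range 2, LSeries.term a s i = 1 := by
    simp [Finset.sum_range_succ, LSeries.term, ha1]
  have h3 : LSeries a s - 1 = ∑' n : ℕ, LSeries.term a s (n + 2) := by
    rw [h2] at h1
    rw [LSeries, ← h1]
    ring
  rw [h3]
  have h4 : HasSum (fun n : ℕ => C * ((n + 2 : ℕ) : ℝ) ^ (-(3 / 2) : ℝ)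
      * (4 * (2 : ℝ) ^ (-s.re))) (S * (4 * (2 : ℝ) ^ (-s.re))) := hsum.hasSum.mul_right _
  refine (tsum_of_norm_bounded h4 fun n => ?_).trans (le_of_eq (by ring))
  have hn2 : (2 : ℝ) ≤ ((n + 2 : ℕ) : ℝ) := by push_cast; linarith [n.cast_nonneg (α := ℝ)]
  have hn0 : (0 : ℝ) < ((n + 2 : ℕ) : ℝ) := by linarith
  rw [LSeries.norm_term_eq, if_neg (by omega)]
  have h5 := hC (n + 2) (by omega)
  have h6 : (4 : ℝ) * 2 ^ (-s.re) = 2 ^ (2 - s.re) := by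
    rw [sub_eq_add_neg, Real.rpow_add (by norm_num)]
    norm_num
  have h7 : ((n + 2 : ℕ) : ℝ) ^ (2 - s.re) ≤ 2 ^ (2 - s.re) :=
    Real.rpow_le_rpow_of_nonpos (by norm_num) hn2 (by linarith)
  rw [h6, div_le_iff₀ (Real.rpow_pos_of_pos hn0 _)]
  refine h5.trans ?_
  calc C * ((n + 2 : ℕ) : ℝ) ^ (1 / 2 : ℝ)
      = C * ((n + 2 : ℕ) : ℝ) ^ (-(3 / 2) : ℝ) * ((n + 2 : ℕ) : ℝ) ^ (2 - s.re)
        * ((n + 2 : ℕ) : ℝ) ^ s.re := by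
        rw [mul_assoc, mul_assoc, ← Real.rpow_add hn0, ← Real.rpow_add hn0]
        congr 2
        ring
    _ ≤ _ := by gcongr

/-! ### Growth of the gamma function -/

theorem Complex.norm_Gamma_le_Gamma_re {z : ℂ} (hz : 0 < z.re) :
    ‖Complex.Gamma z‖ ≤ Real.Gamma z.re := by
  rw [Complex.Gamma_eq_integral hz, Real.Gamma_eq_integral hz, Complex.GammaIntegral]
  refine (MeasureTheory.norm_integral_le_integral_norm _).trans (le_of_eq ?_)
  refine MeasureTheory.setIntegral_congr_fun measurableSet_Ioi fun x hx => ?_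
  simp only [norm_mul, Complex.norm_real, Real.norm_of_nonneg (Real.exp_pos _).le]
  rw [Complex.norm_cpow_eq_rpow_re_of_pos hx]
  simp

/-- A crude form of Stirling's bound, by comparison with a factorial. -/
theorem Real.Gamma_le_mul_rpow {x : ℝ} (hx : 1 / 2 ≤ x) :
    Real.Gamma x ≤ 2 * (x + 2) ^ (x + 2) := by
  have hx0 : 0 < x := by linarith
  have h1 : Real.Gamma (x + 2) = (x + 1) * (x * Real.Gamma x) := by
    rw [show x + 2 = (x + 1) + 1 by ring, Real.Gamma_add_one (by linarith),
      Real.Gamma_add_one (by linarith)]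
  have hG : 0 < Real.Gamma x := Real.Gamma_pos_of_pos hx0
  have h2 : Real.Gamma x ≤ 2 * Real.Gamma (x + 2) := by
    rw [h1]
    have : 1 ≤ 2 * ((x + 1) * x) := by nlinarith
    nlinarith
  have h3 : Real.Gamma (x + 2) ≤ Real.Gamma ((⌈x⌉₊ + 1 : ℕ) + 1) := by
    refine Real.Gamma_strictMonoOn_Ici.monotoneOn (by simp; linarith) ?_ ?_
    · simp only [mem_Ici]; push_cast; linarith [(⌈x⌉₊).cast_nonneg (α := ℝ)]
    · push_cast; linarith [Nat.le_ceil x]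
  rw [Real.Gamma_nat_eq_factorial] at h3
  have h4 : (((⌈x⌉₊ + 1).factorial : ℕ) : ℝ) ≤ ((⌈x⌉₊ + 1 : ℕ) : ℝ) ^ (⌈x⌉₊ + 1) := by
    exact_mod_cast Nat.factorial_le_pow _
  have h5 : ((⌈x⌉₊ + 1 : ℕ) : ℝ) ≤ x + 2 := by
    push_cast; linarith [Nat.ceil_lt_add_one hx0.le]
  have h6 : ((⌈x⌉₊ + 1 : ℕ) : ℝ) ^ (⌈x⌉₊ + 1) ≤ (x + 2) ^ (x + 2) := by
    calc ((⌈x⌉₊ + 1 : ℕ) : ℝ) ^ (⌈x⌉₊ + 1) ≤ (x + 2) ^ (⌈x⌉₊ + 1) := by gcongr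
      _ = (x + 2) ^ ((⌈x⌉₊ + 1 : ℕ) : ℝ) := (Real.rpow_natCast _ _).symm
      _ ≤ _ := Real.rpow_le_rpow_of_exponent_le (by linarith) h5
  linarith

theorem Real.exists_posLog_Gamma_le {τ : ℝ} (hτ : 1 < τ) :
    ∃ C, 0 ≤ C ∧ ∀ x, 1 / 2 ≤ x → Real.posLog (Real.Gamma x) ≤ C * (1 + x) ^ τ := by
  refine ⟨1 + 2 ^ τ / (τ - 1), by have : 0 < τ - 1 := by linarith
                                  positivity, fun x hx => ?_⟩
  have hτ1 : 0 < τ - 1 := by linarith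
  have hx2 : 0 < x + 2 := by linarith
  have h1 : 1 ≤ (x + 2) ^ (x + 2) := Real.one_le_rpow (by linarith) hx2.le
  have h2 := Real.posLog_le_posLog (Real.Gamma_pos_of_pos (by linarith)).le
    (Real.Gamma_le_mul_rpow hx)
  rw [Real.posLog_eq_log (x := 2 * (x + 2) ^ (x + 2)) (by
    rw [abs_of_pos (by positivity)]; linarith),
    Real.log_mul (by norm_num) (by positivity), Real.log_rpow hx2] at h2
  have h3 : (x + 2) * Real.log (x + 2) ≤ 2 ^ τ / (τ - 1) * (1 + x) ^ τ := by
    calc (x + 2) * Real.log (x + 2) ≤ (x + 2) * ((x + 2) ^ (τ - 1) / (τ - 1)) := by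
          gcongr
          exact Real.log_le_rpow_div hx2.le hτ1
      _ = (x + 2) ^ τ / (τ - 1) := by
          rw [← mul_div_assoc, Real.rpow_sub_one hx2.ne']
          field_simp
      _ ≤ (2 * (1 + x)) ^ τ / (τ - 1) := by
          gcongr
          linarith
      _ = _ := by rw [Real.mul_rpow (by norm_num) (by linarith)]; ring
  have h4 : Real.log 2 ≤ (1 + x) ^ τ := by
    have : 1 ≤ (1 + x) ^ τ := Real.one_le_rpow (by linarith) (by linarith)
    linarith [Real.log_two_lt_d9]
  linarith

theorem Complex.norm_sin_le_exp_norm (w : ℂ) : ‖Complex.sin w‖ ≤ Real.exp ‖w‖ := by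
  rw [Complex.sin, norm_div, norm_mul, Complex.norm_I, mul_one, Complex.norm_two,
    div_le_iff₀ (by norm_num)]
  refine (norm_sub_le _ _).trans ?_
  have h1 := Complex.norm_exp_le_exp_norm (-w * Complex.I)
  have h2 := Complex.norm_exp_le_exp_norm (w * Complex.I)
  rw [norm_mul, Complex.norm_I, mul_one, norm_neg] at h1
  rw [norm_mul, Complex.norm_I, mul_one] at h2
  linarith

/-- The reflection formula bounds `1 / Γ` in a left half-plane. -/
theorem Complex.norm_inv_Gamma_le {z : ℂ} (hz : z.re ≤ 1 / 2) :
    ‖(Complex.Gamma z)⁻¹‖ ≤ Real.Gamma (1 - z.re) * Real.exp (π * ‖z‖) := by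
  have hre : 0 < (1 - z).re := by simp; linarith
  have hGpos : 0 < Real.Gamma (1 - z.re) := Real.Gamma_pos_of_pos (by linarith)
  by_cases h0 : Complex.Gamma z = 0
  · rw [h0, inv_zero, norm_zero]; positivity
  have hr := Complex.Gamma_mul_Gamma_one_sub z
  have h1 : Complex.Gamma (1 - z) ≠ 0 := Complex.Gamma_ne_zero_of_re_pos hre
  have hsin : Complex.sin (π * z) ≠ 0 := by
    intro h
    rw [h, div_zero] at hr
    exact (mul_ne_zero h0 h1) hr
  have hπ : (π : ℂ) ≠ 0 := by exact_mod_cast Real.pi_ne_zero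
  have h2 : (Complex.Gamma z)⁻¹ = Complex.Gamma (1 - z) * Complex.sin (π * z) / π := by
    rw [eq_div_iff hsin] at hr
    rw [inv_eq_one_div, div_eq_div_iff h0 hπ]
    linear_combination -hr
  rw [h2, norm_div, norm_mul, Complex.norm_real, Real.norm_of_nonneg Real.pi_pos.le]
  have h3 := Complex.norm_Gamma_le_Gamma_re hre
  have h4 := Complex.norm_sin_le_exp_norm (π * z)
  rw [norm_mul, Complex.norm_real, Real.norm_of_nonneg Real.pi_pos.le] at h4
  have e1 : (1 - z).re = 1 - z.re := by simp
  rw [e1] at h3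
  refine (div_le_self (by positivity) (by linarith [Real.pi_gt_three])).trans ?_
  gcongr

/-! ### The functional equation in a left half-plane -/

/-- The functional equation bounds an L-function in a left half-plane: there, the quotient of gamma
factors is `exp (O(|s| ^ τ))` for every `τ > 1`. -/
theorem exists_posLog_norm_le_of_functionalEquation {L : ℂ → ℂ} {K : ℕ} {Q : ℝ} {lam : Fin K → ℝ}
    {mu : Fin K → ℂ} {ω : ℂ} (hQ : 0 < Q) (hlam : ∀ j, 0 < lam j) (hω : ‖ω‖ = 1)
    (hfe : completedLFun L Q lam mu =ᶠ[codiscrete ℂ]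
      fun s => ω * starRingEnd ℂ (completedLFun L Q lam mu (1 - starRingEnd ℂ s)))
    {M : ℝ} (hM : ∀ s : ℂ, 2 ≤ s.re → ‖L s‖ ≤ M)
    {F : ℂ → ℂ} (hF : Differentiable ℂ F) {k : ℕ} (hFL : ∀ s, s ≠ 1 → F s = (s - 1) ^ k * L s)
    {τ : ℝ} (hτ : 1 < τ) :
    ∃ A C : ℝ, ∀ s : ℂ, s.re < -A → Real.posLog ‖F s‖ ≤ C * (1 + ‖s‖) ^ τ := by
  -- for `Re s < -A`, every `λ_j (1 - conj s) + μ_j` and `1 - (λ_j s + μ_j)` has real part `≥ 1 / 2`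
  set A : ℝ := 2 + ∑ j, (|(mu j).re| + 1) / lam j with hA
  have hA2 : 2 ≤ A := by
    have : 0 ≤ ∑ j, (|(mu j).re| + 1) / lam j :=
      Finset.sum_nonneg fun j _ => div_nonneg (by positivity) (hlam j).le
    linarith
  have hlamA : ∀ j, |(mu j).re| + 1 ≤ lam j * A := fun j => by
    have h1 : (|(mu j).re| + 1) / lam j ≤ ∑ j, (|(mu j).re| + 1) / lam j :=
      Finset.single_le_sum (f := fun j => (|(mu j).re| + 1) / lam j)
        (fun j _ => div_nonneg (by positivity) (hlam j).le) (Finset.mem_univ j)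
    have h2 : (|(mu j).re| + 1) / lam j ≤ A := by linarith
    rwa [div_le_iff₀ (hlam j), mul_comm] at h2
  -- the points where the functional equation can be solved for `L s`
  set S : Set ℂ := {s | completedLFun L Q lam mu s
      = ω * starRingEnd ℂ (completedLFun L Q lam mu (1 - starRingEnd ℂ s))
    ∧ ∀ j, (Complex.Gamma ((lam j : ℂ) * s + mu j))⁻¹ ≠ 0} with hS
  have hSd : Dense S := by
    refine dense_of_eventually_codiscrete (hfe.and ?_)
    rw [eventually_all]
    intro j
    have hd : Differentiable ℂ fun s : ℂ => (Complex.Gamma ((lam j : ℂ) * s + mu j))⁻¹ :=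
      Complex.differentiable_one_div_Gamma.comp
        (((differentiable_const _).mul differentiable_id).add_const _)
    refine hd.eventually_codiscrete_ne_zero (c := (1 - mu j) / lam j) ?_
    have : (lam j : ℂ) ≠ 0 := by exact_mod_cast (hlam j).ne'
    rw [mul_div_cancel₀ _ this, sub_add_cancel, Complex.Gamma_one]
    simp
  -- growth as a statement about `O` on the good part of the half-plane
  set T : Set ℂ := S ∩ {s | s.re < -A} with hT
  set w : ℂ → ℝ := fun s => (1 + ‖s‖) ^ τ with hw
  have hlin : ∀ c : ℝ, 0 ≤ c → ∀ s : ℂ, c * (1 + ‖s‖) ≤ c * w s := fun c hc s => by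
    have : (1 + ‖s‖) ^ (1 : ℝ) ≤ (1 + ‖s‖) ^ τ :=
      Real.rpow_le_rpow_of_exponent_le (by linarith [norm_nonneg s]) hτ.le
    rw [Real.rpow_one] at this
    gcongr
  have hbig : ∀ (f : ℂ → ℝ) (c : ℝ), 0 ≤ c → (∀ s ∈ T, 0 ≤ f s) →
      (∀ s ∈ T, f s ≤ c * (1 + ‖s‖)) → f =O[𝓟 T] w := fun f c hc hf0 hf => by
    refine isBigO_principal.2 ⟨c, fun s hs => ?_⟩
    rw [Real.norm_of_nonneg (hf0 s hs), Real.norm_of_nonneg (by positivity)]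
    exact (hf s hs).trans (hlin c hc s)
  obtain ⟨CΓ, hCΓ0, hCΓ⟩ := Real.exists_posLog_Gamma_le hτ
  have hgam : ∀ (x : ℂ → ℝ) (c : ℝ), 0 ≤ c → (∀ s ∈ T, 1 / 2 ≤ x s ∧ 1 + x s ≤ c * (1 + ‖s‖)) →
      (fun s => Real.posLog (Real.Gamma (x s))) =O[𝓟 T] w := fun x c hc hx => by
    refine isBigO_principal.2 ⟨CΓ * c ^ τ, fun s hs => ?_⟩
    obtain ⟨h1, h2⟩ := hx s hs
    rw [Real.norm_of_nonneg Real.posLog_nonneg, Real.norm_of_nonneg (by positivity)]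
    refine (hCΓ _ h1).trans ?_
    rw [mul_assoc, ← Real.mul_rpow hc (by positivity)]
    have h3 : 0 ≤ 1 + x s := by linarith
    gcongr
  have hre : ∀ s : ℂ, |s.re| ≤ ‖s‖ := Complex.abs_re_le_norm
  have hΓ1 : ∀ j, (fun s => Real.posLog
      (Real.Gamma (((lam j : ℂ) * (1 - starRingEnd ℂ s) + mu j).re))) =O[𝓟 T] w := fun j => by
    refine hgam _ (1 + lam j + |(mu j).re|) (by have := hlam j; positivity) fun s hs => ?_
    have h1 : s.re < -A := hs.2
    have h2 := hlamA j
    have h3 := hlam j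
    have h4 := neg_abs_le (mu j).re
    have h5 := le_abs_self (mu j).re
    have h6 := neg_abs_le s.re
    have h7 := hre s
    have e : ((lam j : ℂ) * (1 - starRingEnd ℂ s) + mu j).re
        = lam j * (1 - s.re) + (mu j).re := by simp
    rw [e]
    constructor
    · nlinarith
    · have h8 : lam j * (-s.re) ≤ lam j * ‖s‖ := by gcongr; linarith
      nlinarith [norm_nonneg s, mul_nonneg (abs_nonneg (mu j).re) (norm_nonneg s)]
  have hΓ2 : ∀ j, (fun s => Real.posLog
      (Real.Gamma (1 - ((lam j : ℂ) * s + mu j).re))) =O[𝓟 T] w := fun j => by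
    refine hgam _ (2 + lam j + |(mu j).re|) (by have := hlam j; positivity) fun s hs => ?_
    have h1 : s.re < -A := hs.2
    have h2 := hlamA j
    have h3 := hlam j
    have h4 := neg_abs_le (mu j).re
    have h5 := le_abs_self (mu j).re
    have h6 := neg_abs_le s.re
    have h7 := hre s
    have e : ((lam j : ℂ) * s + mu j).re = lam j * s.re + (mu j).re := by simp
    rw [e]
    constructor
    · nlinarith
    · have h8 : lam j * (-s.re) ≤ lam j * ‖s‖ := by gcongr; linarith
      nlinarith [norm_nonneg s, mul_nonneg (abs_nonneg (mu j).re) (norm_nonneg s)]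
  have hΓ3 : ∀ j, (fun s : ℂ => π * ‖(lam j : ℂ) * s + mu j‖) =O[𝓟 T] w := fun j => by
    refine hbig _ (π * (lam j + ‖mu j‖)) (by have := hlam j; positivity)
      (fun s _ => by positivity) fun s _ => ?_
    have h1 := norm_add_le ((lam j : ℂ) * s) (mu j)
    rw [norm_mul, Complex.norm_real, Real.norm_of_nonneg (hlam j).le] at h1
    rw [mul_assoc]
    refine mul_le_mul_of_nonneg_left ?_ Real.pi_pos.le
    have h2 := (hlam j).le
    nlinarith [norm_nonneg s, mul_nonneg (norm_nonneg (mu j)) (norm_nonneg s)]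
  have hsum : (fun s => ∑ j, (Real.posLog
      (Real.Gamma (((lam j : ℂ) * (1 - starRingEnd ℂ s) + mu j).re))
      + (Real.posLog (Real.Gamma (1 - ((lam j : ℂ) * s + mu j).re))
        + π * ‖(lam j : ℂ) * s + mu j‖))) =O[𝓟 T] w :=
    IsBigO.fun_sum fun j _ => (hΓ1 j).add ((hΓ2 j).add (hΓ3 j))
  have hrest : (fun s : ℂ => k * (1 + ‖(1 : ℂ)‖) * (1 + ‖s‖) + Real.posLog M
      + 2 * |Real.log Q| * (1 + ‖s‖)) =O[𝓟 T] w := by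
    refine hbig _ (k * (1 + ‖(1 : ℂ)‖) + Real.posLog M + 2 * |Real.log Q|) ?_ ?_ ?_
    · have := Real.posLog_nonneg (x := M); positivity
    · intro s _; have := Real.posLog_nonneg (x := M); positivity
    · intro s _
      have := mul_nonneg (Real.posLog_nonneg (x := M)) (norm_nonneg s)
      nlinarith
  obtain ⟨C, hC⟩ := isBigO_principal.1 (hrest.add hsum)
  have hTle : ∀ s ∈ T, Real.posLog ‖F s‖ ≤ C * (1 + ‖s‖) ^ τ := by
    intro s hs
    have hsA : s.re < -A := hs.2
    obtain ⟨hfes, hne⟩ := hs.1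
    have h1 := hC s hs
    rw [Real.norm_of_nonneg (show 0 ≤ w s by positivity)] at h1
    refine le_trans ?_ ((le_abs_self _).trans h1)
    have hs1 : s ≠ 1 := by rintro rfl; simp at hsA; linarith
    -- solve the functional equation for `‖L s‖`
    have h2 := congrArg norm hfes
    simp only [completedLFun, norm_mul, hω, one_mul, RCLike.norm_conj, norm_prod,
      Complex.norm_cpow_eq_rpow_re_of_pos hQ] at h2
    have e1 : (1 - starRingEnd ℂ s).re = 1 - s.re := by simp
    rw [e1] at h2
    have hprod : (∏ j, ‖Complex.Gamma ((lam j : ℂ) * s + mu j)‖)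
        * ∏ j, ‖(Complex.Gamma ((lam j : ℂ) * s + mu j))⁻¹‖ = 1 := by
      rw [← Finset.prod_mul_distrib]
      refine Finset.prod_eq_one fun j _ => ?_
      rw [← norm_mul, mul_inv_cancel₀ (fun h => hne j (by rw [h, inv_zero])), norm_one]
    have hQs : Q ^ s.re * Q ^ (-s.re) = 1 := by
      rw [← Real.rpow_add hQ, add_neg_cancel, Real.rpow_zero]
    have e2 : Q ^ (1 - s.re) * Q ^ (-s.re) = Q ^ (1 - 2 * s.re) := by
      rw [← Real.rpow_add hQ]; ring_nf
    have hL : ‖L s‖ = ‖L (1 - starRingEnd ℂ s)‖ * Q ^ (1 - 2 * s.re)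
        * ∏ j, (‖Complex.Gamma ((lam j : ℂ) * (1 - starRingEnd ℂ s) + mu j)‖
          * ‖(Complex.Gamma ((lam j : ℂ) * s + mu j))⁻¹‖) := by
      rw [Finset.prod_mul_distrib, ← e2]
      calc ‖L s‖ = ‖L s‖ * (Q ^ s.re * Q ^ (-s.re))
            * ((∏ j, ‖Complex.Gamma ((lam j : ℂ) * s + mu j)‖)
            * ∏ j, ‖(Complex.Gamma ((lam j : ℂ) * s + mu j))⁻¹‖) := by
            rw [hprod, hQs]; ring
        _ = (‖L s‖ * Q ^ s.re * ∏ j, ‖Complex.Gamma ((lam j : ℂ) * s + mu j)‖) * Q ^ (-s.re)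
            * ∏ j, ‖(Complex.Gamma ((lam j : ℂ) * s + mu j))⁻¹‖ := by ring
        _ = _ := by rw [h2]; ring
    have hLM : Real.posLog ‖L (1 - starRingEnd ℂ s)‖ ≤ Real.posLog M :=
      Real.posLog_le_posLog (norm_nonneg _) (hM _ (by rw [e1]; linarith))
    have hQlog : Real.posLog (Q ^ (1 - 2 * s.re)) ≤ 2 * |Real.log Q| * (1 + ‖s‖) := by
      rw [Real.posLog_def]
      refine max_le (by positivity) ?_
      change Real.log _ ≤ _
      rw [Real.log_rpow hQ]
      have h3 : |1 - 2 * s.re| ≤ 2 * (1 + ‖s‖) := by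
        have := hre s
        rw [abs_le] at this ⊢
        constructor <;> linarith
      calc (1 - 2 * s.re) * Real.log Q ≤ |(1 - 2 * s.re) * Real.log Q| := le_abs_self _
        _ = |1 - 2 * s.re| * |Real.log Q| := abs_mul _ _
        _ ≤ 2 * (1 + ‖s‖) * |Real.log Q| := by gcongr
        _ = _ := by ring
    have hfac : ∀ j, Real.posLog (‖Complex.Gamma ((lam j : ℂ) * (1 - starRingEnd ℂ s) + mu j)‖
          * ‖(Complex.Gamma ((lam j : ℂ) * s + mu j))⁻¹‖)
        ≤ Real.posLog (Real.Gamma (((lam j : ℂ) * (1 - starRingEnd ℂ s) + mu j).re))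
          + (Real.posLog (Real.Gamma (1 - ((lam j : ℂ) * s + mu j).re))
          + π * ‖(lam j : ℂ) * s + mu j‖) := by
      intro j
      have h2 := hlamA j
      have h3 := hlam j
      have h4 := neg_abs_le (mu j).re
      have h5 := le_abs_self (mu j).re
      refine Real.posLog_mul.trans (add_le_add ?_ ?_)
      · refine Real.posLog_le_posLog (norm_nonneg _) (Complex.norm_Gamma_le_Gamma_re ?_)
        simp
        nlinarith
      · refine (Real.posLog_le_posLog (norm_nonneg _) (Complex.norm_inv_Gamma_le ?_)).trans ?_
        · simp
          nlinarith
        · refine Real.posLog_mul.trans (add_le_add le_rfl ?_)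
          rw [Real.posLog_def]
          refine max_le (by positivity) ?_
          change Real.log _ ≤ _
          rw [Real.log_exp]
    calc Real.posLog ‖F s‖ = Real.posLog (‖(s - 1) ^ k‖ * ‖L s‖) := by
          rw [hFL s hs1, norm_mul]
      _ ≤ Real.posLog ‖(s - 1) ^ k‖ + Real.posLog ‖L s‖ := Real.posLog_mul
      _ ≤ k * (1 + ‖(1 : ℂ)‖) * (1 + ‖s‖) + ((Real.posLog M + 2 * |Real.log Q| * (1 + ‖s‖))
          + ∑ j, (Real.posLog (Real.Gamma (((lam j : ℂ) * (1 - starRingEnd ℂ s) + mu j).re))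
            + (Real.posLog (Real.Gamma (1 - ((lam j : ℂ) * s + mu j).re))
            + π * ‖(lam j : ℂ) * s + mu j‖))) := by
          refine add_le_add (posLog_norm_sub_pow_le 1 k rfl) ?_
          rw [hL]
          refine Real.posLog_mul.trans (add_le_add (Real.posLog_mul.trans
            (add_le_add hLM hQlog)) ?_)
          exact (Real.posLog_prod _ _).trans (Finset.sum_le_sum fun j _ => hfac j)
      _ = _ := by ring
  refine ⟨A, C, fun s hs => ?_⟩
  -- the good points are dense, and the bound is a closed condition
  have hclosed : IsClosed {s : ℂ | Real.posLog ‖F s‖ ≤ C * (1 + ‖s‖) ^ τ} := by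
    refine isClosed_le (Real.continuous_posLog.comp hF.continuous.norm) ?_
    exact continuous_const.mul ((continuous_const.add continuous_norm).rpow_const
      fun s => Or.inr (by linarith))
  have hopen : IsOpen {s : ℂ | s.re < -A} := isOpen_lt Complex.continuous_re continuous_const
  have hsub := hSd.open_subset_closure_inter hopen
  rw [inter_comm] at hsub
  exact (closure_minimal (fun s hs => hTle s hs) hclosed) (hsub hs)

/-! ### Orders of entire functions and the order of L-functions -/

theorem nevanlinnaOrder_eq_limsup_proximity {F : ℂ → ℂ} (hF : Differentiable ℂ F) :
    nevanlinnaOrder F = limsup (fun r : ℝ =>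
      ((Real.posLog (proximity F ⊤ r) / Real.log r : ℝ) : EReal)) atTop := by
  rw [nevanlinnaOrder, characteristic_top_of_differentiable hF]

theorem tendsto_const_add_log_div_log (a x : ℝ) :
    Tendsto (fun r : ℝ => (((a + x * Real.log r) / Real.log r : ℝ) : EReal)) atTop
      (𝓝 (x : EReal)) := by
  refine (continuous_coe_real_ereal.tendsto x).comp ?_
  have h1 : Tendsto (fun r : ℝ => a / Real.log r + x) atTop (𝓝 (0 + x)) :=
    (Real.tendsto_log_atTop.const_div_atTop a).add_const x
  rw [zero_add] at h1
  refine h1.congr' ?_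
  filter_upwards [eventually_gt_atTop 1] with r hr
  have := (Real.log_pos hr).ne'
  field_simp

theorem nevanlinnaOrder_le {F : ℂ → ℂ} (hF : Differentiable ℂ F) {C x : ℝ} (hx : 0 ≤ x)
    (h : ∀ r, 1 ≤ r → proximity F ⊤ r ≤ C * (1 + r) ^ x) : nevanlinnaOrder F ≤ (x : EReal) := by
  rw [nevanlinnaOrder_eq_limsup_proximity hF,
    ← (tendsto_const_add_log_div_log (Real.log ((1 + |C|) * 2 ^ x)) x).limsup_eq]
  refine limsup_le_limsup ?_
  filter_upwards [eventually_gt_atTop 1] with r hr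
  have hr0 : 0 < r := by linarith
  have hl := Real.log_pos hr
  have hK : 1 ≤ (1 + |C|) * 2 ^ x * r ^ x := by
    have h1 := Real.one_le_rpow (x := 2) (by norm_num) hx
    have h2 := Real.one_le_rpow hr.le hx
    have h3 : (1 : ℝ) ≤ 1 + |C| := by linarith [abs_nonneg C]
    exact one_le_mul_of_one_le_of_one_le (one_le_mul_of_one_le_of_one_le h3 h1) h2
  have h1 : proximity F ⊤ r ≤ (1 + |C|) * 2 ^ x * r ^ x := by
    refine (h r hr.le).trans ?_
    rw [mul_assoc, ← Real.mul_rpow (by norm_num) hr0.le]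
    have h3 : C ≤ 1 + |C| := by linarith [le_abs_self C]
    have h4 : 1 + r ≤ 2 * r := by linarith
    gcongr
  have h2 : Real.posLog (proximity F ⊤ r) ≤ Real.log ((1 + |C|) * 2 ^ x) + x * Real.log r := by
    rw [← Real.log_rpow hr0, ← Real.log_mul (by positivity) (by positivity),
      ← Real.posLog_eq_log (x := _) (by rwa [abs_of_nonneg (by positivity)])]
    exact Real.posLog_le_posLog (proximity_nonneg r) h1
  exact EReal.coe_le_coe_iff.2 (div_le_div_of_nonneg_right h2 hl.le)

/-- Exponential growth on circles forces the order to be at least `1`. -/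
theorem one_le_nevanlinnaOrder {F : ℂ → ℂ} (hF : Differentiable ℂ F) {c C : ℝ} (hc : 0 < c)
    (h : ∀ᶠ r in atTop, c * r - C ≤ proximity F ⊤ r) : 1 ≤ nevanlinnaOrder F := by
  have e : ((1 : ℝ) : EReal) = 1 := rfl
  rw [nevanlinnaOrder_eq_limsup_proximity hF, ← e,
    ← (tendsto_const_add_log_div_log (Real.log (c / 2)) 1).limsup_eq]
  refine limsup_le_limsup ?_
  filter_upwards [h, eventually_gt_atTop 1, eventually_ge_atTop (2 * C / c)] with r h1 hr hr2
  have hr0 : 0 < r := by linarith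
  rw [div_le_iff₀ hc] at hr2
  refine EReal.coe_le_coe_iff.2 (div_le_div_of_nonneg_right ?_ (Real.log_pos hr).le)
  rw [one_mul, ← Real.log_mul (by positivity) hr0.ne']
  have h2 : c / 2 * r ≤ proximity F ⊤ r := by linarith
  exact (Real.log_le_log (by positivity) h2).trans (le_max_right 0 _)

/-- Finite order gives a pointwise bound with a (non-optimal) integer exponent. -/
theorem exists_posLog_norm_le_of_nevanlinnaOrder_lt_top {F : ℂ → ℂ} (hF : Differentiable ℂ F)
    (h : nevanlinnaOrder F < ⊤) :
    ∃ (N : ℕ) (C : ℝ), ∀ z, Real.posLog ‖F z‖ ≤ C * (1 + ‖z‖) ^ (N : ℝ) := by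
  rw [nevanlinnaOrder_eq_limsup_proximity hF] at h
  obtain ⟨c, hc, -⟩ := EReal.lt_iff_exists_real_btwn.1 h
  obtain ⟨r₁, hr₁⟩ := eventually_atTop.1 (eventually_lt_of_limsup_lt hc)
  set r₀ : ℝ := max r₁ 2 with hr₀
  have hr₀1 : 2 ≤ r₀ := le_max_right _ _
  obtain ⟨N, hN⟩ := exists_nat_ge c
  have hprox : ∀ r, r₀ ≤ r → proximity F ⊤ r ≤ r ^ (N : ℝ) := fun r hr => by
    have h1 := EReal.coe_lt_coe_iff.1 (hr₁ r ((le_max_left _ _).trans hr))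
    have hl := Real.log_pos (show 1 < r by linarith)
    rw [div_lt_iff₀ hl] at h1
    have h2 : Real.posLog (proximity F ⊤ r) ≤ N * Real.log r :=
      h1.le.trans (mul_le_mul_of_nonneg_right hN hl.le)
    have h0 : 0 ≤ proximity F ⊤ r := proximity_nonneg _
    rcases h0.eq_or_lt with h0 | h0
    · rw [← h0]; exact Real.rpow_nonneg (by linarith) _
    · have h3 : Real.log (proximity F ⊤ r) ≤ Real.log (r ^ (N : ℝ)) := by
        rw [Real.log_rpow (by linarith)]
        exact (le_max_right 0 _).trans h2
      exact (Real.log_le_log_iff h0 (Real.rpow_pos_of_pos (by linarith) _)).1 h3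
  refine ⟨N, 3 * (2 + r₀) ^ (N : ℝ), fun z => ?_⟩
  have hz := norm_nonneg z
  refine (posLog_norm_le_mul_proximity hF (w := z) (R := 2 * ‖z‖ + r₀) (by linarith)).trans ?_
  have h3 : (2 * ‖z‖ + r₀ + ‖z‖) / (2 * ‖z‖ + r₀ - ‖z‖) ≤ 3 := by
    rw [div_le_iff₀ (by linarith)]; linarith
  rw [mul_assoc, ← Real.mul_rpow (by linarith) (by linarith)]
  refine mul_le_mul h3 ((hprox _ (by linarith)).trans ?_) (proximity_nonneg _) (by norm_num)
  exact Real.rpow_le_rpow (by linarith) (by nlinarith) (by positivity)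

theorem circleAverage_poissonKernel {w : ℂ} {R : ℝ} (hw : ‖w‖ < R) :
    Real.circleAverage (poissonKernel 0 w) 0 R = 1 := by
  have h := InnerProductSpace.HarmonicOnNhd.circleAverage_poissonKernel_smul (c := 0) (R := R)
    (f := fun _ : ℂ => (1 : ℝ)) (w := w)
    (fun z _ => InnerProductSpace.harmonicAt_const 1) (by simpa using hw)
  rw [← h]
  congr 1
  ext z
  simp

theorem circleIntegrable_poissonKernel {w : ℂ} {R : ℝ} (hw : ‖w‖ < R) :
    CircleIntegrable (poissonKernel 0 w) 0 R := by
  have hR : 0 < R := (norm_nonneg w).trans_lt hw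
  refine ContinuousOn.circleIntegrable hR.le ?_
  unfold poissonKernel
  refine ContinuousOn.div (by fun_prop) (by fun_prop) fun z hz => ?_
  simp only [sub_zero]
  refine pow_ne_zero 2 (norm_ne_zero_iff.2 (sub_ne_zero.2 ?_))
  rintro rfl
  simp at hz
  linarith

theorem poissonKernel_nonneg {w z : ℂ} (h : ‖w‖ ≤ ‖z‖) : 0 ≤ poissonKernel 0 w z := by
  rw [poissonKernel_def]
  simp only [sub_zero]
  refine div_nonneg ?_ (by positivity)
  nlinarith [norm_nonneg w]

/-- On the circle `|z| = R`, the two arcs in a vertical strip around the imaginary axis carry a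
proportion `O(1 / R)` of the length. In quantitative form: their indicator function is bounded by
a small multiple of two Poisson kernels. -/
theorem one_le_mul_poissonKernel_add {z : ℂ} {A R : ℝ} (hA : 0 < A) (hR : A < R) (hz : ‖z‖ = R)
    (hre : |z.re| ≤ A) :
    1 ≤ 2 * A / R * (poissonKernel 0 ((R - A : ℝ) * Complex.I) z
      + poissonKernel 0 (-((R - A : ℝ) * Complex.I)) z) := by
  have hR0 : 0 < R := hA.trans hR
  have hn : ‖((R - A : ℝ) : ℂ) * Complex.I‖ = R - A := by
    rw [norm_mul, Complex.norm_I, mul_one, Complex.norm_real, Real.norm_of_nonneg (by linarith)]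
  have hsq : z.re ^ 2 + z.im ^ 2 = R ^ 2 := by
    rw [← hz, ← Complex.normSq_eq_norm_sq, Complex.normSq_apply]; ring
  have hre2 : z.re ^ 2 ≤ A ^ 2 := sq_le_sq' (abs_le.1 hre).1 (abs_le.1 hre).2
  -- one kernel is at least `R / (2 A)` on each arc
  have key : ∀ σ : ℝ, σ ^ 2 = 1 → 0 ≤ σ * z.im →
      R / (2 * A) ≤ poissonKernel 0 ((σ * (R - A) : ℝ) * Complex.I) z := fun σ hσ hσz => by
    have h1 : (σ * z.im) ^ 2 = R ^ 2 - z.re ^ 2 := by rw [mul_pow, hσ]; linarith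
    have h2 : R - A ≤ σ * z.im := abs_le_of_sq_le_sq' (by nlinarith) hσz |>.2
    have h3 : σ * z.im ≤ R := abs_le_of_sq_le_sq' (by nlinarith) hR0.le |>.2
    have h4 : ‖z - ((σ * (R - A) : ℝ) : ℂ) * Complex.I‖ ^ 2
        = z.re ^ 2 + (σ * z.im - (R - A)) ^ 2 := by
      rw [← Complex.normSq_eq_norm_sq, Complex.normSq_apply]
      simp only [Complex.sub_re, Complex.sub_im, Complex.re_ofReal_mul, Complex.im_ofReal_mul,
        Complex.I_re, Complex.I_im]
      have : (z.im - σ * (R - A)) ^ 2 = (σ * z.im - (R - A)) ^ 2 := by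
        linear_combination (-z.im ^ 2 + (R - A) ^ 2) * hσ
      linear_combination this
    have h5 : ‖((σ * (R - A) : ℝ) : ℂ) * Complex.I‖ ^ 2 = (R - A) ^ 2 := by
      rw [norm_mul, Complex.norm_I, mul_one, Complex.norm_real, Real.norm_eq_abs, sq_abs, mul_pow,
        hσ, one_mul]
    rw [poissonKernel_def]
    simp only [sub_zero]
    rw [h4, h5, hz]
    have h6 : 0 < z.re ^ 2 + (σ * z.im - (R - A)) ^ 2 := by
      rw [← h4]
      have : z ≠ ((σ * (R - A) : ℝ) : ℂ) * Complex.I := by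
        intro h
        rw [← h, hz] at h5
        nlinarith
      have := norm_pos_iff.2 (sub_ne_zero.2 this)
      positivity
    have h7 : z.re ^ 2 + (σ * z.im - (R - A)) ^ 2 ≤ 2 * A ^ 2 := by nlinarith
    rw [div_le_div_iff₀ (by positivity) h6]
    nlinarith
  have hK1 : 0 ≤ poissonKernel 0 ((R - A : ℝ) * Complex.I) z :=
    poissonKernel_nonneg (by rw [hn, hz]; linarith)
  have hK2 : 0 ≤ poissonKernel 0 (-((R - A : ℝ) * Complex.I)) z :=
    poissonKernel_nonneg (by rw [norm_neg, hn, hz]; linarith)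
  have h8 : R / (2 * A) ≤ poissonKernel 0 ((R - A : ℝ) * Complex.I) z
      + poissonKernel 0 (-((R - A : ℝ) * Complex.I)) z := by
    rcases le_total 0 z.im with h | h
    · have := key 1 (by norm_num) (by linarith)
      rw [one_mul] at this
      linarith
    · have := key (-1) (by norm_num) (by linarith)
      rw [neg_one_mul, Complex.ofReal_neg, neg_mul] at this
      linarith
  calc (1 : ℝ) = 2 * A / R * (R / (2 * A)) := by field_simp
    _ ≤ _ := mul_le_mul_of_nonneg_left h8 (by positivity)

/-- A bound `B₂` on the whole circle contributes to the mean only with weight `O(1 / R)` if a bound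
`B₁` holds outside a vertical strip. -/
theorem proximity_le_of_strip {F : ℂ → ℂ} (hF : Differentiable ℂ F) {A R B₁ B₂ : ℝ} (hA : 0 < A)
    (hR : A < R) (hB₁ : 0 ≤ B₁) (hB₂ : 0 ≤ B₂)
    (hout : ∀ z, ‖z‖ = R → A < |z.re| → Real.posLog ‖F z‖ ≤ B₁)
    (hin : ∀ z, ‖z‖ = R → Real.posLog ‖F z‖ ≤ B₂) :
    proximity F ⊤ R ≤ B₁ + 4 * A / R * B₂ := by
  have hR0 : 0 < R := hA.trans hR
  have hn : ‖((R - A : ℝ) : ℂ) * Complex.I‖ = R - A := by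
    rw [norm_mul, Complex.norm_I, mul_one, Complex.norm_real, Real.norm_of_nonneg (by linarith)]
  have hw1 : ‖((R - A : ℝ) : ℂ) * Complex.I‖ < R := by rw [hn]; linarith
  have hw2 : ‖-(((R - A : ℝ) : ℂ) * Complex.I)‖ < R := by rw [norm_neg, hn]; linarith
  have i1 := circleIntegrable_poissonKernel hw1
  have i2 := circleIntegrable_poissonKernel hw2
  have i3 := (i1.add i2).const_smul (a := 2 * A / R * B₂)
  have i4 : CircleIntegrable (fun _ : ℂ => B₁) 0 R := circleIntegrable_const _ _ _
  rw [proximity_top]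
  refine (Real.circleAverage_mono (hF.meromorphic'.circleIntegrable_posLog R) (i4.add i3)
    fun z hz => ?_).trans ?_
  · rw [abs_of_nonneg hR0.le] at hz
    have hz' : ‖z‖ = R := by simpa using hz
    have k1 : 0 ≤ poissonKernel 0 ((R - A : ℝ) * Complex.I) z :=
      poissonKernel_nonneg (by rw [hn, hz']; linarith)
    have k2 : 0 ≤ poissonKernel 0 (-((R - A : ℝ) * Complex.I)) z :=
      poissonKernel_nonneg (by rw [norm_neg, hn, hz']; linarith)
    simp only [Pi.add_apply, Pi.smul_apply, smul_eq_mul]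
    rcases lt_or_ge A |z.re| with h | h
    · have : 0 ≤ 2 * A / R * B₂ * (poissonKernel 0 ((R - A : ℝ) * Complex.I) z
        + poissonKernel 0 (-((R - A : ℝ) * Complex.I)) z) := by positivity
      linarith [hout z hz' h]
    · have h1 := one_le_mul_poissonKernel_add hA hR hz' h
      have h2 := mul_le_mul_of_nonneg_left h1 hB₂
      have h3 := hin z hz'
      linarith
  · rw [Real.circleAverage_add i4 i3, Real.circleAverage_smul, Real.circleAverage_add i1 i2,
      circleAverage_poissonKernel hw1, circleAverage_poissonKernel hw2, Real.circleAverage_const,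
      smul_eq_mul]
    apply le_of_eq
    ring

/-- Outside a vertical strip, an entire function grows like `exp (O(|z| ^ τ))`. If it grows like
`exp (O(|z| ^ x))` everywhere, then the mean over circles hardly sees the strip, and the exponent
`x` can be lowered to `x - 1`. -/
theorem exists_posLog_norm_le_max {F : ℂ → ℂ} (hF : Differentiable ℂ F) {A τ x C₁ C₂ : ℝ}
    (hτ : 1 < τ) (hout : ∀ z : ℂ, A < |z.re| → Real.posLog ‖F z‖ ≤ C₁ * (1 + ‖z‖) ^ τ)
    (hin : ∀ z, Real.posLog ‖F z‖ ≤ C₂ * (1 + ‖z‖) ^ x) :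
    ∃ C, ∀ z, Real.posLog ‖F z‖ ≤ C * (1 + ‖z‖) ^ max τ (x - 1) := by
  set A' : ℝ := max A 1 with hA'
  have hA'1 : 1 ≤ A' := le_max_right _ _
  set y := max τ (x - 1) with hy
  have hy0 : 0 ≤ y := by have := le_max_left τ (x - 1); linarith
  refine ⟨3 * ((|C₁| + 8 * A' * |C₂|) * (2 + 2 * A') ^ y), fun z => ?_⟩
  have hz := norm_nonneg z
  set R := 2 * ‖z‖ + 2 * A' with hR
  have hR1 : 1 ≤ R := by linarith
  have hpow : ∀ t, t ≤ y → (1 + R) ^ t ≤ (1 + R) ^ y := fun t ht =>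
    Real.rpow_le_rpow_of_exponent_le (by linarith) ht
  have hm : proximity F ⊤ R ≤ |C₁| * (1 + R) ^ τ + 4 * A' / R * (|C₂| * (1 + R) ^ x) := by
    refine proximity_le_of_strip hF (by linarith) (by linarith)
      (mul_nonneg (abs_nonneg _) (Real.rpow_nonneg (by linarith) _))
      (mul_nonneg (abs_nonneg _) (Real.rpow_nonneg (by linarith) _)) (fun v hv hvA => ?_)
      fun v hv => ?_
    · refine (hout v ((le_max_left _ _).trans_lt hvA)).trans ?_
      rw [hv]
      exact mul_le_mul_of_nonneg_right (le_abs_self _) (Real.rpow_nonneg (by linarith) _)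
    · refine (hin v).trans ?_
      rw [hv]
      exact mul_le_mul_of_nonneg_right (le_abs_self _) (Real.rpow_nonneg (by linarith) _)
  have h1 : 4 * A' / R * (|C₂| * (1 + R) ^ x) ≤ 8 * A' * |C₂| * (1 + R) ^ y := by
    have e : (1 + R) ^ x = (1 + R) ^ (x - 1) * (1 + R) := by
      rw [← Real.rpow_add_one (by linarith), sub_add_cancel]
    have h2 := hpow (x - 1) (le_max_right _ _)
    have h3 : (1 + R) / R ≤ 2 := by rw [div_le_iff₀ (by linarith)]; linarith
    have h4 : 0 ≤ (1 + R) ^ (x - 1) := Real.rpow_nonneg (by linarith) _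
    calc 4 * A' / R * (|C₂| * (1 + R) ^ x)
        = 4 * A' * |C₂| * ((1 + R) / R) * (1 + R) ^ (x - 1) := by rw [e]; ring
      _ ≤ 4 * A' * |C₂| * 2 * (1 + R) ^ y := by gcongr
      _ = _ := by ring
  have h2 : |C₁| * (1 + R) ^ τ ≤ |C₁| * (1 + R) ^ y :=
    mul_le_mul_of_nonneg_left (hpow τ (le_max_left _ _)) (abs_nonneg _)
  refine (posLog_norm_le_mul_proximity hF (w := z) (R := R) (by linarith)).trans ?_
  have h3 : (R + ‖z‖) / (R - ‖z‖) ≤ 3 := by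
    rw [div_le_iff₀ (by linarith)]; linarith
  have h4 : (1 + R) ^ y ≤ ((2 + 2 * A') * (1 + ‖z‖)) ^ y :=
    Real.rpow_le_rpow (by linarith) (by nlinarith) hy0
  rw [Real.mul_rpow (by linarith) (by linarith)] at h4
  calc (R + ‖z‖) / (R - ‖z‖) * proximity F ⊤ R
      ≤ 3 * ((|C₁| + 8 * A' * |C₂|) * (1 + R) ^ y) := by
        refine mul_le_mul h3 ?_ (proximity_nonneg _) (by norm_num)
        linarith
    _ ≤ 3 * ((|C₁| + 8 * A' * |C₂|) * ((2 + 2 * A') ^ y * (1 + ‖z‖) ^ y)) := by gcongr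
    _ = _ := by ring

/-- For entire functions of finite order, a growth bound of exponent `τ > 1` outside a vertical strip
propagates to the strip: the exponent is lowered by `1` until it reaches `τ`. -/
theorem exists_posLog_norm_le_of_strip {F : ℂ → ℂ} (hF : Differentiable ℂ F)
    (hord : nevanlinnaOrder F < ⊤) {A τ C₁ : ℝ} (hτ : 1 < τ)
    (hout : ∀ z : ℂ, A < |z.re| → Real.posLog ‖F z‖ ≤ C₁ * (1 + ‖z‖) ^ τ) :
    ∃ C, ∀ z, Real.posLog ‖F z‖ ≤ C * (1 + ‖z‖) ^ τ := by
  obtain ⟨N, C₂, hN⟩ := exists_posLog_norm_le_of_nevanlinnaOrder_lt_top hF hord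
  have key : ∀ n : ℕ, ∃ C, ∀ z, Real.posLog ‖F z‖ ≤ C * (1 + ‖z‖) ^ max τ ((N : ℝ) - n) := by
    intro n
    induction n with
    | zero =>
      refine ⟨|C₂|, fun z => (hN z).trans ?_⟩
      rw [Nat.cast_zero, sub_zero]
      have hz := norm_nonneg z
      exact mul_le_mul (le_abs_self _) (Real.rpow_le_rpow_of_exponent_le (by linarith)
        (le_max_right _ _)) (Real.rpow_nonneg (by linarith) _) (abs_nonneg _)
    | succ n ih =>
      obtain ⟨C, hC⟩ := ih
      obtain ⟨C', hC'⟩ := exists_posLog_norm_le_max hF hτ hout hC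
      refine ⟨C', fun z => (hC' z).trans_eq ?_⟩
      congr 2
      push_cast
      rcases le_total τ ((N : ℝ) - n) with h | h
      · rw [max_eq_right h]; congr 1; ring
      · rw [max_eq_left h, max_eq_left (by linarith), max_eq_left (by linarith)]
  obtain ⟨C, hC⟩ := key N
  refine ⟨C, fun z => ?_⟩
  have := hC z
  rwa [sub_self, max_eq_left (by linarith)] at this

theorem IsLFunction.exists_norm_sub_one_le {L : ℂ → ℂ} (hL : IsLFunction L) :
    ∃ K, 0 ≤ K ∧ ∀ s : ℂ, 2 ≤ s.re → ‖L s - 1‖ ≤ K * 2 ^ (-s.re) := by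
  obtain ⟨a, ha1, ha, hLa⟩ := hL.dirichletSeries
  obtain ⟨C, hC⟩ := ha (1 / 2) (by norm_num)
  obtain ⟨K, hK0, hK⟩ := exists_norm_LSeries_sub_one_le ha1 hC
  refine ⟨K, hK0, fun s hs => ?_⟩
  rw [hLa s (by linarith)]
  exact hK s hs

/-- An L-function has order at most `1`, in the form of pointwise bounds: it is bounded for `Re s ≥ 2`,
the functional equation controls a left half-plane, and the finiteness of the order the strip in
between. -/
theorem IsLFunction.exists_differentiable {L : ℂ → ℂ} (hL : IsLFunction L) :
    ∃ (k : ℕ) (F : ℂ → ℂ), Differentiable ℂ F ∧ (∀ s, s ≠ 1 → F s = (s - 1) ^ k * L s) ∧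
      ∀ τ : ℝ, 1 < τ → ∃ C, ∀ s, Real.posLog ‖F s‖ ≤ C * (1 + ‖s‖) ^ τ := by
  obtain ⟨k, F, hF, hord, hFL⟩ := hL.continuation
  refine ⟨k, F, hF, hFL, fun τ hτ => ?_⟩
  obtain ⟨K, Q, lam, mu, ω, hQ, hlam, -, hω, hfe⟩ := hL.functionalEquation
  obtain ⟨K', hK'0, hK'⟩ := hL.exists_norm_sub_one_le
  have hM : ∀ s : ℂ, 2 ≤ s.re → ‖L s‖ ≤ 1 + K' := fun s hs => by
    have h1 : ‖L s‖ ≤ ‖L s - 1‖ + 1 := by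
      simpa using norm_add_le (L s - 1) 1
    have h2 : (2 : ℝ) ^ (-s.re) ≤ 1 :=
      Real.rpow_le_one_of_one_le_of_nonpos (by norm_num) (by linarith)
    nlinarith [hK' s hs]
  obtain ⟨A, C, hC⟩ := exists_posLog_norm_le_of_functionalEquation hQ hlam hω hfe hM hF hFL hτ
  set C' : ℝ := |C| + (k * (1 + ‖(1 : ℂ)‖) + Real.posLog (1 + K')) with hC'
  have hk0 : 0 ≤ k * (1 + ‖(1 : ℂ)‖) + Real.posLog (1 + K') := by
    have := Real.posLog_nonneg (x := 1 + K'); positivity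
  refine exists_posLog_norm_le_of_strip hF hord (A := max A 2) (C₁ := C') hτ fun s hs => ?_
  have hs0 := norm_nonneg s
  have hw : 0 ≤ (1 + ‖s‖) ^ τ := Real.rpow_nonneg (by linarith) _
  rcases lt_or_ge s.re 0 with h | h
  · rw [abs_of_neg h] at hs
    have := hC s (by linarith [le_max_left A 2])
    exact this.trans (mul_le_mul_of_nonneg_right (by linarith [le_abs_self C]) hw)
  · rw [abs_of_nonneg h] at hs
    have h2 : 2 ≤ s.re := ((le_max_right _ _).trans_lt hs).le
    have hs1 : s ≠ 1 := by rintro rfl; norm_num at h2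
    have h3 : (1 + ‖s‖) ≤ (1 + ‖s‖) ^ τ := by
      simpa using Real.rpow_le_rpow_of_exponent_le (show 1 ≤ 1 + ‖s‖ by linarith) hτ.le
    have h4 : Real.posLog ‖L s‖ ≤ Real.posLog (1 + K') :=
      Real.posLog_le_posLog (norm_nonneg _) (hM s h2)
    calc Real.posLog ‖F s‖ ≤ Real.posLog ‖(s - 1) ^ k‖ + Real.posLog ‖L s‖ := by
          rw [hFL s hs1, norm_mul]; exact Real.posLog_mul
      _ ≤ k * (1 + ‖(1 : ℂ)‖) * (1 + ‖s‖) + Real.posLog (1 + K') :=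
          add_le_add (posLog_norm_sub_pow_le 1 k rfl) h4
      _ ≤ (k * (1 + ‖(1 : ℂ)‖) + Real.posLog (1 + K')) * (1 + ‖s‖) := by
          nlinarith [mul_nonneg (Real.posLog_nonneg (x := 1 + K')) hs0]
      _ ≤ (k * (1 + ‖(1 : ℂ)‖) + Real.posLog (1 + K')) * (1 + ‖s‖) ^ τ := by gcongr
      _ ≤ C' * (1 + ‖s‖) ^ τ := mul_le_mul_of_nonneg_right (by linarith [abs_nonneg C]) hw

/-! ### Entire functions with the same zeros, and approximation of 1 in a sector -/

theorem Differentiable.meromorphicOrderAt_ne_top {F : ℂ → ℂ} (hF : Differentiable ℂ F) {c : ℂ}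
    (hc : F c ≠ 0) (s : ℂ) : meromorphicOrderAt F s ≠ ⊤ := by
  rw [Ne, meromorphicOrderAt_eq_top_iff]
  intro h
  have h1 : AnalyticOnNhd ℂ F univ := fun z _ => hF.analyticAt z
  have h2 := h1.eq_of_frequently_eq (g := 0) (fun z _ => analyticAt_const) h.frequently
  exact hc (congrFun h2 c)

theorem exists_eq_exp_of_ne_zero {V : ℂ → ℂ} (hV : Differentiable ℂ V) (h0 : ∀ z, V z ≠ 0) :
    ∃ g : ℂ → ℂ, Differentiable ℂ g ∧ ∀ z, V z = Complex.exp (g z) := by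
  have hd : Differentiable ℂ fun z => deriv V z / V z := hV.deriv.div hV h0
  obtain ⟨g, hg0, hg⟩ := hd.isExactOn_univ.with_val_at 0 (Complex.log (V 0))
  have hg' : ∀ z, HasDerivAt g (deriv V z / V z) z := fun z => hg z (mem_univ z)
  refine ⟨g, fun z => (hg' z).differentiableAt, fun z => ?_⟩
  have hconst : ∀ z, HasDerivAt (fun z => V z * Complex.exp (-g z)) 0 z := fun z => by
    refine ((hV z).hasDerivAt.mul (hg' z).neg.cexp).congr_deriv ?_
    have := h0 z
    field_simp
    ring
  have h1 := is_const_of_deriv_eq_zero (fun z => (hconst z).differentiableAt)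
    (fun z => (hconst z).deriv) z 0
  simp only [hg0, Complex.exp_neg, Complex.exp_log (h0 0), mul_inv_cancel₀ (h0 0)] at h1
  rwa [mul_inv_eq_one₀ (Complex.exp_ne_zero _)] at h1

theorem exists_eq_exp_mul_of_meromorphicOrderAt_eq {E P : ℂ → ℂ} (hE : Differentiable ℂ E)
    (hP : Differentiable ℂ P) {c : ℂ} (hc : P c ≠ 0)
    (h : ∀ s, meromorphicOrderAt E s = meromorphicOrderAt P s) :
    ∃ g : ℂ → ℂ, Differentiable ℂ g ∧ ∀ z, E z = Complex.exp (g z) * P z := by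
  have hq : MeromorphicOn (E / P) univ := (hE.meromorphic'.div hP.meromorphic').meromorphicOn
  have hord : ∀ s, meromorphicOrderAt (toMeromorphicNFOn (E / P) univ) s = 0 := fun s => by
    rw [meromorphicOrderAt_toMeromorphicNFOn hq (mem_univ s),
      meromorphicOrderAt_div (hE.meromorphic' s) (hP.meromorphic' s), h s]
    have := hP.meromorphicOrderAt_ne_top hc s
    lift meromorphicOrderAt P s to ℤ using this with n
    change ((n - n : ℤ) : WithTop ℤ) = 0
    rw [sub_self, WithTop.coe_zero]
  have hNF : ∀ s, MeromorphicNFAt (toMeromorphicNFOn (E / P) univ) s := fun s =>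
    meromorphicNFOn_toMeromorphicNFOn _ _ (mem_univ s)
  have hQd : Differentiable ℂ (toMeromorphicNFOn (E / P) univ) := fun s =>
    ((hNF s).meromorphicOrderAt_nonneg_iff_analyticAt.1 (hord s).ge).differentiableAt
  obtain ⟨g, hg, hQg⟩ := exists_eq_exp_of_ne_zero hQd fun s =>
    (hNF s).meromorphicOrderAt_eq_zero_iff.1 (hord s)
  refine ⟨g, hg, ?_⟩
  have hev : ∀ᶠ z in codiscrete ℂ, E z = Complex.exp (g z) * P z := by
    filter_upwards [toMeromorphicNFOn_eqOn_codiscrete hq, hP.eventually_codiscrete_ne_zero hc]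
      with z h1 h2
    rw [← hQg, ← h1, Pi.div_apply, div_mul_cancel₀ _ h2]
  have := Continuous.ext_on (dense_of_eventually_codiscrete hev) hE.continuous
    (hg.continuous.cexp.mul hP.continuous) fun z hz => hz
  exact congrFun this

/-- Entire functions with the same zeros off the point `b` differ by a power of `s - b` and a
zero-free entire factor. -/
theorem exists_eq_sub_pow_mul_exp_mul {E₁ E₂ : ℂ → ℂ} (hE₁ : Differentiable ℂ E₁)
    (hE₂ : Differentiable ℂ E₂) {c₁ c₂ : ℂ} (hc₁ : E₁ c₁ ≠ 0) (hc₂ : E₂ c₂ ≠ 0) (b : ℂ)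
    (h : ∀ s, s ≠ b → meromorphicOrderAt E₁ s = meromorphicOrderAt E₂ s) :
    ∃ (m : ℕ) (g : ℂ → ℂ), Differentiable ℂ g ∧
      ((∀ z, E₁ z = (z - b) ^ m * Complex.exp (g z) * E₂ z) ∨
        ∀ z, E₂ z = (z - b) ^ m * Complex.exp (g z) * E₁ z) := by
  wlog hle : meromorphicOrderAt E₂ b ≤ meromorphicOrderAt E₁ b generalizing E₁ E₂ c₁ c₂
  · obtain ⟨m, g, hg, hor⟩ := this hE₂ hE₁ hc₂ hc₁ (fun s hs => (h s hs).symm)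
      (not_le.1 hle).le
    exact ⟨m, g, hg, hor.symm⟩
  obtain ⟨m, hm⟩ : ∃ m : ℕ, meromorphicOrderAt E₁ b = m + meromorphicOrderAt E₂ b := by
    have h1 := hE₁.meromorphicOrderAt_ne_top hc₁ b
    have h2 := hE₂.meromorphicOrderAt_ne_top hc₂ b
    lift meromorphicOrderAt E₁ b to ℤ using h1 with n₁
    lift meromorphicOrderAt E₂ b to ℤ using h2 with n₂
    refine ⟨(n₁ - n₂).toNat, ?_⟩
    have h3 : n₂ ≤ n₁ := by exact_mod_cast hle
    have h4 : n₁ = ((n₁ - n₂).toNat : ℤ) + n₂ := by omega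
    exact_mod_cast h4
  have hpow : Differentiable ℂ fun z : ℂ => (z - b) ^ m := (differentiable_id.sub_const b).pow m
  have hP : Differentiable ℂ fun z => (z - b) ^ m * E₂ z := hpow.mul hE₂
  have hPE : ∀ s, meromorphicOrderAt E₁ s
      = meromorphicOrderAt (fun z => (z - b) ^ m * E₂ z) s := fun s => by
    by_cases hs : s = b
    · subst hs
      rw [fun_meromorphicOrderAt_mul (hpow.meromorphic' s) (hE₂.meromorphic' s),
        fun_meromorphicOrderAt_pow_id_sub_const, hm]
    · rw [h s hs]
      exact (meromorphicOrderAt_mul_of_ne_zero (hpow.analyticAt s)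
        (pow_ne_zero _ (sub_ne_zero.2 hs))).symm
  obtain ⟨z₀, hz₀⟩ : ∃ z₀, (z₀ - b) ^ m * E₂ z₀ ≠ 0 := by
    obtain ⟨z, hz1, hz2⟩ := (dense_of_eventually_codiscrete
      ((hE₂.eventually_codiscrete_ne_zero hc₂).and ((differentiable_id.sub_const
        b).eventually_codiscrete_ne_zero (c := b + 1) (by simp)))).nonempty
    exact ⟨z, mul_ne_zero (pow_ne_zero _ hz2) hz1⟩
  obtain ⟨g, hg, hEg⟩ := exists_eq_exp_mul_of_meromorphicOrderAt_eq hE₁ hP hz₀ hPE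
  exact ⟨m, g, hg, Or.inl fun z => by rw [hEg]; ring⟩

/-- If `F` is at most `exp (-c)` on an arc, then the proximity function of `1 / F` is at least `c`
times the proportion of that arc. -/
theorem le_proximity_inv_of_arc {F : ℂ → ℂ} (hF : Differentiable ℂ F) {z₀ : ℂ} (hz₀ : F z₀ ≠ 0)
    {α β c r : ℝ} (hα : 0 ≤ α) (hαβ : α < β) (hβ : β ≤ 2 * π) (hc : 0 ≤ c) (hr : 0 < r)
    (h : ∀ θ ∈ Icc α β, ‖F (circleMap 0 r θ)‖ ≤ Real.exp (-c)) :
    (β - α) / (2 * π) * c ≤ proximity F⁻¹ ⊤ r := by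
  classical
  -- the zeros of `F` do not matter for the integral
  set u : ℂ → ℝ := fun z => if F z = 0 then c else Real.posLog ‖F⁻¹ z‖ with hu
  have hcongr : (fun z => Real.posLog ‖F⁻¹ z‖) =ᶠ[codiscreteWithin (sphere 0 |r|)] u := by
    have h1 := codiscreteWithin_mono (subset_univ (sphere (0 : ℂ) |r|))
      (hF.eventually_codiscrete_ne_zero hz₀)
    filter_upwards [h1] with z hz
    have hz' : F z ≠ 0 := hz
    simp [hu, hz']
  have hint : CircleIntegrable u 0 r :=
    (hF.meromorphic'.inv.circleIntegrable_posLog r).congr_codiscreteWithin hcongr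
  have hint' : IntervalIntegrable (fun θ => u (circleMap 0 r θ)) MeasureTheory.volume 0 (2 * π) :=
    hint
  have hu0 : ∀ z, 0 ≤ u z := fun z => by
    simp only [hu]
    split_ifs
    exacts [hc, Real.posLog_nonneg]
  have hlow : ∀ θ ∈ Icc α β, c ≤ u (circleMap 0 r θ) := fun θ hθ => by
    simp only [hu]
    split_ifs with hz
    · exact le_rfl
    · refine le_trans ?_ (le_max_right 0 _)
      rw [Pi.inv_apply, norm_inv, Real.log_inv]
      have := (Real.log_le_iff_le_exp (norm_pos_iff.2 hz)).2 (h θ hθ)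
      linarith
  have hsub : Icc α β ⊆ uIcc 0 (2 * π) := by
    rw [uIcc_of_le (by positivity)]
    exact Icc_subset_Icc hα hβ
  rw [proximity_top, Real.circleAverage_congr_codiscreteWithin hcongr hr.ne',
    Real.circleAverage_def, smul_eq_mul]
  have h2 : (β - α) * c ≤ ∫ θ in α..β, u (circleMap 0 r θ) := by
    have h3 := intervalIntegral.integral_mono_on (f := fun _ => c) (μ := MeasureTheory.volume)
      hαβ.le intervalIntegrable_const
      (hint'.mono_set (by rwa [uIcc_of_le hαβ.le])) hlow
    simpa using h3
  have h4 : ∫ θ in α..β, u (circleMap 0 r θ) ≤ ∫ θ in (0 : ℝ)..2 * π, u (circleMap 0 r θ) :=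
    intervalIntegral.integral_mono_interval hα hαβ.le hβ
      (Eventually.of_forall fun θ => hu0 _) hint'
  calc (β - α) / (2 * π) * c = (2 * π)⁻¹ * ((β - α) * c) := by ring
    _ ≤ _ := mul_le_mul_of_nonneg_left (h2.trans h4) (by positivity)

/-- An entire function that tends to `1` exponentially fast in a sector has order at least `1`:
by the first main theorem, it grows at least as much as it approximates the value `1`. -/
theorem one_le_nevanlinnaOrder_of_arc {h : ℂ → ℂ} (hh : Differentiable ℂ h) {z₀ : ℂ}
    (hz₀ : h z₀ ≠ 1) {α β c : ℝ} (hα : 0 ≤ α) (hαβ : α < β) (hβ : β ≤ 2 * π) (hc : 0 < c)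
    (harc : ∀ᶠ r in atTop, ∀ θ ∈ Icc α β, ‖h (circleMap 0 r θ) - 1‖ ≤ Real.exp (-(c * r))) :
    1 ≤ nevanlinnaOrder h := by
  have hF : Differentiable ℂ fun z => h z - 1 := hh.sub_const 1
  refine one_le_nevanlinnaOrder hh (c := (β - α) / (2 * π) * c)
    (C := Real.log 2 - Real.log ‖meromorphicTrailingCoeffAt (fun z => h z - 1) 0‖)
    (mul_pos (div_pos (by linarith) (by positivity)) hc) ?_
  filter_upwards [harc, eventually_ge_atTop 1] with r hr hr1
  have h1 := le_proximity_inv_of_arc hF (sub_ne_zero.2 hz₀) hα hαβ hβ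
    (mul_nonneg hc.le (by linarith)) (by linarith) hr
  have h2 := proximity_inv_le_sub_log hF hr1
  have h3 := proximity_sub_le hh.meromorphic' (differentiable_const (1 : ℂ)).meromorphic' r
  have h4 : proximity (fun _ : ℂ => (1 : ℂ)) ⊤ r = 0 := by simp [Real.posLog_one]
  have h5 : (β - α) / (2 * π) * c * r = (β - α) / (2 * π) * (c * r) := by ring
  linarith

/-- The linear form `Re (a z)`, `a ≠ 0`, has constant sign and linear growth in a suitable part of the
open first quadrant. -/
theorem exists_arc_le_abs_re_mul {a : ℂ} (ha : a ≠ 0) :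
    ∃ α β δ : ℝ, 0 < α ∧ α < β ∧ β < π / 2 ∧ 0 < δ ∧
      ((∀ θ ∈ Icc α β, ∀ r, 0 ≤ r → δ * r ≤ (a * circleMap 0 r θ).re) ∨
        ∀ θ ∈ Icc α β, ∀ r, 0 ≤ r → (a * circleMap 0 r θ).re ≤ -(δ * r)) := by
  set q : ℝ → ℝ := fun θ => a.re * Real.cos θ - a.im * Real.sin θ with hq
  have hqre : ∀ r θ, (a * circleMap 0 r θ).re = q θ * r := fun r θ => by
    simp only [circleMap, zero_add, Complex.mul_re, Complex.mul_im, Complex.ofReal_re,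
      Complex.ofReal_im, Complex.exp_ofReal_mul_I_re, Complex.exp_ofReal_mul_I_im, hq]
    ring
  have hqc : Continuous q := by fun_prop
  have hpi := Real.pi_pos
  -- the zeros of `q` are `π` apart, so `q` cannot vanish at both `π / 6` and `π / 3`
  obtain ⟨θ₀, h0, h1, hne⟩ : ∃ θ₀, 0 < θ₀ ∧ θ₀ < π / 2 ∧ q θ₀ ≠ 0 := by
    by_contra! hcon
    have e1 := hcon (π / 6) (by linarith) (by linarith)
    have e2 := hcon (π / 3) (by linarith) (by linarith)
    simp only [hq, Real.cos_pi_div_six, Real.sin_pi_div_six, Real.cos_pi_div_three,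
      Real.sin_pi_div_three] at e1 e2
    have h3 : √3 * √3 = (3 : ℝ) := Real.mul_self_sqrt (by norm_num)
    have e3 : a.re = 0 := by linear_combination √3 * e1 - e2 - a.re / 2 * h3
    have e4 : a.im = 0 := by rw [e3] at e1; linarith
    exact ha (Complex.ext e3 e4)
  have hnear : ∀ᶠ θ in 𝓝 θ₀, 0 < θ ∧ θ < π / 2 ∧
      |q θ - q θ₀| < |q θ₀| / 2 := by
    refine (eventually_gt_nhds h0).and ((eventually_lt_nhds h1).and ?_)
    have := hqc.tendsto θ₀
    exact (Metric.tendsto_nhds.1 this) _ (by positivity)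
  obtain ⟨ε, hε, hball⟩ := Metric.eventually_nhds_iff.1 hnear
  have hin : ∀ θ ∈ Icc θ₀ (θ₀ + ε / 2), 0 < θ ∧ θ < π / 2 ∧ |q θ - q θ₀| < |q θ₀| / 2 :=
    fun θ hθ => hball (by
      rw [Real.dist_eq, abs_of_nonneg (by linarith [hθ.1])]
      linarith [hθ.2])
  refine ⟨θ₀, θ₀ + ε / 2, |q θ₀| / 2, h0, by linarith, (hin _ ⟨by linarith, le_rfl⟩).2.1,
    by positivity, ?_⟩
  rcases hne.lt_or_gt with hneg | hpos
  · right
    intro θ hθ r hr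
    have h3 := (abs_lt.1 (hin θ hθ).2.2).2
    rw [abs_of_neg hneg] at h3 ⊢
    rw [hqre]
    nlinarith
  · left
    intro θ hθ r hr
    have h3 := (abs_lt.1 (hin θ hθ).2.2).1
    rw [abs_of_pos hpos] at h3 ⊢
    rw [hqre]
    nlinarith

/-- A function `(z - 1) ^ m * exp (a * z + b)` different from `1` tends to `0`, to `∞` or to a
constant different from `1` in a suitable part of the open first quadrant. -/
theorem exists_arc_one_add_norm_le {m : ℕ} {a b z₀ : ℂ}
    (hz₀ : (z₀ - 1) ^ m * Complex.exp (a * z₀ + b) ≠ 1) :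
    ∃ α β K : ℝ, 0 < α ∧ α < β ∧ β < π / 2 ∧ 0 ≤ K ∧ ∀ᶠ r in atTop, ∀ θ ∈ Icc α β,
      ∀ z, z = circleMap 0 r θ → 1 + ‖(z - 1) ^ m * Complex.exp (a * z + b)‖
        ≤ K * ‖1 - (z - 1) ^ m * Complex.exp (a * z + b)‖ := by
  have hbig : ∀ w : ℂ, 3 ≤ ‖w‖ → 1 + ‖w‖ ≤ 2 * ‖1 - w‖ := fun w hw => by
    have := norm_sub_norm_le w 1
    rw [norm_one, norm_sub_rev] at this
    linarith
  have hsmall : ∀ w : ℂ, ‖w‖ ≤ 1 / 3 → 1 + ‖w‖ ≤ 2 * ‖1 - w‖ := fun w hw => by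
    have := norm_sub_norm_le 1 w
    rw [norm_one] at this
    linarith
  have hn : ∀ z : ℂ, ‖(z - 1) ^ m * Complex.exp (a * z + b)‖
      = ‖z - 1‖ ^ m * Real.exp ((a * z).re + b.re) := fun z => by
    rw [norm_mul, norm_pow, Complex.norm_exp, Complex.add_re]
  have hlow : ∀ r θ : ℝ, 0 ≤ r → r - 1 ≤ ‖circleMap 0 r θ - 1‖ := fun r θ hr => by
    have := norm_sub_norm_le (circleMap 0 r θ) 1
    rwa [norm_circleMap_zero, abs_of_nonneg hr, norm_one] at this
  have hup : ∀ r θ : ℝ, 0 ≤ r → ‖circleMap 0 r θ - 1‖ ≤ r + 1 := fun r θ hr => by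
    have := norm_sub_le (circleMap 0 r θ) 1
    rwa [norm_circleMap_zero, abs_of_nonneg hr, norm_one] at this
  have hpi := Real.pi_pos
  by_cases ha : a = 0
  · subst ha
    rcases Nat.eq_zero_or_pos m with rfl | hm
    · simp only [pow_zero, one_mul, zero_mul, zero_add] at hz₀ ⊢
      have hne : 0 < ‖1 - Complex.exp b‖ := norm_pos_iff.2 (sub_ne_zero.2 hz₀.symm)
      exact ⟨π / 6, π / 3, (1 + ‖Complex.exp b‖) / ‖1 - Complex.exp b‖, by positivity,
        by linarith, by linarith, by positivity, Eventually.of_forall fun r θ _ z _ => by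
          rw [div_mul_cancel₀ _ hne.ne']⟩
    · refine ⟨π / 6, π / 3, 2, by positivity, by linarith, by linarith, by norm_num, ?_⟩
      filter_upwards [eventually_ge_atTop 2, eventually_ge_atTop (1 + 3 / Real.exp b.re)]
        with r hr hr2 θ _ z hz
      refine hbig _ ?_
      rw [hn, zero_mul, Complex.zero_re, zero_add, hz]
      have h1 := hlow r θ (by linarith)
      have h2 : 3 / Real.exp b.re ≤ ‖circleMap 0 r θ - 1‖ ^ m :=
        (by linarith : 3 / Real.exp b.re ≤ ‖circleMap 0 r θ - 1‖).trans
          (le_self_pow₀ (by linarith) hm.ne')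
      rwa [div_le_iff₀ (Real.exp_pos _)] at h2
  · obtain ⟨α, β, δ, hα, hαβ, hβ, hδ, hor⟩ := exists_arc_le_abs_re_mul ha
    refine ⟨α, β, 2, hα, hαβ, hβ, by norm_num, ?_⟩
    rcases hor with hor | hor
    · have ht : Tendsto (fun r : ℝ => Real.exp (δ * r + b.re)) atTop atTop :=
        Real.tendsto_exp_atTop.comp
          (tendsto_atTop_add_const_right _ _ (tendsto_id.const_mul_atTop hδ))
      filter_upwards [eventually_ge_atTop 2, ht.eventually_ge_atTop 3] with r hr hr3 θ hθ z hz
      refine hbig _ ?_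
      rw [hn, hz]
      have h1 : 1 ≤ ‖circleMap 0 r θ - 1‖ ^ m :=
        one_le_pow₀ (by linarith [hlow r θ (by linarith)])
      have h2 := hor θ hθ r (by linarith)
      have h3 : Real.exp (δ * r + b.re) ≤ Real.exp ((a * circleMap 0 r θ).re + b.re) :=
        Real.exp_le_exp.2 (by linarith)
      have h4 := le_mul_of_one_le_left (Real.exp_pos ((a * circleMap 0 r θ).re + b.re)).le h1
      linarith
    · have ht : Tendsto (fun r : ℝ => (r + 1) ^ m * Real.exp (-(δ * r) + b.re)) atTop (𝓝 0) := by
        have h1 : Tendsto (fun r : ℝ => r ^ (m : ℝ) * Real.exp (-δ * r)) atTop (𝓝 0) :=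
          tendsto_rpow_mul_exp_neg_mul_atTop_nhds_zero m δ hδ
        have h2 := (h1.comp (tendsto_atTop_add_const_right _ (1 : ℝ) tendsto_id)).mul_const
          (Real.exp (δ + b.re))
        rw [zero_mul] at h2
        refine h2.congr fun r => ?_
        simp only [Function.comp_apply, id_eq, Real.rpow_natCast]
        rw [mul_assoc, ← Real.exp_add]
        congr 2
        ring
      filter_upwards [eventually_ge_atTop 2, ht.eventually_le_const (by norm_num : (0 : ℝ) < 1 / 3)]
        with r hr hr3 θ hθ z hz
      refine hsmall _ (le_trans ?_ hr3)
      rw [hn, hz]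
      have h1 := hup r θ (by linarith)
      have h2 := hor θ hθ r (by linarith)
      gcongr

/-! ### Uniqueness of L-functions -/

theorem proximity_mul_mul_inv {F G : ℂ → ℂ} (hF : Differentiable ℂ F) {z₀ : ℂ}
    (hz₀ : F z₀ ≠ 0) {r : ℝ} (hr : 0 < r) :
    proximity (fun z => F z * G z * (F z)⁻¹) ⊤ r = proximity G ⊤ r := by
  rw [proximity_top, proximity_top]
  refine Real.circleAverage_congr_codiscreteWithin ?_ hr.ne'
  filter_upwards [codiscreteWithin_mono (subset_univ (sphere (0 : ℂ) |r|))
    (hF.eventually_codiscrete_ne_zero hz₀)] with z hz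
  have hz' : F z ≠ 0 := hz
  rw [mul_right_comm, mul_inv_cancel₀ hz', one_mul]

/-- The first main theorem for a quotient: `G = (F G) / F`. -/
theorem proximity_le_add_proximity_mul {F G : ℂ → ℂ} (hF : Differentiable ℂ F)
    (hG : Differentiable ℂ G) {z₀ : ℂ} (hz₀ : F z₀ ≠ 0) {r : ℝ} (hr : 1 ≤ r) :
    proximity G ⊤ r ≤ proximity (fun z => F z * G z) ⊤ r + proximity F ⊤ r
      - Real.log ‖meromorphicTrailingCoeffAt F 0‖ := by
  have h1 := proximity_mul_mul_inv (G := G) hF hz₀ (r := r) (by linarith)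
  have h2 := proximity_mul_le (hF.mul hG).meromorphic' hF.meromorphic'.inv r
  have h3 := proximity_inv_le_sub_log hF hr
  have h4 : proximity (fun z => F z * G z * (F z)⁻¹) ⊤ r
      ≤ proximity (fun z => F z * G z) ⊤ r + proximity F⁻¹ ⊤ r := h2
  linarith

/-- An order bound from growth of every exponent `τ > 1`. The bound is asked for `r ≥ 2` only, where
`|s - 1| ≥ 1` on the circle `|s| = r`. -/
theorem nevanlinnaOrder_le_one {F : ℂ → ℂ} (hF : Differentiable ℂ F)
    (h : ∀ τ : ℝ, 1 < τ → ∃ C, ∀ r, 2 ≤ r → proximity F ⊤ r ≤ C * (1 + r) ^ τ) :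
    nevanlinnaOrder F ≤ 1 := by
  have key : ∀ τ : ℝ, 1 < τ → nevanlinnaOrder F ≤ (τ : EReal) := fun τ hτ => by
    obtain ⟨C, hC⟩ := h τ hτ
    refine nevanlinnaOrder_le hF (C := |C| * 2 ^ τ) (by linarith) fun r hr => ?_
    have h1 := proximity_top_mono hF (r := r) (R := r + 1) (by linarith) (by linarith)
    refine h1.trans ((hC (r + 1) (by linarith)).trans ?_)
    rw [mul_assoc, ← Real.mul_rpow (by norm_num) (by linarith)]
    refine mul_le_mul (le_abs_self C) (Real.rpow_le_rpow (by linarith) (by linarith) (by linarith))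
      (Real.rpow_nonneg (by linarith) _) (abs_nonneg _)
  by_contra hcon
  obtain ⟨τ, h1, h2⟩ := EReal.lt_iff_exists_real_btwn.1 (not_le.1 hcon)
  exact absurd (key τ (by exact_mod_cast h1)) (not_le.2 h2)

theorem le_mul_one_add_rpow {c r τ : ℝ} (hc : 0 ≤ c) (hr : 0 ≤ r) (hτ : 1 ≤ τ) :
    c * (1 + r) ≤ c * (1 + r) ^ τ := by
  have := Real.rpow_le_rpow_of_exponent_le (show 1 ≤ 1 + r by linarith) hτ
  rw [Real.rpow_one] at this
  exact mul_le_mul_of_nonneg_left this hc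

theorem proximity_le_of_posLog_norm_le {F : ℂ → ℂ} (hF : Differentiable ℂ F) {C τ : ℝ}
    (h : ∀ z, Real.posLog ‖F z‖ ≤ C * (1 + ‖z‖) ^ τ) {r : ℝ} (hr : 0 ≤ r) :
    proximity F ⊤ r ≤ C * (1 + r) ^ τ :=
  proximity_top_le_of_forall hF.meromorphic' hr fun z hz => by rw [← hz]; exact h z

theorem posLog_norm_sub_pow_mul_exp_le {m : ℕ} {a b z : ℂ} :
    Real.posLog ‖(z - 1) ^ m * Complex.exp (a * z + b)‖
      ≤ (2 * m + ‖a‖ + ‖b‖) * (1 + ‖z‖) := by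
  have h1 := posLog_norm_sub_pow_le (1 : ℂ) m (z := z) rfl
  have h2 : Real.posLog ‖Complex.exp (a * z + b)‖ ≤ ‖a‖ * ‖z‖ + ‖b‖ := by
    refine max_le (by positivity) ?_
    rw [Complex.norm_exp, Real.log_exp, ← norm_mul]
    exact (Complex.re_le_norm _).trans (norm_add_le _ _)
  rw [norm_mul]
  refine Real.posLog_mul.trans ?_
  rw [norm_one] at h1
  nlinarith [norm_nonneg a, norm_nonneg b, norm_nonneg z, mul_nonneg (norm_nonneg b) (norm_nonneg z)]

section

variable {h F₁ F₂ : ℂ → ℂ} {k m : ℕ}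

/-- If `F₁ - p h = f (F₂ - p h)` with `p` a polynomial and `F₁`, `F₂`, `f` of order at most `1`,
then the identity `(f - 1) (F₂ - p h) = F₁ - F₂` bounds the order of `h`. -/
theorem nevanlinnaOrder_le_one_of_eq_mul (hh : Differentiable ℂ h) (hF₁ : Differentiable ℂ F₁)
    (hF₂ : Differentiable ℂ F₂)
    (hb₁ : ∀ τ : ℝ, 1 < τ → ∃ C, ∀ s, Real.posLog ‖F₁ s‖ ≤ C * (1 + ‖s‖) ^ τ)
    (hb₂ : ∀ τ : ℝ, 1 < τ → ∃ C, ∀ s, Real.posLog ‖F₂ s‖ ≤ C * (1 + ‖s‖) ^ τ) {a b z₀ : ℂ}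
    (hz₀ : (z₀ - 1) ^ m * Complex.exp (a * z₀ + b) ≠ 1)
    (hE : ∀ s, F₁ s - (s - 1) ^ k * h s
      = (s - 1) ^ m * Complex.exp (a * s + b) * (F₂ s - (s - 1) ^ k * h s)) :
    nevanlinnaOrder h ≤ 1 := by
  set f : ℂ → ℂ := fun s => (s - 1) ^ m * Complex.exp (a * s + b) with hf
  have hpk : Differentiable ℂ fun s : ℂ => (s - 1) ^ k := (differentiable_id.sub_const 1).pow k
  have hfd : Differentiable ℂ f := ((differentiable_id.sub_const 1).pow m).mul
    ((differentiable_id.const_mul a).add_const b).cexp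
  set E : ℂ → ℂ := fun s => F₂ s - (s - 1) ^ k * h s with hEdef
  have hEd : Differentiable ℂ E := hF₂.sub (hpk.mul hh)
  have hf1 : Differentiable ℂ fun s => f s - 1 := hfd.sub_const 1
  have h1m : Meromorphic fun _ : ℂ => (1 : ℂ) := (differentiable_const (1 : ℂ)).meromorphic'
  have hone : ∀ r, proximity (fun _ : ℂ => (1 : ℂ)) ⊤ r = 0 := fun r => by simp [Real.posLog_one]
  refine nevanlinnaOrder_le_one hh fun τ hτ => ?_
  obtain ⟨C₁, hC₁⟩ := hb₁ τ hτ
  obtain ⟨C₂, hC₂⟩ := hb₂ τ hτ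
  set c := |Real.log ‖meromorphicTrailingCoeffAt (fun s => f s - 1) 0‖| with hc
  refine ⟨C₁ + 2 * C₂ + (2 * m + ‖a‖ + ‖b‖) + (3 * Real.log 2 + c), fun r hr => ?_⟩
  have hr0 : 0 ≤ r := by linarith
  have p1 := proximity_le_of_posLog_norm_le hF₁ hC₁ hr0
  have p2 := proximity_le_of_posLog_norm_le hF₂ hC₂ hr0
  have pf : proximity f ⊤ r ≤ (2 * m + ‖a‖ + ‖b‖) * (1 + r) :=
    proximity_top_le_of_forall hfd.meromorphic' hr0 fun z hz => by
      rw [← hz]; exact posLog_norm_sub_pow_mul_exp_le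
  have pf1 : proximity (fun s => f s - 1) ⊤ r ≤ proximity f ⊤ r + Real.log 2 := by
    have := proximity_sub_le hfd.meromorphic' h1m r
    rwa [hone, add_zero] at this
  have pD : proximity (fun s => (f s - 1) * E s) ⊤ r
      ≤ proximity F₁ ⊤ r + proximity F₂ ⊤ r + Real.log 2 := by
    have e : (fun s => (f s - 1) * E s) = fun s => F₁ s - F₂ s := by
      ext s
      have := hE s
      simp only [hf, hEdef]
      linear_combination -this
    rw [e]
    exact proximity_sub_le hF₁.meromorphic' hF₂.meromorphic' r
  have pE := proximity_le_add_proximity_mul hf1 hEd (z₀ := z₀) (sub_ne_zero.2 hz₀)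
    (show 1 ≤ r by linarith)
  have pq : proximity (fun s : ℂ => ((s - 1) ^ k)⁻¹) ⊤ r ≤ 0 := by
    refine proximity_top_le_of_forall hpk.meromorphic'.inv hr0 fun z hz => ?_
    have h1 : 1 ≤ ‖z - 1‖ := by
      have := norm_sub_norm_le z 1
      rw [hz, norm_one] at this
      linarith
    refine (Real.posLog_eq_zero_iff _).2 ?_ |>.le
    rw [abs_of_nonneg (norm_nonneg _), Pi.inv_apply, norm_inv, norm_pow]
    exact inv_le_one_of_one_le₀ (one_le_pow₀ h1)
  have ph : proximity h ⊤ r ≤ proximity F₂ ⊤ r + proximity E ⊤ r + Real.log 2 := by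
    have e : proximity h ⊤ r
        = proximity (fun s => ((s - 1) ^ k)⁻¹ * (F₂ s - E s)) ⊤ r := by
      refine proximity_top_congr hr0 fun z hz => ?_
      have hz1 : z - 1 ≠ 0 := by
        rintro h1
        rw [sub_eq_zero.1 h1, norm_one] at hz
        linarith
      simp only [hEdef, sub_sub_cancel]
      rw [inv_mul_cancel_left₀ (pow_ne_zero _ hz1)]
    rw [e]
    have q1 := proximity_mul_le hpk.meromorphic'.inv (hF₂.sub hEd).meromorphic' r
    have q2 := proximity_sub_le hF₂.meromorphic' hEd.meromorphic' r
    have q3 : proximity (fun s => ((s - 1) ^ k)⁻¹ * (F₂ s - E s)) ⊤ r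
      ≤ proximity (fun s : ℂ => ((s - 1) ^ k)⁻¹) ⊤ r
        + proximity (fun s => F₂ s - E s) ⊤ r := q1
    linarith
  have hl2 : 0 ≤ Real.log 2 := Real.log_nonneg (by norm_num)
  have hlog := neg_abs_le (Real.log ‖meromorphicTrailingCoeffAt (fun s => f s - 1) 0‖)
  have g1 := le_mul_one_add_rpow (c := 2 * m + ‖a‖ + ‖b‖) (by positivity) hr0 hτ.le
  have g2 := le_mul_one_add_rpow (c := 3 * Real.log 2 + c) (by positivity) hr0 hτ.le
  have g3 : 3 * Real.log 2 + c ≤ (3 * Real.log 2 + c) * (1 + r) :=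
    le_mul_of_one_le_right (by positivity) (by linarith)
  have e : (C₁ + 2 * C₂ + (2 * m + ‖a‖ + ‖b‖) + (3 * Real.log 2 + c)) * (1 + r) ^ τ
      = C₁ * (1 + r) ^ τ + 2 * (C₂ * (1 + r) ^ τ) + (2 * m + ‖a‖ + ‖b‖) * (1 + r) ^ τ
        + (3 * Real.log 2 + c) * (1 + r) ^ τ := by ring
  rw [e]
  linarith

/-- In a sector where `f = (s - 1) ^ m * exp (a s + b)` stays away from `1`, the identity
`(h - 1) (1 - f) = (L₁ - 1) - f (L₂ - 1)` makes `h - 1` as small as the `L i - 1`. -/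
theorem one_le_nevanlinnaOrder_of_eq_mul (hh : Differentiable ℂ h) {L₁ L₂ : ℂ → ℂ}
    {K₁ K₂ : ℝ} (hK₁ : ∀ s : ℂ, 2 ≤ s.re → ‖L₁ s - 1‖ ≤ K₁ * 2 ^ (-s.re))
    (hK₂ : ∀ s : ℂ, 2 ≤ s.re → ‖L₂ s - 1‖ ≤ K₂ * 2 ^ (-s.re)) (hK₁0 : 0 ≤ K₁) (hK₂0 : 0 ≤ K₂)
    {w₀ : ℂ} (hw₀ : h w₀ ≠ 1) {a b z₀ : ℂ}
    (hz₀ : (z₀ - 1) ^ m * Complex.exp (a * z₀ + b) ≠ 1)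
    (hE : ∀ s : ℂ, 2 ≤ s.re → L₁ s - h s
      = (s - 1) ^ m * Complex.exp (a * s + b) * (L₂ s - h s)) :
    1 ≤ nevanlinnaOrder h := by
  obtain ⟨α, β, K, hα, hαβ, hβ, hK, harc⟩ := exists_arc_one_add_norm_le hz₀
  have hpi := Real.pi_pos
  have hcos : 0 < Real.cos β := Real.cos_pos_of_mem_Ioo ⟨by linarith, hβ⟩
  have hl2 : 0 < Real.log 2 := Real.log_pos (by norm_num)
  set c := Real.cos β * Real.log 2 with hc
  have hc0 : 0 < c := mul_pos hcos hl2
  refine one_le_nevanlinnaOrder_of_arc hh hw₀ hα.le hαβ (by linarith) (half_pos hc0) ?_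
  have ht : Tendsto (fun r : ℝ => Real.exp (c / 2 * r)) atTop atTop :=
    Real.tendsto_exp_atTop.comp (tendsto_id.const_mul_atTop (half_pos hc0))
  filter_upwards [harc, ht.eventually_ge_atTop (K * (K₁ + K₂)),
    eventually_ge_atTop (2 / Real.cos β), eventually_ge_atTop 0] with r hr hrK hr2 hr0 θ hθ
  set z := circleMap 0 r θ with hz
  have hzre : z.re = r * Real.cos θ := by
    simp only [hz, circleMap, zero_add, Complex.re_ofReal_mul, Complex.exp_ofReal_mul_I_re]
  have hcosθ : Real.cos β ≤ Real.cos θ :=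
    Real.cos_le_cos_of_nonneg_of_le_pi (by linarith [hθ.1]) (by linarith) hθ.2
  have hre : r * Real.cos β ≤ z.re := by rw [hzre]; gcongr
  have h2 : 2 ≤ z.re := by
    rw [div_le_iff₀ hcos] at hr2
    linarith
  set f := (z - 1) ^ m * Complex.exp (a * z + b) with hf
  have h1 := hr θ hθ z rfl
  rw [← hf] at h1
  have hpos : 0 < ‖1 - f‖ := by
    rcases (norm_nonneg (1 - f)).eq_or_lt with h0 | h0
    · rw [← h0, mul_zero] at h1
      linarith [norm_nonneg f]
    · exact h0
  have hid : (h z - 1) * (1 - f) = (L₁ z - 1) - f * (L₂ z - 1) := by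
    linear_combination -(hE z h2)
  have hle : ‖h z - 1‖ * ‖1 - f‖ ≤ (K₁ + K₂) * 2 ^ (-z.re) * (K * ‖1 - f‖) := by
    rw [← norm_mul, hid]
    have w0 : (0 : ℝ) < 2 ^ (-z.re) := by positivity
    calc ‖L₁ z - 1 - f * (L₂ z - 1)‖ ≤ ‖L₁ z - 1‖ + ‖f‖ * ‖L₂ z - 1‖ := by
          rw [← norm_mul]; exact norm_sub_le _ _
      _ ≤ K₁ * 2 ^ (-z.re) + ‖f‖ * (K₂ * 2 ^ (-z.re)) := by
          gcongr
          exacts [hK₁ z h2, hK₂ z h2]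
      _ ≤ (K₁ + K₂) * 2 ^ (-z.re) * (1 + ‖f‖) := by
          nlinarith [mul_nonneg (mul_nonneg hK₁0 w0.le) (norm_nonneg f), mul_nonneg hK₂0 w0.le]
      _ ≤ _ := by gcongr
  have hle2 : ‖h z - 1‖ ≤ K * (K₁ + K₂) * 2 ^ (-z.re) := by
    refine le_of_mul_le_mul_right (hle.trans_eq ?_) hpos
    ring
  have hdec : (2 : ℝ) ^ (-z.re) ≤ Real.exp (-(c * r)) := by
    rw [Real.rpow_def_of_pos (by norm_num)]
    refine Real.exp_le_exp.2 ?_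
    have := mul_le_mul_of_nonneg_left hre hl2.le
    rw [hc]
    linarith
  calc ‖h z - 1‖ ≤ Real.exp (c / 2 * r) * Real.exp (-(c * r)) :=
        hle2.trans (mul_le_mul hrK hdec (by positivity) (Real.exp_pos _).le)
    _ = _ := by rw [← Real.exp_add]; congr 1; ring

/-- If `L₁ - h = f (L₂ - h)` with `f = (s - 1) ^ m exp g` and distinct L-functions `L₁`, `L₂`, then `g`
is affine and `h` has order `1`. -/
theorem nevanlinnaOrder_eq_one_of_eq_mul (hh : Differentiable ℂ h)
    (hnc : ¬ ∃ c : ℂ, ∀ s : ℂ, h s = c) {L₁ L₂ : ℂ → ℂ}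
    (hL₁ : IsLFunction L₁) (hL₂ : IsLFunction L₂)
    (hF₁ : Differentiable ℂ F₁) (hF₂ : Differentiable ℂ F₂)
    (hFL₁ : ∀ s, s ≠ 1 → F₁ s = (s - 1) ^ k * L₁ s)
    (hFL₂ : ∀ s, s ≠ 1 → F₂ s = (s - 1) ^ k * L₂ s)
    (hb₁ : ∀ τ : ℝ, 1 < τ → ∃ C, ∀ s, Real.posLog ‖F₁ s‖ ≤ C * (1 + ‖s‖) ^ τ)
    (hb₂ : ∀ τ : ℝ, 1 < τ → ∃ C, ∀ s, Real.posLog ‖F₂ s‖ ≤ C * (1 + ‖s‖) ^ τ)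
    {z₀ : ℂ} (hz₀ : F₁ z₀ ≠ F₂ z₀) {g : ℂ → ℂ} (hg : Differentiable ℂ g)
    (hE : ∀ s, F₁ s - (s - 1) ^ k * h s
      = (s - 1) ^ m * Complex.exp (g s) * (F₂ s - (s - 1) ^ k * h s)) :
    nevanlinnaOrder h = 1 := by
  have hD : ∀ s, ((s - 1) ^ m * Complex.exp (g s) - 1) * (F₂ s - (s - 1) ^ k * h s)
      = F₁ s - F₂ s := fun s => by linear_combination -(hE s)
  have hpk : Differentiable ℂ fun s : ℂ => (s - 1) ^ k := (differentiable_id.sub_const 1).pow k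
  obtain ⟨C₁, hC₁⟩ := hb₁ (3 / 2) (by norm_num)
  obtain ⟨C₂, hC₂⟩ := hb₂ (3 / 2) (by norm_num)
  obtain ⟨a, b, hab⟩ := exists_eq_affine_of_sub_pow_mul_exp hg (hF₂.sub (hpk.mul hh)) 1 m
    (B := C₁ + C₂ + Real.log 2) (fun z => by
      have h1 : 1 ≤ (1 + ‖z‖) ^ (3 / 2 : ℝ) :=
        Real.one_le_rpow (by linarith [norm_nonneg z]) (by norm_num)
      have h2 := le_mul_of_one_le_right (Real.log_nonneg (by norm_num : (1 : ℝ) ≤ 2)) h1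
      have h3 : Real.posLog ‖F₁ z - F₂ z‖ ≤ Real.log 2 + Real.posLog ‖F₁ z‖
          + Real.posLog ‖F₂ z‖ := by
        have := Real.posLog_norm_add_le (F₁ z) (-F₂ z)
        rw [norm_neg, ← sub_eq_add_neg] at this
        linarith
      have e := hD z
      simp only [Pi.sub_apply, Pi.mul_apply] at e ⊢
      rw [e, add_mul, add_mul]
      linarith [hC₁ z, hC₂ z]) ⟨z₀, by
      have e := hD z₀
      simp only [Pi.sub_apply, Pi.mul_apply] at e ⊢
      rw [e]
      exact sub_ne_zero.2 hz₀⟩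
  have hE' : ∀ s, F₁ s - (s - 1) ^ k * h s
      = (s - 1) ^ m * Complex.exp (a * s + b) * (F₂ s - (s - 1) ^ k * h s) := fun s => by
    rw [← hab]; exact hE s
  have hz₀' : (z₀ - 1) ^ m * Complex.exp (a * z₀ + b) ≠ 1 := fun h1 => by
    have := hE' z₀
    rw [h1, one_mul] at this
    exact hz₀ (sub_left_injective this)
  obtain ⟨K₁, hK₁0, hK₁⟩ := hL₁.exists_norm_sub_one_le
  obtain ⟨K₂, hK₂0, hK₂⟩ := hL₂.exists_norm_sub_one_le
  obtain ⟨w₀, hw₀⟩ : ∃ w₀, h w₀ ≠ 1 := by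
    by_contra! hcon
    exact hnc ⟨1, hcon⟩
  refine le_antisymm
    (nevanlinnaOrder_le_one_of_eq_mul hh hF₁ hF₂ hb₁ hb₂ hz₀' hE')
    (one_le_nevanlinnaOrder_of_eq_mul hh hK₁ hK₂ hK₁0 hK₂0 hw₀ hz₀' fun s hs => ?_)
  have hs1 : s ≠ 1 := by rintro rfl; norm_num at hs
  have h1 := hE' s
  rw [hFL₁ s hs1, hFL₂ s hs1] at h1
  refine mul_left_cancel₀ (pow_ne_zero k (sub_ne_zero.2 hs1)) ?_
  linear_combination h1

end

/-- The exponent that clears the pole at `1` may be chosen arbitrarily large, in particular the same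
for two L-functions. -/
theorem IsLFunction.exists_differentiable_of_le {L : ℂ → ℂ} (hL : IsLFunction L) :
    ∃ k₀ : ℕ, ∀ k, k₀ ≤ k → ∃ F : ℂ → ℂ, Differentiable ℂ F ∧
      (∀ s, s ≠ 1 → F s = (s - 1) ^ k * L s) ∧
      ∀ τ : ℝ, 1 < τ → ∃ C, ∀ s, Real.posLog ‖F s‖ ≤ C * (1 + ‖s‖) ^ τ := by
  obtain ⟨k₀, F, hF, hFL, hb⟩ := hL.exists_differentiable
  refine ⟨k₀, fun k hk => ⟨fun s => (s - 1) ^ (k - k₀) * F s,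
    ((differentiable_id.sub_const 1).pow _).mul hF, fun s hs => ?_, fun τ hτ => ?_⟩⟩
  · simp only [hFL s hs]
    rw [← mul_assoc, ← pow_add, Nat.sub_add_cancel hk]
  · obtain ⟨C, hC⟩ := hb τ hτ
    refine ⟨(k - k₀ : ℕ) * (1 + ‖(1 : ℂ)‖) + C, fun s => ?_⟩
    rw [norm_mul, add_mul]
    exact Real.posLog_mul.trans (add_le_add ((posLog_norm_sub_pow_le 1 _ rfl).trans
      (le_mul_one_add_rpow (by positivity) (norm_nonneg s) hτ.le)) (hC s))

theorem IsLFunction.eq_of_sameZerosCM {h L₁ L₂ : ℂ → ℂ} (hh : Differentiable ℂ h)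
    (hnc : ¬ ∃ c : ℂ, ∀ s : ℂ, h s = c) (hord : nevanlinnaOrder h ≠ 1)
    (hL₁ : IsLFunction L₁) (hL₂ : IsLFunction L₂)
    (hz : SameZerosCM (fun s => L₁ s - h s) (fun s => L₂ s - h s)) : L₁ = L₂ := by
  obtain ⟨k₁, hk₁⟩ := hL₁.exists_differentiable_of_le
  obtain ⟨k₂, hk₂⟩ := hL₂.exists_differentiable_of_le
  obtain ⟨F₁, hF₁, hFL₁, hb₁⟩ := hk₁ (max k₁ k₂) (le_max_left _ _)
  obtain ⟨F₂, hF₂, hFL₂, hb₂⟩ := hk₂ (max k₁ k₂) (le_max_right _ _)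
  set k := max k₁ k₂
  by_cases hFF : F₁ = F₂
  · have hoff : ∀ s, s ≠ 1 → L₁ s = L₂ s := fun s hs => by
      have := hFL₁ s hs
      rw [hFF, hFL₂ s hs] at this
      exact (mul_left_cancel₀ (pow_ne_zero k (sub_ne_zero.2 hs)) this).symm
    ext s
    by_cases hs : s = 1
    · subst hs
      refine (((hL₁.meromorphicNF (mem_univ 1)).eventuallyEq_nhdsNE_iff_eventuallyEq_nhds
        (hL₂.meromorphicNF (mem_univ 1))).1 ?_).eq_of_nhds
      filter_upwards [self_mem_nhdsWithin] with s hs using hoff s hs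
    · exact hoff s hs
  exfalso
  obtain ⟨z₀, hz₀⟩ := Function.ne_iff.1 hFF
  have hpk : Differentiable ℂ fun s : ℂ => (s - 1) ^ k := (differentiable_id.sub_const 1).pow k
  have hord_eq : ∀ {L F : ℂ → ℂ}, IsLFunction L → Differentiable ℂ F →
      (∀ s, s ≠ 1 → F s = (s - 1) ^ k * L s) → ∀ s, s ≠ 1 →
      meromorphicOrderAt (fun s => F s - (s - 1) ^ k * h s) s
        = zeroMultiplicity (fun s => L s - h s) s := by
    intro L F hL hF hFL s hs
    have hE : Differentiable ℂ fun s => F s - (s - 1) ^ k * h s := hF.sub (hpk.mul hh)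
    have h1 : meromorphicOrderAt (fun s => F s - (s - 1) ^ k * h s) s
        = meromorphicOrderAt (fun s => L s - h s) s := by
      rw [← meromorphicOrderAt_mul_of_ne_zero (f := fun s => L s - h s) (hpk.analyticAt s)
        (pow_ne_zero k (sub_ne_zero.2 hs))]
      refine meromorphicOrderAt_congr ?_
      have : ∀ᶠ t in 𝓝[≠] s, t ≠ 1 := (isOpen_ne.mem_nhds hs : _) |> mem_nhdsWithin_of_mem_nhds
      filter_upwards [this] with t ht
      simp only [Pi.mul_apply, hFL t ht]
      ring
    rw [zeroMultiplicity, ← h1, max_eq_left (hE.analyticAt s).meromorphicOrderAt_nonneg]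
  have horders : ∀ s, s ≠ 1 → meromorphicOrderAt (fun s => F₁ s - (s - 1) ^ k * h s) s
      = meromorphicOrderAt (fun s => F₂ s - (s - 1) ^ k * h s) s := fun s hs => by
    rw [hord_eq hL₁ hF₁ hFL₁ s hs, hord_eq hL₂ hF₂ hFL₂ s hs, hz s]
  have hE₁ : Differentiable ℂ fun s => F₁ s - (s - 1) ^ k * h s := hF₁.sub (hpk.mul hh)
  have hE₂ : Differentiable ℂ fun s => F₂ s - (s - 1) ^ k * h s := hF₂.sub (hpk.mul hh)
  -- if one of the two functions vanishes identically, then so does the other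
  have htop : ∀ {E E' : ℂ → ℂ}, Differentiable ℂ E' →
      (∀ s, s ≠ 1 → meromorphicOrderAt E s = meromorphicOrderAt E' s) → (∀ s, E s = 0) →
      ∀ s, E' s = 0 := by
    intro E E' hE' hEE hE0 s
    by_contra hs
    refine hE'.meromorphicOrderAt_ne_top hs 2 ?_
    rw [← hEE 2 (by norm_num), meromorphicOrderAt_eq_top_iff]
    exact Eventually.of_forall hE0
  have hnz₁ : ∃ c, F₁ c - (c - 1) ^ k * h c ≠ 0 := by
    by_contra! h0
    have h1 := htop hE₂ horders h0 z₀
    exact hz₀ (sub_left_injective ((h0 z₀).trans h1.symm))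
  have hnz₂ : ∃ c, F₂ c - (c - 1) ^ k * h c ≠ 0 := by
    by_contra! h0
    have h1 := htop hE₁ (fun s hs => (horders s hs).symm) h0 z₀
    exact hz₀ (sub_left_injective (h1.trans (h0 z₀).symm))
  obtain ⟨c₁, hc₁⟩ := hnz₁
  obtain ⟨c₂, hc₂⟩ := hnz₂
  obtain ⟨m, g, hg, hE | hE⟩ := exists_eq_sub_pow_mul_exp_mul hE₁ hE₂ hc₁ hc₂ 1 horders
  · exact hord (nevanlinnaOrder_eq_one_of_eq_mul hh hnc hL₁ hL₂ hF₁ hF₂ hFL₁ hFL₂ hb₁ hb₂ hz₀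
      hg hE)
  · exact hord (nevanlinnaOrder_eq_one_of_eq_mul hh hnc hL₂ hL₁ hF₂ hF₁ hFL₂ hFL₁ hb₂ hb₁
      hz₀.symm hg hE)

/-! ### Two Dirichlet polynomials and a function of order 1 -/

theorem posLog_norm_div_natCast_cpow_le {N : ℕ} (hN : 1 ≤ N) (c s : ℂ) :
    Real.posLog ‖c / (N : ℂ) ^ s‖ ≤ Real.posLog ‖c‖ + Real.log N * ‖s‖ := by
  have hN1 : (1 : ℝ) ≤ N := by exact_mod_cast hN
  have hN0 : 0 < N := hN
  rw [div_eq_mul_inv, ← Complex.cpow_neg, norm_mul, Complex.norm_natCast_cpow_of_pos hN0]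
  refine Real.posLog_mul.trans (add_le_add le_rfl ?_)
  refine max_le (mul_nonneg (Real.log_nonneg hN1) (norm_nonneg s)) ?_
  rw [Real.log_rpow (by linarith), mul_comm, Complex.neg_re]
  refine mul_le_mul_of_nonneg_left ?_ (Real.log_nonneg hN1)
  exact (neg_le_abs _).trans (Complex.abs_re_le_norm s)

theorem differentiable_div_natCast_cpow {N : ℕ} (hN : N ≠ 0) (c : ℂ) :
    Differentiable ℂ fun s : ℂ => c / (N : ℂ) ^ s := by
  have hN' : (N : ℂ) ≠ 0 := by exact_mod_cast hN
  exact (differentiable_const c).div (differentiable_id.const_cpow (Or.inl hN'))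
    fun s => by simp [Complex.cpow_eq_zero_iff, hN']

/-- The Dirichlet polynomial `1 + q / (q ^ 2) ^ s` is in the extended Selberg class; its functional
equation has no gamma factors. -/
theorem isLFunction_one_add_div {q : ℕ} (hq : 2 ≤ q) {L : ℂ → ℂ}
    (hL : ∀ s, L s = 1 + (q : ℂ) / ((q ^ 2 : ℕ) : ℂ) ^ s) : IsLFunction L := by
  have hq0 : q ^ 2 ≠ 0 := by positivity
  have hq1 : q ^ 2 ≠ 1 := by nlinarith
  have hLd : Differentiable ℂ L := by
    have e : L = fun s => 1 + (q : ℂ) / ((q ^ 2 : ℕ) : ℂ) ^ s := funext hL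
    rw [e]
    exact (differentiable_div_natCast_cpow hq0 _).const_add 1
  refine ⟨fun s _ => (hLd.analyticAt s).meromorphicNFAt, ?_, ⟨0, L, hLd, ?_, by simp⟩, ?_⟩
  · refine ⟨fun n => if n = 1 then 1 else if n = q ^ 2 then q else 0, by simp, fun ε hε => ?_,
      fun s _ => ?_⟩
    · refine ⟨q, fun n hn => ?_⟩
      have h1 : (1 : ℝ) ≤ (n : ℝ) ^ ε := Real.one_le_rpow (by exact_mod_cast hn) hε.le
      have hq' : (1 : ℝ) ≤ q := by exact_mod_cast (by omega : 1 ≤ q)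
      have h2 : (q : ℝ) ≤ q * (n : ℝ) ^ ε := le_mul_of_one_le_right (by linarith) h1
      dsimp only
      split_ifs
      · simp only [norm_one]; linarith
      · simpa using h2
      · simp only [norm_zero]; linarith
    · rw [LSeries, tsum_eq_sum (s := {1, q ^ 2}), Finset.sum_pair hq1.symm,
        LSeries.term_of_ne_zero one_ne_zero, LSeries.term_of_ne_zero hq0, hL]
      · simp [show q ≠ 1 by omega]
      · intro n hn
        simp only [Finset.mem_insert, Finset.mem_singleton, not_or] at hn
        by_cases h0 : n = 0
        · simp [h0]
        · rw [LSeries.term_of_ne_zero h0]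
          simp [hn.1, hn.2]
  · refine lt_of_le_of_lt (nevanlinnaOrder_le hLd (x := 1)
      (C := Real.log 2 + Real.posLog ‖(q : ℂ)‖ + Real.log ((q ^ 2 : ℕ) : ℝ)) zero_le_one
      fun r hr => ?_) (EReal.coe_lt_top 1)
    refine proximity_top_le_of_forall hLd.meromorphic' (by linarith) fun z hz => ?_
    have h1 := Real.posLog_norm_add_le 1 ((q : ℂ) / ((q ^ 2 : ℕ) : ℂ) ^ z)
    have h2 := posLog_norm_div_natCast_cpow_le (N := q ^ 2) (by omega) q z
    rw [norm_one, Real.posLog_one] at h1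
    rw [hz] at h2
    rw [hL, Real.rpow_one]
    have h3 : 0 ≤ Real.log 2 := Real.log_nonneg (by norm_num)
    have h4 : 0 ≤ Real.posLog ‖(q : ℂ)‖ := Real.posLog_nonneg
    have h5 : 0 ≤ Real.log ((q ^ 2 : ℕ) : ℝ) := Real.log_natCast_nonneg _
    nlinarith
  · refine ⟨0, q, Fin.elim0, Fin.elim0, 1, by positivity, fun j => j.elim0, fun j => j.elim0,
      norm_one, Eventually.of_forall fun s => ?_⟩
    have hqc : (q : ℂ) ≠ 0 := by exact_mod_cast (by omega : q ≠ 0)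
    -- the completed function is `q ^ s + q ^ (1 - s)`
    have key : ∀ s, L s * (q : ℂ) ^ s = (q : ℂ) ^ s + (q : ℂ) ^ (1 - s) := fun s => by
      have h1 : (((q ^ 2 : ℕ) : ℂ)) ^ s = (q : ℂ) ^ s * (q : ℂ) ^ s := by
        rw [sq, Nat.cast_mul, Complex.natCast_mul_natCast_cpow]
      have h2 : (q : ℂ) ^ s ≠ 0 := by simp [Complex.cpow_eq_zero_iff, hqc]
      rw [hL, h1, Complex.cpow_sub _ _ hqc, Complex.cpow_one]
      field_simp
    have hconj : ∀ s : ℂ, starRingEnd ℂ ((q : ℂ) ^ s) = (q : ℂ) ^ starRingEnd ℂ s := fun s => by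
      rw [Complex.cpow_conj _ _ (by rw [Complex.natCast_arg]; exact Real.pi_pos.ne),
        Complex.conj_natCast]
    simp only [completedLFun, Finset.univ_eq_empty, Finset.prod_empty, mul_one, one_mul,
      Complex.ofReal_natCast, key, map_add, hconj, map_sub, map_one, Complex.conj_conj,
      sub_sub_cancel]
    ring

theorem zeroMultiplicity_eq_zero {F : ℂ → ℂ} (hF : Differentiable ℂ F) {s : ℂ} (hs : F s ≠ 0) :
    zeroMultiplicity F s = 0 := by
  rw [zeroMultiplicity, (hF.analyticAt s).meromorphicOrderAt_eq,
    (hF.analyticAt s).analyticOrderAt_eq_zero.2 hs]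
  simp

theorem sameZerosCM_of_ne_zero {F G : ℂ → ℂ} (hF : Differentiable ℂ F) (hG : Differentiable ℂ G)
    (hF0 : ∀ s, F s ≠ 0) (hG0 : ∀ s, G s ≠ 0) : SameZerosCM F G := fun s => by
  rw [zeroMultiplicity_eq_zero hF (hF0 s), zeroMultiplicity_eq_zero hG (hG0 s)]

theorem nevanlinnaOrder_le_one_of_eq_one_add_div_add_div {h : ℂ → ℂ}
    (hh : ∀ s, h s = 1 + 2 / (4 : ℂ) ^ s + 3 / (9 : ℂ) ^ s) : nevanlinnaOrder h ≤ 1 := by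
  have h4 := differentiable_div_natCast_cpow (N := 4) (by norm_num) 2
  have h9 := differentiable_div_natCast_cpow (N := 9) (by norm_num) 3
  push_cast at h4 h9
  have hd : Differentiable ℂ h := by
    rw [funext hh]
    exact (h4.const_add 1).add h9
  set C : ℝ := 2 * Real.log 2 + Real.posLog ‖(2 : ℂ)‖ + Real.posLog ‖(3 : ℂ)‖
    + Real.log 4 + Real.log 9 with hC
  refine nevanlinnaOrder_le hd (x := 1) (C := C) zero_le_one fun r hr => ?_
  refine proximity_top_le_of_forall hd.meromorphic' (by linarith) fun z hz => ?_
  have e1 := Real.posLog_norm_add_le (1 + 2 / (4 : ℂ) ^ z) (3 / (9 : ℂ) ^ z)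
  have e2 := Real.posLog_norm_add_le 1 (2 / (4 : ℂ) ^ z)
  have e3 := posLog_norm_div_natCast_cpow_le (N := 4) (by norm_num) 2 z
  have e4 := posLog_norm_div_natCast_cpow_le (N := 9) (by norm_num) 3 z
  push_cast at e3 e4
  rw [norm_one, Real.posLog_one] at e2
  rw [hz] at e3 e4
  rw [hh, Real.rpow_one]
  have i1 : 0 ≤ Real.log 2 := Real.log_nonneg (by norm_num)
  have i2 : 0 ≤ Real.posLog ‖(2 : ℂ)‖ := Real.posLog_nonneg
  have i3 : 0 ≤ Real.posLog ‖(3 : ℂ)‖ := Real.posLog_nonneg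
  have i4 : 0 ≤ Real.log 4 := Real.log_nonneg (by norm_num)
  have i5 : 0 ≤ Real.log 9 := Real.log_nonneg (by norm_num)
  have i6 : 0 ≤ (2 * Real.log 2 + Real.posLog ‖(2 : ℂ)‖ + Real.posLog ‖(3 : ℂ)‖) * r := by
    positivity
  rw [hC]
  linarith

theorem example_of_nevanlinnaOrder_eq_one {h L₁ L₂ : ℂ → ℂ}
    (h₁ : ∀ s, L₁ s = 1 + 2 / (4 : ℂ) ^ s) (h₂ : ∀ s, L₂ s = 1 + 3 / (9 : ℂ) ^ s)
    (hs : ∀ s, h s = L₁ s + L₂ s - 1) :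
    IsLFunction L₁ ∧ IsLFunction L₂ ∧ Differentiable ℂ h ∧ (¬ ∃ c : ℂ, ∀ s : ℂ, h s = c) ∧
      nevanlinnaOrder h = 1 ∧
      (∀ s, L₁ s - h s ≠ 0) ∧ (∀ s, L₂ s - h s ≠ 0) ∧
      SameZerosCM (fun s => L₁ s - h s) (fun s => L₂ s - h s) ∧ L₁ ≠ L₂ := by
  have hL₁ : IsLFunction L₁ := isLFunction_one_add_div (q := 2) le_rfl fun s => by
    rw [h₁]; norm_num
  have hL₂ : IsLFunction L₂ := isLFunction_one_add_div (q := 3) (by norm_num) fun s => by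
    rw [h₂]; norm_num
  have hh : ∀ s, h s = 1 + 2 / (4 : ℂ) ^ s + 3 / (9 : ℂ) ^ s := fun s => by
    rw [hs, h₁, h₂]; ring
  have d4 := differentiable_div_natCast_cpow (N := 4) (by norm_num) 2
  have d9 := differentiable_div_natCast_cpow (N := 9) (by norm_num) 3
  push_cast at d4 d9
  have hd : Differentiable ℂ h := by
    rw [funext hh]
    exact (d4.const_add 1).add d9
  have e₁ : ∀ s, L₁ s - h s = -(3 / (9 : ℂ) ^ s) := fun s => by rw [hh, h₁]; ring
  have e₂ : ∀ s, L₂ s - h s = -(2 / (4 : ℂ) ^ s) := fun s => by rw [hh, h₂]; ring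
  have n₁ : ∀ s, L₁ s - h s ≠ 0 := fun s => by
    rw [e₁]; simp [Complex.cpow_eq_zero_iff]
  have n₂ : ∀ s, L₂ s - h s ≠ 0 := fun s => by
    rw [e₂]; simp [Complex.cpow_eq_zero_iff]
  have v0 : h 0 = 6 := by rw [hh]; norm_num
  refine ⟨hL₁, hL₂, hd, ?_, le_antisymm (nevanlinnaOrder_le_one_of_eq_one_add_div_add_div hh) ?_, n₁, n₂,
    sameZerosCM_of_ne_zero ?_ ?_ n₁ n₂, fun hcon => ?_⟩
  · rintro ⟨c, hc⟩
    have h0 := hc 0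
    have h1 := hc 1
    rw [v0] at h0
    rw [hh, ← h0] at h1
    norm_num at h1
  · obtain ⟨K₁, hK₁0, hK₁⟩ := hL₁.exists_norm_sub_one_le
    obtain ⟨K₂, hK₂0, hK₂⟩ := hL₂.exists_norm_sub_one_le
    -- `(L₁ - h) / (L₂ - h) = (3 / 2) (4 / 9) ^ s`
    have hb : Complex.exp (Complex.log (3 / 2)) = 3 / 2 := Complex.exp_log (by norm_num)
    refine one_le_nevanlinnaOrder_of_eq_mul hd hK₁ hK₂ hK₁0 hK₂0 (w₀ := 0)
      (by rw [v0]; norm_num) (m := 0) (a := Complex.log 4 - Complex.log 9)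
      (b := Complex.log (3 / 2)) (z₀ := 0) (by simp [hb]; norm_num) fun s _ => ?_
    have p4 : (4 : ℂ) ^ s = Complex.exp (Complex.log 4 * s) :=
      Complex.cpow_def_of_ne_zero (by norm_num) s
    have p9 : (9 : ℂ) ^ s = Complex.exp (Complex.log 9 * s) :=
      Complex.cpow_def_of_ne_zero (by norm_num) s
    rw [e₁, e₂, p4, p9, Complex.exp_add, sub_mul, Complex.exp_sub, hb]
    have := Complex.exp_ne_zero (Complex.log 4 * s)
    have := Complex.exp_ne_zero (Complex.log 9 * s)
    field_simp
  · rw [funext e₁]; exact d9.neg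
  · rw [funext e₂]; exact d4.neg
  · have h1 := congrFun hcon 1
    rw [h₁, h₂] at h1
    norm_num at h1

end

/-- First part: the uniqueness theorem. Second part: the example with `ρ(h) = 1`. -/
theorem theorem1 :
    (∀ h L₁ L₂ : ℂ → ℂ, Differentiable ℂ h → (¬ ∃ c : ℂ, ∀ s : ℂ, h s = c) →
      nevanlinnaOrder h ≠ 1 → IsLFunction L₁ → IsLFunction L₂ →
      SameZerosCM (fun s => L₁ s - h s) (fun s => L₂ s - h s) → L₁ = L₂) ∧
    (∀ h L₁ L₂ : ℂ → ℂ, (∀ s, L₁ s = 1 + 2 / (4 : ℂ) ^ s) → (∀ s, L₂ s = 1 + 3 / (9 : ℂ) ^ s) →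
      (∀ s, h s = L₁ s + L₂ s - 1) →
      IsLFunction L₁ ∧ IsLFunction L₂ ∧ Differentiable ℂ h ∧ (¬ ∃ c : ℂ, ∀ s : ℂ, h s = c) ∧
      nevanlinnaOrder h = 1 ∧
      (∀ s, L₁ s - h s ≠ 0) ∧ (∀ s, L₂ s - h s ≠ 0) ∧
      SameZerosCM (fun s => L₁ s - h s) (fun s => L₂ s - h s) ∧ L₁ ≠ L₂) := by
  exact ⟨fun h L₁ L₂ hh hnc hord hL₁ hL₂ hz =>
    IsLFunction.eq_of_sameZerosCM hh hnc hord hL₁ hL₂ hz,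
    fun h L₁ L₂ h₁ h₂ hs => example_of_nevanlinnaOrder_eq_one h₁ h₂ hs⟩
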